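/- Let $V=\mathbb{C}[x_1,x_2,\dots]$, let $\alpha_n\in\operatorname{End}V$ be $n\,\partial/\partial x_n$ for $n>0$, $0$ for $n=0$, and multiplication by $x_{-n}$ for $n<0$, and put $\alpha(z)=\sum_{n\in\mathbb{Z}}\alpha_n z^{-n-1}$. For fields $A(z)=\sum_n A_{(n)}z^{-n-1}$ and $B(z)$ on $V$ let ${:}A(z)B(z){:}=\sum_{n<0}A_{(n)}z^{-n-1}B(z)+B(z)\sum_{n\ge 0}A_{(n)}z^{-n-1}$ (nested from the right) and $\partial^{(j)}=\partial_z^j/j!$. The free bosonic vertex algebra is $V$ with the products $a_{(n)}b$ given by $Y(a,z)b=\sum_n (a_{(n)}b)z^{-n-1}$, where $Y$ is linear in $a$ and $$Y(x_{i_1}\cdots x_{i_k},z)={:}\partial^{(i_1-1)}\alpha(z)\cdots\partial^{(i_k-1)}\alpha(z){:}\qquad(i_1\le\dots\le i_k),$$ in particular $Y(1,z)=\mathrm{id}$ and $Y(x_1,z)=\alpha(z)$; its vacuum vector is $1$. Let $\operatorname{Aut}V$ be the group of linear bijections $\sigma$ of $V$ with $\sigma(a_{(n)}b)=\sigma(a)_{(n)}\sigma(b)$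 for all $a,b\in V$, $n\in\mathbb{Z}$. Let $\operatorname{Aut}^0V$ be the subgroup of those with $\sigma(V^\Delta)=V^\Delta$ for all $\Delta\in\mathbb{C}$, where $V^\Delta$ is spanned by the monomials $x_{i_1}\cdots x_{i_k}$ with $i_1+\dots+i_k=\Delta$. For $m\ge 0$ let $\operatorname{Inn}_{(m)}V$ be the subgroup of $\operatorname{Aut}V$ generated by all automorphisms of the form $\exp(a_{(m)})=\sum_n (a_{(m)})^n/n!$ with $a\in V$ and $a_{(0)}=\dots=a_{(m-1)}=0$, where the exponential series is required, when applied to any vector, to have all its terms in a finite-dimensional subspace and to converge there; let $\operatorname{Inn}V$ be the union of the increasing sequence of subgroups $\operatorname{Inn}_{(m)}V$. **Theorem.** These products make $V$ a vertex algebra (they satisfy Borcherds' axioms with vacuum $1$), and its automorphism group is a semidirect product $$\operatorname{Aut}V=\operatorname{Inn}V\rtimes\operatorname{Aut}^0V,$$ i.e. $\operatorname{Inn}V$ is normal and every automorphism is uniquely a product of an element of $\operatorname{Inn}V$ and one of $\operatorname{Aut}^0V$. Moreover: 1. $\operatorname{Inn}V=\{\tau_a\mid a\in\mathbb{C}\}$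 with $\tau_a=\exp(a\,\partial/\partial x_1)$, and $a\mapsto\tau_a$ is an isomorphism of the additive group $\mathbb{C}$ onto $\operatorname{Inn}V$. 2. $\operatorname{Aut}^0V=\{\mathrm{id},\iota\}\cong\mathbb{Z}/2\mathbb{Z}$, where $\iota$ is an automorphism with $\iota(x_1)=-x_1$. 3. An automorphism $\sigma$ of $V$ is determined by $\sigma(x_1)$, and the vectors that occur as $\sigma(x_1)$ are exactly $a+x_1$ and $a-x_1$ with $a\in\mathbb{C}$. -/

import Mathlib

noncomputable section

namespace FreeBoson

/-! ### Fields on a complex vector space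

A field `A(z) = ∑ A_(n) z^(-n-1)` on `M` is Mathlib's `VertexOperator ℂ M`: for each `u`, the series
`A(z) u` is a Laurent series. Its Fourier mode `A_(n)` is `VertexOperator.ncoeff A n`. -/

section Fields

variable {M : Type*} [AddCommGroup M] [Module ℂ M]

/-- The Fourier mode `A_(n)`, the coefficient of `z^(-n-1)`. -/
abbrev mode (A : VertexOperator ℂ M) (n : ℤ) : Module.End ℂ M := VertexOperator.ncoeff A n

/-- The modes of a field on a given vector vanish for all large indices. -/
theorem mode_trunc (A : VertexOperator ℂ M) (u : M) : ∃ N : ℤ, ∀ n ≥ N, mode A n u = 0 := by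
  refine ⟨-(((HahnModule.of ℂ).symm (A u)).order), fun n hn => ?_⟩
  exact VertexOperator.ncoeff_eq_zero_of_lt_order A n u (by omega)

/-- The field with prescribed Fourier modes. -/
def ofModes (A : ℤ → Module.End ℂ M) (h : ∀ u, ∃ N : ℤ, ∀ n ≥ N, A n u = 0) :
    VertexOperator ℂ M :=
  VertexOperator.of_coeff (fun k => A (-k - 1)) (by
    intro u
    obtain ⟨N, hN⟩ := h u
    refine ⟨-N, fun k hk => ?_⟩
    by_contra hlt
    exact hk (hN _ (by omega)))

@[simp]
theorem mode_ofModes (A : ℤ → Module.End ℂ M) (h : ∀ u, ∃ N : ℤ, ∀ n ≥ N, A n u = 0) (n : ℤ) :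
    mode (ofModes A h) n = A n := by
  rw [mode, ofModes, VertexOperator.ncoeff_of_coeff]
  congr 1
  omega

/-- The identity field `I(z) = id`. -/
def idField : VertexOperator ℂ M :=
  ofModes (fun n => if n = -1 then LinearMap.id else 0)
    (fun u => ⟨0, fun n hn => by rw [if_neg (by omega)]; rfl⟩)

/-- The derivative `∂A(z) = ∑ (-n-1) A_(n) z^(-n-2)`, that is `(∂A)_(n) = -n A_(n-1)`. -/
def derivField (A : VertexOperator ℂ M) : VertexOperator ℂ M :=
  ofModes (fun n => (-(n : ℂ)) • mode A (n - 1)) (by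
    intro u
    obtain ⟨N, hN⟩ := mode_trunc A u
    exact ⟨N + 1, fun n hn => by simp [hN (n - 1) (by omega)]⟩)

/-- The divided power derivative `∂^(j) A = ∂^j A / j!`. -/
def divDeriv (j : ℕ) (A : VertexOperator ℂ M) : VertexOperator ℂ M :=
  ((j.factorial : ℂ)⁻¹) • (derivField^[j] A)

theorem support_creation (A B : VertexOperator ℂ M) (n : ℤ) (u : M) :
    (Function.support fun j : ℕ => mode A (-(j : ℤ) - 1) (mode B (n + j) u)).Finite := by
  obtain ⟨N, hN⟩ := mode_trunc B u
  refine (Set.finite_lt_nat (N - n).toNat).subset fun j hj => ?_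
  by_contra hlt
  simp only [Set.mem_ofPred_eq, not_lt] at hlt
  exact hj (by simp only [hN (n + j) (by omega), map_zero])

theorem support_annihilation (A B : VertexOperator ℂ M) (n : ℤ) (u : M) :
    (Function.support fun j : ℕ => mode B (n - 1 - j) (mode A j u)).Finite := by
  obtain ⟨N, hN⟩ := mode_trunc A u
  refine (Set.finite_lt_nat N.toNat).subset fun j hj => ?_
  by_contra hlt
  simp only [Set.mem_ofPred_eq, not_lt] at hlt
  exact hj (by simp only [hN j (by omega), map_zero])

/-- The `n`-th Fourier mode of `A(z)_- B(z) + B(z) A(z)_+`, where `A(z)_-` collects the modes of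
negative index and `A(z)_+` those of nonnegative index; both sums have finitely many nonzero
terms. -/
def normalMode (A B : VertexOperator ℂ M) (n : ℤ) : Module.End ℂ M where
  toFun u := (∑ᶠ j : ℕ, mode A (-(j : ℤ) - 1) (mode B (n + j) u)) +
    ∑ᶠ j : ℕ, mode B (n - 1 - j) (mode A j u)
  map_add' u v := by
    simp only [map_add]
    rw [finsum_add_distrib (support_creation A B n u) (support_creation A B n v),
      finsum_add_distrib (support_annihilation A B n u) (support_annihilation A B n v)]
    abel
  map_smul' c u := by
    simp only [map_smul, RingHom.id_apply, smul_add]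
    rw [smul_finsum, smul_finsum]

/-- The normally ordered product `:A(z)B(z): = A(z)_- B(z) + B(z) A(z)_+`. -/
def normalProd (A B : VertexOperator ℂ M) : VertexOperator ℂ M :=
  ofModes (normalMode A B) (by
    intro u
    obtain ⟨NB, hNB⟩ := mode_trunc B u
    obtain ⟨NA, hNA⟩ := mode_trunc A u
    choose K hK using fun j : ℕ => mode_trunc B (mode A j u)
    refine ⟨max NB (∑ j ∈ Finset.range NA.toNat, (|K j| + 1 + j)), fun n hn => ?_⟩
    have h0 : NB ≤ n := (le_max_left _ _).trans hn
    have h0' : ∑ j ∈ Finset.range NA.toNat, (|K j| + 1 + (j : ℤ)) ≤ n := (le_max_right _ _).trans hn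
    have h1 : ∀ j : ℕ, mode A (-(j : ℤ) - 1) (mode B (n + j) u) = 0 := fun j => by
      rw [hNB (n + j) (by omega), map_zero]
    have h2 : ∀ j : ℕ, mode B (n - 1 - j) (mode A j u) = 0 := fun j => by
      by_cases hj : j < NA.toNat
      · refine hK j _ ?_
        have h3 := Finset.single_le_sum
          (f := fun j : ℕ => (|K j| + 1 + (j : ℤ))) (s := Finset.range NA.toNat)
          (fun i _ => by positivity) (Finset.mem_range.2 hj)
        have h5 := le_abs_self (K j)
        have h4 := h3.trans h0'
        omega
      · rw [hNA j (by omega), map_zero]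
    simp [normalMode, h1, h2])

end Fields

/-! ### Vertex algebras and their automorphisms

The products of a vertex algebra are encoded by the state-field map `Y`, with
`a_(n) b = mode (Y a) n b`; bilinearity of the products is the linearity of `Y` and of the modes. -/

section VertexAlgebras

variable {V : Type*} [AddCommGroup V] [Module ℂ V]

/-- Borcherds' axioms for a vertex algebra with vacuum vector `vac`. All the sums in the Borcherds
identity have finitely many nonzero terms. -/
structure IsVertexAlgebra (Y : V →ₗ[ℂ] VertexOperator ℂ V) (vac : V) : Prop where
  truncation : ∀ a b : V, ∃ N : ℤ, ∀ n ≥ N, mode (Y a) n b = 0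
  borcherds : ∀ (a b c : V) (k l m : ℤ),
    ∑ᶠ i : ℕ, ((Ring.choose k i : ℤ) : ℂ) •
        mode (Y (mode (Y a) (m + i) b)) (k + l - i) c =
      ∑ᶠ i : ℕ, ((-1 : ℂ) ^ i * ((Ring.choose m i : ℤ) : ℂ)) •
        (mode (Y a) (k + m - i) (mode (Y b) (l + i) c) -
          (-1 : ℂ) ^ m • mode (Y b) (l + m - i) (mode (Y a) (k + i) c))
  vacuum_nonneg : ∀ (a : V) (n : ℤ), 0 ≤ n → mode (Y a) n vac = 0
  vacuum_neg_one : ∀ a : V, mode (Y a) (-1) vac = a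

/-- `Aut V`: the linear bijections that preserve all the products. -/
def Aut (Y : V →ₗ[ℂ] VertexOperator ℂ V) : Subgroup (V ≃ₗ[ℂ] V) where
  carrier := {σ | ∀ (a b : V) (n : ℤ), σ (mode (Y a) n b) = mode (Y (σ a)) n (σ b)}
  one_mem' := fun _ _ _ => rfl
  mul_mem' := fun {σ ρ} hσ hρ a b n => by
    rw [LinearEquiv.mul_apply, hρ, hσ]; rfl
  inv_mem' := fun {σ} hσ a b n => by
    change σ.symm _ = _
    apply σ.injective
    rw [hσ, σ.apply_symm_apply]
    change _ = mode (Y (σ (σ.symm a))) n (σ (σ.symm b))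
    rw [σ.apply_symm_apply, σ.apply_symm_apply]

/-- `σ = exp D = ∑ Dⁿ / n!`: for each `v` the vectors `Dⁿ v` lie in a finite dimensional subspace,
and the exponential series of `D` on `v` converges to `σ v` (convergence in a finite dimensional
complex vector space is convergence under all linear functionals). This includes the locally
nilpotent case, where the series is a finite sum. -/
def IsExp (D σ : Module.End ℂ V) : Prop :=
  ∀ v : V, (∃ W : Submodule ℂ V, FiniteDimensional ℂ W ∧ ∀ n : ℕ, (D ^ n) v ∈ W) ∧
    ∀ φ : Module.Dual ℂ V, HasSum (fun n : ℕ => ((n.factorial : ℂ)⁻¹) * φ ((D ^ n) v)) (φ (σ v))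

/-- `Inn_(m) V`: the group generated by the inner automorphisms of level `m`, that is the
automorphisms `exp (a_(m))` where `a_(0) = ⋯ = a_(m-1) = 0`. -/
def InnLevel (Y : V →ₗ[ℂ] VertexOperator ℂ V) (m : ℕ) : Subgroup (Aut Y) :=
  Subgroup.closure {σ | ∃ a : V, (∀ j : ℕ, j < m → mode (Y a) j = 0) ∧
    IsExp (mode (Y a) m) ((σ : V ≃ₗ[ℂ] V) : V →ₗ[ℂ] V)}

/-- `Inn V`: the union of the increasing sequence of the groups `Inn_(m) V`, written as their
supremum. -/
def Inn (Y : V →ₗ[ℂ] VertexOperator ℂ V) : Subgroup (Aut Y) := ⨆ m : ℕ, InnLevel Y m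

/-- `Aut⁰ V`: the automorphisms `σ` with `σ (V^Δ) = V^Δ` for all complex `Δ`. -/
def AutZero (Y : V →ₗ[ℂ] VertexOperator ℂ V) (gr : ℂ → Submodule ℂ V) : Subgroup (Aut Y) where
  carrier := {σ | ∀ Δ : ℂ, (gr Δ).map ((σ : V ≃ₗ[ℂ] V) : V →ₗ[ℂ] V) = gr Δ}
  one_mem' := fun Δ => Submodule.map_id _
  mul_mem' := fun {σ ρ} hσ hρ Δ => by
    have h : (gr Δ).map (((σ * ρ : Aut Y) : V ≃ₗ[ℂ] V) : V →ₗ[ℂ] V) =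
        ((gr Δ).map ((ρ : V ≃ₗ[ℂ] V) : V →ₗ[ℂ] V)).map ((σ : V ≃ₗ[ℂ] V) : V →ₗ[ℂ] V) :=
      Submodule.map_comp _ _ _
    rw [h, hρ, hσ]
  inv_mem' := fun {σ} hσ Δ => by
    have h : ((gr Δ).map ((σ : V ≃ₗ[ℂ] V) : V →ₗ[ℂ] V)).map
        (((σ⁻¹ : Aut Y) : V ≃ₗ[ℂ] V) : V →ₗ[ℂ] V) = gr Δ := by
      rw [← Submodule.map_comp]
      have h' : ((((σ⁻¹ : Aut Y) : V ≃ₗ[ℂ] V) : V →ₗ[ℂ] V) ∘ₗ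
          ((σ : V ≃ₗ[ℂ] V) : V →ₗ[ℂ] V)) = LinearMap.id :=
        LinearMap.ext fun v => (σ : V ≃ₗ[ℂ] V).symm_apply_apply v
      rw [h', Submodule.map_id]
    rwa [hσ] at h

end VertexAlgebras

/-! ### The free bosonic vertex algebra -/

/-- The Fock space of charge `0`: the polynomial ring `ℂ[x₁, x₂, …]`. -/
abbrev Fock : Type := MvPolynomial ℕ+ ℂ

/-- The variable `x_n`, for `n ≥ 1`. -/
abbrev x (n : ℕ+) : Fock := MvPolynomial.X n

/-- The action of the Heisenberg generators on the Fock space of charge `0`: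
`α_n = n ∂/∂x_n` for `n > 0`, `α_0 = 0`, and `α_n` is multiplication by `x_{-n}` for `n < 0`. -/
def alphaMode : ℤ → Module.End ℂ Fock
  | Int.ofNat 0 => 0
  | Int.ofNat (k + 1) => ((k + 1 : ℕ) : ℂ) • (MvPolynomial.pderiv k.succPNat).toLinearMap
  | Int.negSucc k => LinearMap.mulLeft ℂ (x k.succPNat)

/-- The Heisenberg field `α(z) = ∑ α_n z^(-n-1)`. -/
def alpha : VertexOperator ℂ Fock :=
  ofModes alphaMode (by
    intro u
    refine ⟨((u.vars.sup fun i : ℕ+ => (i : ℕ)) : ℕ) + 1, fun n hn => ?_⟩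
    obtain ⟨k, rfl⟩ : ∃ k : ℕ, n = Int.ofNat (k + 1) :=
      ⟨(n - 1).toNat, by simp only [Int.ofNat_eq_natCast]; omega⟩
    have hk : k.succPNat ∉ u.vars := fun hmem => by
      have := Finset.le_sup (f := fun i : ℕ+ => (i : ℕ)) hmem
      simp only [Nat.succPNat_coe, Int.ofNat_eq_natCast] at this hn
      omega
    change ((k + 1 : ℕ) : ℂ) • MvPolynomial.pderiv k.succPNat u = 0
    rw [MvPolynomial.pderiv_eq_zero_of_notMem_vars hk, smul_zero])

/-- The nested normally ordered product `:∂^(i₁-1)α(z) ⋯ ∂^(iₖ-1)α(z):`. -/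
def wickField : List ℕ+ → VertexOperator ℂ Fock
  | [] => idField
  | i :: is => normalProd (divDeriv ((i : ℕ) - 1) alpha) (wickField is)

/-- The state-field correspondence of the free bosonic vertex algebra, the linear map with
`Y(x_{i₁} ⋯ x_{iₖ}, z) = :∂^(i₁-1)α(z) ⋯ ∂^(iₖ-1)α(z):` for `i₁ ≤ ⋯ ≤ iₖ`. -/
def Y : Fock →ₗ[ℂ] VertexOperator ℂ Fock :=
  (MvPolynomial.basisMonomials ℕ+ ℂ).constr ℂ fun d => wickField (d.toMultiset.sort (· ≤ ·))

/-- The standard gradation: `V^Δ` is spanned by the monomials `x_{i₁} ⋯ x_{iₖ}` with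
`i₁ + ⋯ + iₖ = Δ`; it is zero unless `Δ` is a natural number. -/
def stdGrading (Δ : ℂ) : Submodule ℂ Fock :=
  MvPolynomial.weightedHomogeneousSubmodule ℂ (fun n : ℕ+ => ((n : ℕ) : ℂ)) Δ

end FreeBoson

end

/-! That the products form a vertex algebra is proved by reconstruction. The Heisenberg relations
make `alpha` local with itself, and Dong's lemma (`IsLocal.nthProd`) spreads locality to all the
fields `Y a`, because nested normally ordered products are iterated products of negative index. Each
`Y a` is translation covariant and creates `a` from the vacuum. By Goddard's uniqueness theorem
(`Creates.unique`) the field of `a_(m) b` is then the `m`-th product of the fields of `a` and `b`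
(`mode_mode_eq_nthProd`). This is the Borcherds identity for `k = 0`, and a recursion shared by both
sides gives the rest (`borcherds_of_local`). Formal distributions are treated as functions of their
indices. Negative powers of `z - w` are controlled by the injectivity of multiplication by `z - w`
on distributions bounded in the second index.

For the automorphisms, the substitutions `x₁ ↦ εx₁ + a`, `x_i ↦ εx_i` with `ε² = 1` preserve the
products. To see that there are no others, let `g = σ(x₁)`. An automorphism fixes `1`, commutes with
the translation operator `T` and is determined by `g`. Up to lower polynomial degree, `a_(-1) b` is
`ab` (`mode_Y_leading`), so to leading order `σ` is the substitution `x_i ↦ T^(i-1) H / (i-1)!`,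
with `H` the top homogeneous component of `g`. A nonconstant `H` is differentially transcendental
(`substHom_injective`), so if `deg g ≥ 2` then `σ` multiplies degrees by `deg g`, and `x₁` could not
be an image. Hence `g = P(T) x₁ + c`. The inverse has the same shape, so `P` is a unit of `ℂ[T]`,
that is, a constant `ε`, and `x₁_(1) x₁ = 1` forces `ε² = 1`.

For the inner automorphisms, a generator `exp(a_(m))` is the square of `exp(a_(m)/2)`, which is
again an automorphism because `a_(m)` is a derivation of all products. Squares have sign `ε² = 1`,
so every inner automorphism is some `τ_a`. Conversely `τ_a` is the exponential of `(a x₁)_(1) = a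
∂/∂x₁`, and `(a x₁)_(0) = 0`. The semidirect product is then read off from pairs `(ε, a)`. -/

noncomputable section

namespace FreeBoson

/-! ### Expansions of `(z - w)^m` applied to formal distributions -/

section Expansion

variable {ι ι' V V' : Type*} [AddCommGroup V] [Module ℂ V] [AddCommGroup V'] [Module ℂ V']

/-- The shift of the first index, that is multiplication by `z`. -/
def shiftL : Module.End ℂ (ℤ → ℤ → ι → V) where
  toFun F k l r := F (k + 1) l r
  map_add' _ _ := rfl
  map_smul' _ _ := rfl

/-- The shift of the second index, that is multiplication by `w`. -/
def shiftR : Module.End ℂ (ℤ → ℤ → ι → V) where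
  toFun F k l r := F k (l + 1) r
  map_add' _ _ := rfl
  map_smul' _ _ := rfl

/-- Multiplication of a formal distribution by `z - w`. -/
def diff : Module.End ℂ (ℤ → ℤ → ι → V) := shiftL - shiftR

theorem diff_apply (F : ℤ → ℤ → ι → V) (k l : ℤ) (r : ι) :
    diff F k l r = F (k + 1) l r - F k (l + 1) r := rfl

/-- The interchange of the first two indices. -/
def swapIdx : (ℤ → ℤ → ι → V) →ₗ[ℂ] (ℤ → ℤ → ι → V) where
  toFun F k l r := F l k r
  map_add' _ _ := rfl
  map_smul' _ _ := rfl

theorem swapIdx_apply (F : ℤ → ℤ → ι → V) (k l : ℤ) (r : ι) : swapIdx F k l r = F l k r := rfl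

theorem diff_swapIdx (F : ℤ → ℤ → ι → V) : diff (swapIdx F) = -swapIdx (diff F) := by
  funext k l r
  simp [diff_apply, swapIdx_apply]

theorem diff_pow_swapIdx (F : ℤ → ℤ → ι → V) (n : ℕ) :
    (diff ^ n) (swapIdx F) = (-1 : ℂ) ^ n • swapIdx ((diff ^ n) F) := by
  induction n with
  | zero => simp
  | succ n ih =>
    rw [pow_succ', Module.End.mul_apply, ih, map_smul, diff_swapIdx, Module.End.mul_apply, pow_succ]
    simp

/-- The coefficients vanish for large second index, uniformly in the first. -/
def BddR (F : ℤ → ℤ → ι → V) : Prop := ∀ r, ∃ Q : ℤ, ∀ l ≥ Q, ∀ k, F k l r = 0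

omit [Module ℂ V] in
theorem BddR.sub {F G : ℤ → ℤ → ι → V} (hF : BddR F) (hG : BddR G) : BddR (F - G) := by
  intro r
  obtain ⟨P, hP⟩ := hF r
  obtain ⟨Q, hQ⟩ := hG r
  refine ⟨max P Q, fun l hl k => ?_⟩
  change F k l r - G k l r = 0
  rw [hP l (le_trans (le_max_left _ _) hl), hQ l (le_trans (le_max_right _ _) hl), sub_zero]

theorem BddR.diff {F : ℤ → ℤ → ι → V} (hF : BddR F) : BddR (diff F) := by
  intro r
  obtain ⟨Q, hQ⟩ := hF r
  exact ⟨Q, fun l hl k => by rw [diff_apply, hQ l hl, hQ (l + 1) (by omega), sub_zero]⟩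

theorem BddR.diff_pow {F : ℤ → ℤ → ι → V} (hF : BddR F) (n : ℕ) :
    BddR ((FreeBoson.diff ^ n) F) := by
  induction n with
  | zero => simpa using hF
  | succ n ih => rw [pow_succ', Module.End.mul_apply]; exact ih.diff

/-- If `z - w` kills `F`, its coefficients are constant along the lines `k + l = const`. Following
such a line towards large `l` reaches a zero coefficient. -/
theorem BddR.eq_zero_of_diff {F : ℤ → ℤ → ι → V} (hF : BddR F)
    (h : FreeBoson.diff F = 0) : F = 0 := by
  funext k l r
  obtain ⟨Q, hQ⟩ := hF r
  have key : ∀ n : ℕ, F k l r = F (k - n) (l + n) r := by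
    intro n
    induction n with
    | zero => simp
    | succ n ih =>
      have := congrFun (congrFun (congrFun h (k - n - 1)) (l + n)) r
      rw [diff_apply] at this
      simp only [sub_add_cancel, Pi.zero_apply] at this
      rw [ih, sub_eq_zero.1 this, Nat.cast_succ, ← sub_sub, ← add_assoc]
  rw [key (Q - l).toNat, hQ _ (by omega)]
  rfl

theorem BddR.eq_zero_of_diff_pow {F : ℤ → ℤ → ι → V} (hF : BddR F) {n : ℕ}
    (h : (FreeBoson.diff ^ n) F = 0) : F = 0 := by
  induction n with
  | zero => simpa using h
  | succ n ih =>
    rw [pow_succ', Module.End.mul_apply] at h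
    exact ih ((hF.diff_pow n).eq_zero_of_diff h)

/-- The product of a formal distribution with `(z - w)^m`, expanded for `|z| > |w|`. -/
def expand (m : ℤ) (F : ℤ → ℤ → ι → V) : ℤ → ℤ → ι → V := fun k l r =>
  ∑ᶠ i : ℕ, ((-1 : ℂ) ^ i * ((Ring.choose m i : ℤ) : ℂ)) • F (k + m - i) (l + i) r

theorem BddR.support {F : ℤ → ℤ → ι → V} (hF : BddR F) (c : ℕ → ℂ) (f : ℕ → ℤ) (l : ℤ) (r : ι) :
    (Function.support fun i : ℕ => c i • F (f i) (l + i) r).Finite := by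
  obtain ⟨Q, hQ⟩ := hF r
  refine (Set.finite_lt_nat (Q - l).toNat).subset fun j hj => ?_
  by_contra hlt
  simp only [Set.mem_ofPred_eq, not_lt] at hlt
  exact hj (by simp only [hQ (l + j) (by omega), smul_zero])

theorem BddR.expand {F : ℤ → ℤ → ι → V} (hF : BddR F) (m : ℤ) : BddR (expand m F) := by
  intro r
  obtain ⟨Q, hQ⟩ := hF r
  refine ⟨Q, fun l hl k => ?_⟩
  simp only [FreeBoson.expand]
  rw [finsum_eq_zero_of_forall_eq_zero fun i => by rw [hQ (l + i) (by omega), smul_zero]]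

theorem expand_zero (F : ℤ → ℤ → ι → V) : expand 0 F = F := by
  funext k l r
  rw [expand, finsum_eq_single _ 0 fun i hi => ?_]
  · simp
  · rw [Ring.choose_zero_pos ℤ (Nat.pos_of_ne_zero hi)]; simp

theorem expand_sub {F G : ℤ → ℤ → ι → V} (hF : BddR F) (hG : BddR G) (m : ℤ) :
    expand m (F - G) = expand m F - expand m G := by
  funext k l r
  simp only [expand, Pi.sub_apply, smul_sub]
  exact finsum_sub_distrib (hF.support _ _ _ _) (hG.support _ _ _ _)

theorem finsum_nat_eq_add_succ {M : Type*} [AddCommMonoid M] (f : ℕ → M)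
    (hf : (Function.support f).Finite) : ∑ᶠ i, f i = f 0 + ∑ᶠ i, f (i + 1) := by
  have h1 : (Function.support fun i => f (i + 1)).Finite :=
    hf.preimage (Function.Injective.injOn (add_left_injective 1)) |>.subset fun i hi => hi
  obtain ⟨N, hN⟩ := hf.bddAbove
  rw [finsum_eq_sum_of_support_subset (s := Finset.range (N + 2)) f (fun i hi => by
      have := hN hi; simp; omega),
    finsum_eq_sum_of_support_subset (s := Finset.range (N + 1)) _ (fun i hi => by
      have := hN (show i + 1 ∈ Function.support f from hi); simp; omega),
    Finset.sum_range_succ', add_comm]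

/-- Pascal's rule for the generalized binomial coefficients. -/
theorem expand_succ {F : ℤ → ℤ → ι → V} (hF : BddR F) (m : ℤ) :
    expand (m + 1) F = diff (expand m F) := by
  funext k l r
  rw [diff_apply]
  simp only [expand]
  rw [finsum_nat_eq_add_succ _ (hF.support _ _ _ _),
    finsum_nat_eq_add_succ (fun i : ℕ => ((-1 : ℂ) ^ i * ((Ring.choose m i : ℤ) : ℂ)) •
      F (k + 1 + m - i) (l + i) r) (hF.support _ _ _ _),
    add_sub_assoc (_ • _) (finsum _) (finsum _), ← finsum_sub_distrib]
  · congr 1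
    · simp [show k + (m + 1) = k + 1 + m by ring]
    · refine finsum_congr fun i => ?_
      have e1 : k + (m + 1) - ((i + 1 : ℕ) : ℤ) = k + m - i := by push_cast; ring
      have e2 : k + 1 + m - ((i + 1 : ℕ) : ℤ) = k + m - i := by push_cast; ring
      have e3 : l + ((i + 1 : ℕ) : ℤ) = l + 1 + i := by push_cast; ring
      rw [e1, e2, e3, ← sub_smul, Ring.choose_succ_succ]
      congr 1
      push_cast
      ring
  · refine (hF.support (fun i => (-1 : ℂ) ^ (i + 1) * ((Ring.choose m (i + 1) : ℤ) : ℂ))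
      (fun i => k + 1 + m - ((i + 1 : ℕ) : ℤ)) (l + 1) r).subset fun i hi => ?_
    have e3 : l + ((i + 1 : ℕ) : ℤ) = l + 1 + i := by push_cast; ring
    simp only [Function.mem_support, e3] at hi ⊢
    exact hi
  · exact hF.support _ _ _ _

theorem expand_add_nat {F : ℤ → ℤ → ι → V} (hF : BddR F) (m : ℤ) (n : ℕ) :
    expand (m + n) F = (diff ^ n) (expand m F) := by
  induction n with
  | zero => simp
  | succ n ih =>
    rw [pow_succ', Module.End.mul_apply, ← ih, ← expand_succ hF]
    congr 1; push_cast; ring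

theorem expand_natCast {F : ℤ → ℤ → ι → V} (hF : BddR F) (n : ℕ) :
    expand n F = (diff ^ n) F := by
  have := expand_add_nat hF 0 n
  rwa [zero_add, expand_zero] at this

theorem pow_intertwine {X X' : Type*} [AddCommGroup X] [Module ℂ X] [AddCommGroup X'] [Module ℂ X']
    {D : Module.End ℂ X} {D' : Module.End ℂ X'} {L : X → X'} (h : ∀ x, L (D x) = D' (L x))
    (n : ℕ) (x : X) : L ((D ^ n) x) = (D' ^ n) (L x) := by
  induction n with
  | zero => simp
  | succ n ih => rw [pow_succ', Module.End.mul_apply, h, ih, pow_succ', Module.End.mul_apply]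

/-- The expansion of `(z - w)^m` commutes with all operations that commute with `z - w`. -/
theorem expand_intertwine {L : (ℤ → ℤ → ι → V) → (ℤ → ℤ → ι' → V')}
    (hL : ∀ F, BddR F → BddR (L F)) (hd : ∀ F, L (diff F) = diff (L F))
    {F : ℤ → ℤ → ι → V} (hF : BddR F) (m : ℤ) : expand m (L F) = L (expand m F) := by
  obtain ⟨n, rfl | rfl⟩ := m.eq_nat_or_neg
  · rw [expand_natCast hF, expand_natCast (hL F hF), pow_intertwine hd]
  -- For exponent `-n` both sides become `L F` after multiplication by `(z - w)^n`, which is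
  -- injective on distributions bounded in the second index.
  · rw [← sub_eq_zero]
    refine (((hL F hF).expand _).sub (hL _ (hF.expand _))).eq_zero_of_diff_pow (n := n) ?_
    rw [map_sub, ← pow_intertwine hd, ← expand_add_nat hF, ← expand_add_nat (hL F hF)]
    simp [expand_zero]

/-- `i_{z,w} (z - w)^m F - i_{w,z} (z - w)^m G`, where `i_{z,w}` is the expansion for
`|z| > |w|`. -/
def residue (m : ℤ) (F G : ℤ → ℤ → ι → V) : ℤ → ℤ → ι → V :=
  expand m F - (-1 : ℂ) ^ m • swapIdx (expand m (swapIdx G))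

theorem residue_apply (m : ℤ) (F G : ℤ → ℤ → ι → V) (k l : ℤ) (r : ι) :
    residue m F G k l r = (∑ᶠ i : ℕ, ((-1 : ℂ) ^ i * ((Ring.choose m i : ℤ) : ℂ)) •
      F (k + m - i) (l + i) r) - (-1 : ℂ) ^ m • ∑ᶠ i : ℕ,
        ((-1 : ℂ) ^ i * ((Ring.choose m i : ℤ) : ℂ)) • G (k + i) (l + m - i) r := rfl

/-- Swapping the indices turns `z - w` into `w - z`; the sign `(-1)^n` this produces is absorbed by
the factor `(-1)^m` in front of the second expansion. -/
theorem residue_add_nat {F G : ℤ → ℤ → ι → V} (hF : BddR F) (hG : BddR (swapIdx G)) (m : ℤ)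
    (n : ℕ) : residue (m + n) F G = (diff ^ n) (residue m F G) := by
  rw [residue, residue, map_sub, map_smul, diff_pow_swapIdx, expand_add_nat hF, expand_add_nat hG,
    smul_smul, zpow_add₀ (by norm_num), zpow_natCast]

theorem residue_zero (F G : ℤ → ℤ → ι → V) : residue 0 F G = F - G := by
  rw [residue, expand_zero, expand_zero]
  simp only [zpow_zero, one_smul]
  rfl

theorem residue_natCast {F G : ℤ → ℤ → ι → V} (hF : BddR F) (hG : BddR (swapIdx G)) (n : ℕ) :
    residue n F G = (diff ^ n) (F - G) := by
  have := residue_add_nat hF hG 0 n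
  rwa [zero_add, residue_zero] at this

/-- The two expansions are taken in opposite index orders, so `L` has to preserve boundedness in
both of them. -/
theorem residue_intertwine (L : (ℤ → ℤ → ι → V) →ₗ[ℂ] (ℤ → ℤ → ι' → V'))
    (hL : ∀ F, BddR F → BddR (L F)) (hd : ∀ F, L (diff F) = diff (L F))
    (hL' : ∀ F, BddR F → BddR (swapIdx (L (swapIdx F))))
    {F G : ℤ → ℤ → ι → V} (hF : BddR F) (hG : BddR (swapIdx G)) (m : ℤ) :
    residue m (L F) (L G) = L (residue m F G) := by
  have hd' : ∀ F, swapIdx (L (swapIdx (diff F))) = diff (swapIdx (L (swapIdx F))) := by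
    intro F
    rw [diff_swapIdx, ← hd, ← map_neg, ← map_neg]
    rw [diff_swapIdx, neg_neg]
  have := expand_intertwine (L := fun F => swapIdx (L (swapIdx F))) hL' hd' hG m
  rw [residue, residue, map_sub, map_smul, expand_intertwine hL hd hF]
  congr 2
  change expand m (swapIdx (L G)) = _ at this
  rw [this]
  rfl

theorem residue_sub {F G F' G' : ℤ → ℤ → ι → V} (hF : BddR F) (hG : BddR (swapIdx G))
    (hF' : BddR F') (hG' : BddR (swapIdx G')) (m : ℤ) :
    residue m (F - F') (G - G') = residue m F G - residue m F' G' := by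
  rw [residue, residue, residue, map_sub, expand_sub hF hF', expand_sub hG hG', map_sub, smul_sub]
  abel

end Expansion

end FreeBoson
end
noncomputable section

namespace FreeBoson

/-! ### Locality, Dong's lemma and the reconstruction theorem -/

section Locality

variable {V : Type*} [AddCommGroup V] [Module ℂ V]

/-- The products `A_(k) B_(l) u`. -/
def modeProd (A B : ℤ → V → V) : ℤ → ℤ → V → V := fun k l u => A k (B l u)

/-- The commutators `[A_(k), B_(l)] u`. -/
def modeComm (A B : ℤ → V → V) : ℤ → ℤ → V → V := fun k l u => A k (B l u) - B l (A k u)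

/-- Mutual locality: `(z - w)^N [A(z), B(w)] = 0` for some `N`. -/
def IsLocal (A B : ℤ → V → V) : Prop := ∃ N : ℕ, (diff ^ N) (modeComm A B) = 0

theorem diff_pow_eq_zero_of_le {ι : Type*} {F : ℤ → ℤ → ι → V} {M N : ℕ} (h : M ≤ N)
    (hF : (diff ^ M) F = 0) : (diff ^ N) F = 0 := by
  obtain ⟨j, rfl⟩ := Nat.exists_eq_add_of_le' h
  rw [pow_add, Module.End.mul_apply, hF, map_zero]

theorem IsLocal.symm {A B : ℤ → V → V} (h : IsLocal A B) : IsLocal B A := by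
  obtain ⟨N, hN⟩ := h
  refine ⟨N, ?_⟩
  have : modeComm B A = -swapIdx (modeComm A B) := by
    funext k l u
    simp [modeComm, swapIdx_apply]
  rw [this, map_neg, diff_pow_swapIdx, hN, map_zero, smul_zero, neg_zero]

theorem IsLocal.sub_left {A A' : ℤ → V → V} {B : ℤ → Module.End ℂ V}
    (h : IsLocal A fun n => B n) (h' : IsLocal A' fun n => B n) :
    IsLocal (A - A') fun n => B n := by
  obtain ⟨N, hN⟩ := h
  obtain ⟨N', hN'⟩ := h'
  refine ⟨max N N', ?_⟩
  have : modeComm (A - A') (fun n => B n) =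
      modeComm A (fun n => B n) - modeComm A' (fun n => B n) := by
    funext k l u
    simp only [modeComm, Pi.sub_apply, map_sub]
    abel
  rw [this, map_sub, diff_pow_eq_zero_of_le (le_max_left _ _) hN,
    diff_pow_eq_zero_of_le (le_max_right _ _) hN', sub_zero]

theorem IsLocal.smul_left {A : ℤ → V → V} {B : ℤ → Module.End ℂ V} (c : ℂ)
    (h : IsLocal A fun n => B n) : IsLocal (c • A) fun n => B n := by
  obtain ⟨N, hN⟩ := h
  refine ⟨N, ?_⟩
  have : modeComm (c • A) (fun n => B n) = c • modeComm A (fun n => B n) := by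
    funext k l u
    simp only [modeComm, Pi.smul_apply, map_smul, smul_sub]
  rw [this, map_smul, hN, smul_zero]

theorem IsLocal.add_left {A A' : ℤ → V → V} {B : ℤ → Module.End ℂ V}
    (h : IsLocal A fun n => B n) (h' : IsLocal A' fun n => B n) :
    IsLocal (A + A') fun n => B n := by
  have := h.sub_left (h'.smul_left (-1))
  simpa using this

/-- A family of modes that vanish on a given vector for all large indices. -/
def Truncated (A : ℤ → V → V) : Prop := ∀ u, ∃ N : ℤ, ∀ n ≥ N, A n u = 0

theorem BddR.modeProd {A : ℤ → Module.End ℂ V} {B : ℤ → V → V} (hB : Truncated B) :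
    BddR (modeProd (fun n => A n) B) := by
  intro u
  obtain ⟨N, hN⟩ := hB u
  exact ⟨N, fun l hl k => by simp [FreeBoson.modeProd, hN l hl]⟩

/-- The coefficients of `i_{z,w} (z - w)^m A(z) B(w) - i_{w,z} (z - w)^m B(w) A(z)`; those with
first index `0` are the modes of the `m`-th product of the fields `A` and `B`. -/
def nthProd (m : ℤ) (A B : ℤ → V → V) : ℤ → ℤ → V → V :=
  residue m (modeProd A B) (swapIdx (modeProd B A))

theorem nthProd_apply (m : ℤ) (A B : ℤ → V → V) (k l : ℤ) (u : V) :
    nthProd m A B k l u = (∑ᶠ i : ℕ, ((-1 : ℂ) ^ i * ((Ring.choose m i : ℤ) : ℂ)) •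
      A (k + m - i) (B (l + i) u)) - (-1 : ℂ) ^ m • ∑ᶠ i : ℕ,
        ((-1 : ℂ) ^ i * ((Ring.choose m i : ℤ) : ℂ)) • B (l + m - i) (A (k + i) u) := rfl

/-- An operation on formal distributions that preserves boundedness in both index orders and
commutes with `z - w`. -/
structure IsShiftOp {ι ι' V' : Type*} [AddCommGroup V'] [Module ℂ V']
    (L : (ℤ → ℤ → ι → V) →ₗ[ℂ] (ℤ → ℤ → ι' → V')) : Prop where
  bdd : ∀ F, BddR F → BddR (L F)
  bdd_swap : ∀ F, BddR F → BddR (swapIdx (L (swapIdx F)))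
  comm : ∀ F, L (diff F) = diff (L F)

theorem IsShiftOp.residue {ι ι' V' : Type*} [AddCommGroup V'] [Module ℂ V']
    {L : (ℤ → ℤ → ι → V) →ₗ[ℂ] (ℤ → ℤ → ι' → V')} (hL : IsShiftOp L)
    {F G : ℤ → ℤ → ι → V} (hF : BddR F) (hG : BddR (swapIdx G)) (m : ℤ) :
    residue m (L F) (L G) = L (residue m F G) :=
  residue_intertwine L hL.bdd hL.comm hL.bdd_swap hF hG m

theorem IsShiftOp.mul {ι : Type*} {L L' : Module.End ℂ (ℤ → ℤ → ι → V)} (hL : IsShiftOp L)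
    (hL' : IsShiftOp L') : IsShiftOp (L * L') where
  bdd F hF := hL.bdd _ (hL'.bdd F hF)
  bdd_swap F hF := hL.bdd_swap _ (hL'.bdd_swap F hF)
  comm F := by rw [Module.End.mul_apply, hL'.comm, hL.comm]; rfl

theorem IsShiftOp.pow {ι : Type*} {L : Module.End ℂ (ℤ → ℤ → ι → V)} (hL : IsShiftOp L) (n : ℕ) :
    IsShiftOp (L ^ n) := by
  induction n with
  | zero => exact ⟨fun F h => h, fun F h => h, fun F => rfl⟩
  | succ n ih => rw [pow_succ]; exact ih.mul hL

theorem IsShiftOp.sub {ι : Type*} {L L' : Module.End ℂ (ℤ → ℤ → ι → V)} (hL : IsShiftOp L)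
    (hL' : IsShiftOp L') : IsShiftOp (L - L') where
  bdd F hF := (hL.bdd _ hF).sub (hL'.bdd F hF)
  bdd_swap F hF := (hL.bdd_swap _ hF).sub (hL'.bdd_swap F hF)
  comm F := by
    rw [LinearMap.sub_apply, hL'.comm, hL.comm, ← map_sub]; rfl

theorem isShiftOp_shiftL {ι : Type*} :
    IsShiftOp (shiftL : Module.End ℂ (ℤ → ℤ → ι → V)) where
  bdd F hF r := by
    obtain ⟨Q, hQ⟩ := hF r
    exact ⟨Q, fun l hl k => hQ l hl (k + 1)⟩
  bdd_swap F hF r := by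
    obtain ⟨Q, hQ⟩ := hF r
    exact ⟨Q, fun l hl k => hQ (l + 1) (by omega) k⟩
  comm F := rfl

theorem isShiftOp_shiftR {ι : Type*} :
    IsShiftOp (shiftR : Module.End ℂ (ℤ → ℤ → ι → V)) where
  bdd F hF r := by
    obtain ⟨Q, hQ⟩ := hF r
    exact ⟨Q, fun l hl k => hQ (l + 1) (by omega) k⟩
  bdd_swap F hF r := by
    obtain ⟨Q, hQ⟩ := hF r
    exact ⟨Q, fun l hl k => hQ l hl (k + 1)⟩
  comm F := rfl

/-- The shift of a third index. -/
def shift₃ {U : Type*} : Module.End ℂ (ℤ → ℤ → ℤ × U → V) where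
  toFun F k l r := F k l (r.1 + 1, r.2)
  map_add' _ _ := rfl
  map_smul' _ _ := rfl

theorem isShiftOp_shift₃ {U : Type*} :
    IsShiftOp (shift₃ : Module.End ℂ (ℤ → ℤ → ℤ × U → V)) where
  bdd F hF r := by
    obtain ⟨Q, hQ⟩ := hF (r.1 + 1, r.2)
    exact ⟨Q, fun l hl k => hQ l hl k⟩
  bdd_swap F hF r := by
    obtain ⟨Q, hQ⟩ := hF (r.1 + 1, r.2)
    exact ⟨Q, fun l hl k => hQ l hl k⟩
  comm F := rfl

/-- In the binomial expansion of `(a - b)^(p + K)` every term contains `b^K` or `a^p`. In Dong's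
lemma, with a third variable `x`, the roles are `a = z - x`, `b = z - w` and `a - b = w - x`. -/
theorem pow_sub_apply_eq_zero {X : Type*} [AddCommGroup X] [Module ℂ X] {a b : Module.End ℂ X}
    (hab : Commute a b) {s : X} {p q K : ℕ} (hb : (b ^ K) s = 0)
    (ha : (a ^ p * (a - b) ^ q) s = 0) : ((a - b) ^ (q + (p + K))) s = 0 := by
  have hc : Commute a (a - b) := (Commute.refl a).sub_right hab
  have hc' : Commute b (a - b) := hab.symm.sub_right (Commute.refl b)
  have e : (a - b) ^ (p + K) = (a + -b) ^ (p + K) := by rw [sub_eq_add_neg]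
  rw [pow_add, e, hab.neg_right.add_pow', Finset.mul_sum, LinearMap.sum_apply]
  refine Finset.sum_eq_zero fun ij hij => ?_
  replace hij := Finset.HasAntidiagonal.mem_antidiagonal.1 hij
  rw [mul_smul_comm, LinearMap.smul_apply]
  by_cases h : K ≤ ij.2
  · obtain ⟨j, hj⟩ := Nat.exists_eq_add_of_le' h
    rw [hj, neg_pow, pow_add b, ← mul_assoc, ← mul_assoc, ← mul_assoc, Module.End.mul_apply, hb,
      map_zero, smul_zero]
  · obtain ⟨i, hi⟩ := Nat.exists_eq_add_of_le' (show p ≤ ij.1 by omega)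
    have : (a - b) ^ q * (a ^ ij.1 * (-b) ^ ij.2) =
        (a ^ i * (-b) ^ ij.2) * (a ^ p * (a - b) ^ q) := by
      have h1 : Commute ((a - b) ^ q) (a ^ ij.1 * (-b) ^ ij.2) :=
        ((hc.symm.pow_pow _ _)).mul_right ((hc'.symm.neg_right).pow_pow _ _)
      have h2 : Commute (a ^ p) ((-b) ^ ij.2) := hab.neg_right.pow_pow _ _
      rw [h1.eq, hi, pow_add, mul_assoc (a ^ i), h2.eq]
      simp only [mul_assoc]
    rw [this, Module.End.mul_apply, ha, map_zero, smul_zero]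

/-- Dong's lemma: the products of mutually local fields are local. -/
theorem IsLocal.nthProd {A B C : ℤ → Module.End ℂ V} (hA : Truncated fun n => A n)
    (hB : Truncated fun n => B n) (hAB : IsLocal (fun n => A n) fun n => B n)
    (hAC : IsLocal (fun n => A n) fun n => C n) (hBC : IsLocal (fun n => B n) fun n => C n)
    (m : ℤ) : IsLocal (nthProd m (fun n => A n) (fun n => B n) 0) fun n => C n := by
  obtain ⟨N, hN⟩ := hAB
  obtain ⟨p, hp⟩ := hAC
  obtain ⟨q, hq⟩ := hBC
  set F : ℤ → ℤ → ℤ × V → V := fun k l r => A k (B l (C r.1 r.2)) with hFdef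
  set F' : ℤ → ℤ → ℤ × V → V := fun k l r => C r.1 (A k (B l r.2)) with hFdef'
  set G : ℤ → ℤ → ℤ × V → V := fun k l r => B l (A k (C r.1 r.2)) with hGdef
  set G' : ℤ → ℤ → ℤ × V → V := fun k l r => C r.1 (B l (A k r.2)) with hGdef'
  have bF : BddR F := fun r => (hB (C r.1 r.2)).imp fun Q hQ l hl k => by simp [F, hQ l hl]
  have bF' : BddR F' := fun r => (hB r.2).imp fun Q hQ l hl k => by simp [F', hQ l hl]
  have bG : BddR (swapIdx G) := fun r => (hA (C r.1 r.2)).imp fun Q hQ l hl k => by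
    simp [G, swapIdx_apply, hQ l hl]
  have bG' : BddR (swapIdx G') := fun r => (hA r.2).imp fun Q hQ l hl k => by
    simp [G', swapIdx_apply, hQ l hl]
  -- Setting the first index of `S` to `0` gives the commutator of the `m`-th product of `A` and `B`
  -- with `C`.
  set S := residue m F G - residue m F' G' with hS
  let d13 : Module.End ℂ (ℤ → ℤ → ℤ × V → V) := shiftL - shift₃
  let d23 : Module.End ℂ (ℤ → ℤ → ℤ × V → V) := shiftR - shift₃
  have hd : d23 = d13 - diff := by simp only [d13, d23, diff]; abel
  have hcomm : Commute d13 (diff : Module.End ℂ (ℤ → ℤ → ℤ × V → V)) :=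
    LinearMap.ext fun F => (isShiftOp_shiftL.sub isShiftOp_shift₃).comm F
  -- `A` and `B` are local
  have key : ∀ F G : ℤ → ℤ → ℤ × V → V, BddR F → BddR (swapIdx G) → (diff ^ N) (F - G) = 0 →
      (diff ^ (N + m.natAbs)) (residue m F G) = 0 := by
    intro F G hF hG h
    -- The summand `|m|` makes the total exponent `m + N + |m|` at least `N`, so locality applies
    -- even for negative `m`.
    rw [← residue_add_nat hF hG, show m + ((N + m.natAbs : ℕ) : ℤ) =
      ((N : ℕ) : ℤ) + ((m + m.natAbs).toNat : ℕ) by omega, residue_add_nat hF hG,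
      residue_natCast hF hG, h, map_zero]
  have h1 : (diff ^ (N + m.natAbs)) S = 0 := by
    rw [hS, map_sub, key F G bF bG ?_, key F' G' bF' bG' ?_, sub_zero]
    · have := pow_intertwine (D := diff) (D' := diff)
        (L := fun f : ℤ → ℤ → V → V => fun k l (r : ℤ × V) => C r.1 (f k l r.2))
        (fun f => by funext k l r; simp [diff_apply]) N
        (modeComm (fun n => A n) fun n => B n)
      rw [hN] at this
      have e : F' - G' = fun k l (r : ℤ × V) =>
          C r.1 (modeComm (fun n => A n) (fun n => B n) k l r.2) := by
        funext k l r; simp [F', G', modeComm]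
      rw [e, ← this]
      funext k l r
      simp
    · have := pow_intertwine (D := diff) (D' := diff)
        (L := fun f : ℤ → ℤ → V → V => fun k l (r : ℤ × V) => f k l (C r.1 r.2))
        (fun f => rfl) N (modeComm (fun n => A n) fun n => B n)
      rw [hN] at this
      exact this.symm
  -- `A` and `C`, and `B` and `C` are local
  have c13_23 : Commute (d13 ^ p) (d23 ^ q) := by
    rw [hd]; exact (((Commute.refl d13).sub_right hcomm)).pow_pow _ _
  have hop : IsShiftOp (d13 ^ p * d23 ^ q) :=
    ((isShiftOp_shiftL.sub isShiftOp_shift₃).pow p).mul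
      ((isShiftOp_shiftR.sub isShiftOp_shift₃).pow q)
  have h13 : ∀ Φ : (ℤ → ℤ → V → V) → (ℤ → ℤ → ℤ × V → V), (∀ f, Φ (diff f) = d13 (Φ f)) →
      Φ 0 = 0 → (d13 ^ p * d23 ^ q) (Φ (modeComm (fun n => A n) fun n => C n)) = 0 := by
    intro Φ hΦ h0
    rw [c13_23.eq, Module.End.mul_apply, ← pow_intertwine hΦ, hp, h0, map_zero]
  have h23 : ∀ Φ : (ℤ → ℤ → V → V) → (ℤ → ℤ → ℤ × V → V), (∀ f, Φ (diff f) = d23 (Φ f)) →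
      Φ 0 = 0 → (d13 ^ p * d23 ^ q) (Φ (modeComm (fun n => B n) fun n => C n)) = 0 := by
    intro Φ hΦ h0
    rw [Module.End.mul_apply, ← pow_intertwine hΦ, hq, h0, map_zero]
  -- `ABC - CAB = A[B, C] + [A, C]B`, where each commutator is killed by its own factor; the
  -- difference `G - G'` is treated alike.
  have hFF : (d13 ^ p * d23 ^ q) (F - F') = 0 := by
    have e : F - F' = (fun k l (r : ℤ × V) =>
          A k (modeComm (fun n => B n) (fun n => C n) l r.1 r.2)) +
        (fun k l (r : ℤ × V) => modeComm (fun n => A n) (fun n => C n) k r.1 (B l r.2)) := by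
      funext k l r; simp [F, F', modeComm]
    rw [e, map_add, h23 (fun f k l r => A k (f l r.1 r.2)), h13 (fun f k l r => f k r.1 (B l r.2)),
      add_zero]
    · intro f; rfl
    · rfl
    · intro f; funext k l r; exact map_sub _ _ _
    · funext k l r; exact map_zero _
  have hGG : (d13 ^ p * d23 ^ q) (G - G') = 0 := by
    have e : G - G' = (fun k l (r : ℤ × V) =>
          B l (modeComm (fun n => A n) (fun n => C n) k r.1 r.2)) +
        (fun k l (r : ℤ × V) => modeComm (fun n => B n) (fun n => C n) l r.1 (A k r.2)) := by
      funext k l r; simp [G, G', modeComm]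
    rw [e, map_add, h13 (fun f k l r => B l (f k r.1 r.2)), h23 (fun f k l r => f l r.1 (A k r.2)),
      add_zero]
    · intro f; rfl
    · rfl
    · intro f; funext k l r; exact map_sub _ _ _
    · funext k l r; exact map_zero _
  have h2 : (d13 ^ p * d23 ^ q) S = 0 := by
    rw [hS, ← residue_sub bF bG bF' bG', ← hop.residue (bF.sub bF') (show BddR (swapIdx (G - G')) from bG.sub bG'), hFF, hGG]
    funext k l r
    simp [residue_apply]
  -- `S` is killed by a power of `z - w` and by `(z - x)^p (w - x)^q`, hence by a power of `w - x`
  -- alone.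
  rw [hd] at h2
  have h3 := pow_sub_apply_eq_zero hcomm h1 h2
  rw [← hd] at h3
  refine ⟨q + (p + (N + m.natAbs)), ?_⟩
  have h4 := pow_intertwine (D := d23) (D' := diff)
    (L := fun (f : ℤ → ℤ → ℤ × V → V) l r u => f 0 l (r, u)) (fun f => rfl)
    (q + (p + (N + m.natAbs))) S
  rw [h3] at h4
  have e : modeComm (FreeBoson.nthProd m (fun n => A n) (fun n => B n) 0) (fun n => C n) =
      fun l r u => S 0 l (r, u) := by
    funext l r u
    let L : (ℤ → ℤ → V → V) →ₗ[ℂ] (ℤ → ℤ → ℤ × V → V) :=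
      { toFun := fun f k l r => C r.1 (f k l r.2)
        map_add' := fun f g => by funext k l r; simp
        map_smul' := fun c f => by funext k l r; simp }
    have hL : IsShiftOp L :=
      ⟨fun f hf r => (hf r.2).imp fun Q hQ l hl k => by
          change C r.1 (f k l r.2) = 0; rw [hQ l hl, map_zero],
        fun f hf r => (hf r.2).imp fun Q hQ l hl k => by
          change C r.1 (f k l r.2) = 0; rw [hQ l hl, map_zero],
        fun f => by funext k l r; exact map_sub (C r.1) _ _⟩
    have h5 : residue m F' G' 0 l (r, u) =
        C r (FreeBoson.nthProd m (fun n => A n) (fun n => B n) 0 l u) := by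
      have := hL.residue (F := modeProd (fun n => A n) fun n => B n)
        (G := swapIdx (modeProd (fun n => B n) fun n => A n)) (BddR.modeProd hB)
        (BddR.modeProd hA) m
      exact congrFun (congrFun (congrFun this 0) l) (r, u)
    simp only [S, Pi.sub_apply]
    rw [h5]
    rfl
  rw [e]
  exact h4.symm

/-- A translation covariant family of modes which creates the vector `a` from the vacuum. -/
structure Creates (T : Module.End ℂ V) (vac : V) (D : ℤ → V → V) (a : V) : Prop where
  map_zero : ∀ n, D n 0 = 0
  cov : ∀ n u, T (D n u) - D n (T u) = -((n : ℂ) • D (n - 1) u)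
  nonneg : ∀ n, 0 ≤ n → D n vac = 0
  neg_one : D (-1) vac = a

/-- A term of `(z - w)^n` containing a positive power of `w` moves the second index from `-1` to a
nonnegative value, where `F` vanishes. Only `z^n` survives. -/
theorem diff_pow_apply_neg_one {ι : Type*} {r : ι} (n : ℕ) :
    ∀ {F : ℤ → ℤ → ι → V}, (∀ k l, 0 ≤ l → F k l r = 0) →
    ∀ k, (diff ^ n) F k (-1) r = F (k + n) (-1) r := by
  induction n with
  | zero => intro F hF k; simp
  | succ n ih =>
    intro F hF k
    rw [pow_succ, Module.End.mul_apply, ih]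
    · rw [diff_apply, hF _ (-1 + 1) (by norm_num), sub_zero]
      push_cast
      rw [add_assoc]
    · intro k l hl
      rw [diff_apply, hF _ _ hl, hF _ _ (by omega), sub_zero]

/-- Goddard's uniqueness theorem. -/
theorem Creates.unique {T : Module.End ℂ V} {vac : V} (hT : T vac = 0) {D D' : ℤ → V → V} {a : V}
    (hD : Creates T vac D a) (hD' : Creates T vac D' a)
    (h : ∀ b : V, ∃ B : ℤ → Module.End ℂ V, Creates T vac (fun n => B n) b ∧
      IsLocal D (fun n => B n) ∧ IsLocal D' fun n => B n) : D = D' := by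
  -- Since `T` kills the vacuum, covariance reads `T(D_(n) vac) = -n D_(n-1) vac`; it determines all
  -- negative modes on the vacuum from the mode `-1`.
  have hvac' : ∀ n : ℕ, (D - D') (-(n : ℤ) - 1) vac = 0 := by
    intro n
    induction n with
    | zero => simp [hD.neg_one, hD'.neg_one]
    | succ n ih =>
      have h1 := hD.cov (-(n : ℤ) - 1) vac
      have h2 := hD'.cov (-(n : ℤ) - 1) vac
      rw [hT, hD.map_zero, sub_zero] at h1
      rw [hT, hD'.map_zero, sub_zero] at h2
      have h3 : T ((D - D') (-(n : ℤ) - 1) vac) = _ := map_sub T _ _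
      rw [h1, h2, ih, T.map_zero, ← neg_sub', ← smul_sub, eq_comm, neg_eq_zero, smul_eq_zero] at h3
      rw [show -((n + 1 : ℕ) : ℤ) - 1 = -(n : ℤ) - 1 - 1 by push_cast; ring]
      refine h3.resolve_left ?_
      intro h0
      have h4 : -(n : ℤ) - 1 = 0 := Int.cast_injective (α := ℂ) (h0.trans Int.cast_zero.symm)
      omega
  have hvac : ∀ n, (D - D') n vac = 0 := by
    intro n
    by_cases hn : 0 ≤ n
    · simp [hD.nonneg n hn, hD'.nonneg n hn]
    · have := hvac' (-n - 1).toNat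
      rwa [show (-(((-n - 1).toNat : ℕ) : ℤ) - 1) = n by omega] at this
  rw [← sub_eq_zero]
  funext k b
  obtain ⟨B, hB, h1, h2⟩ := h b
  obtain ⟨N, hN⟩ := h1.sub_left h2
  -- Locality gives `(z - w)^N E(z) B(w) vac = 0` for `E = D - D'`, because `E(z) vac = 0`. Its
  -- coefficient at `w = 0` is `z^N E(z) b`; starting from `k - N` picks out `E_(k) b`.
  have h3 := diff_pow_apply_neg_one (r := vac) N (F := modeComm (D - D') fun n => B n)
    (fun k l hl => by
      simp only [modeComm, hvac, _root_.map_zero, hB.nonneg l hl, sub_zero]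
      simp [hD.map_zero, hD'.map_zero]) (k - N)
  rw [hN, sub_add_cancel] at h3
  simp only [modeComm, hvac, _root_.map_zero, sub_zero] at h3
  rw [hB.neg_one] at h3
  exact h3.symm

/-- The operator `-(∂_z + ∂_w)` on formal distributions. -/
def translate {ι : Type*} : Module.End ℂ (ℤ → ℤ → ι → V) where
  toFun F k l r := (k : ℂ) • F (k - 1) l r + (l : ℂ) • F k (l - 1) r
  map_add' F G := by funext k l r; simp only [Pi.add_apply, smul_add]; abel
  map_smul' c F := by
    funext k l r
    simp only [Pi.smul_apply, smul_add, RingHom.id_apply, smul_smul, mul_comm c]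

/-- The derivation `∂_z + ∂_w` annihilates `z - w`, so it commutes with multiplication by it. -/
theorem isShiftOp_translate {ι : Type*} :
    IsShiftOp (translate : Module.End ℂ (ℤ → ℤ → ι → V)) where
  bdd F hF r := by
    obtain ⟨Q, hQ⟩ := hF r
    refine ⟨Q + 1, fun l hl k => ?_⟩
    change (k : ℂ) • F (k - 1) l r + (l : ℂ) • F k (l - 1) r = 0
    rw [hQ l (by omega), hQ (l - 1) (by omega), smul_zero, smul_zero, add_zero]
  bdd_swap F hF r := by
    obtain ⟨Q, hQ⟩ := hF r
    refine ⟨Q + 1, fun l hl k => ?_⟩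
    change (l : ℂ) • F k (l - 1) r + (k : ℂ) • F (k - 1) l r = 0
    rw [hQ l (by omega), hQ (l - 1) (by omega), smul_zero, smul_zero, add_zero]
  comm F := by
    funext k l r
    rw [diff_apply]
    change (k : ℂ) • diff F (k - 1) l r + (l : ℂ) • diff F k (l - 1) r =
      (((k + 1 : ℤ) : ℂ) • F (k + 1 - 1) l r + (l : ℂ) • F (k + 1) (l - 1) r) -
      ((k : ℂ) • F (k - 1) (l + 1) r + ((l + 1 : ℤ) : ℂ) • F k (l + 1 - 1) r)
    simp only [diff_apply, sub_add_cancel, add_sub_cancel_right]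
    push_cast
    module

/-- The products of fields that create `a` and `b` create the product of `a` and `b`. -/
theorem Creates.nthProd {T : Module.End ℂ V} {vac : V} {A B : ℤ → Module.End ℂ V} {a b : V}
    (hA : Truncated fun n => A n) (hB : Truncated fun n => B n)
    (cA : Creates T vac (fun n => A n) a) (cB : Creates T vac (fun n => B n) b) (m : ℤ) :
    Creates T vac (nthProd m (fun n => A n) (fun n => B n) 0) (A m b) where
  map_zero n := by simp [nthProd_apply]
  cov n u := by
    -- `L` is the commutator with `T`. On the products of modes of `A` and `B`, in either order, it
    -- acts as `∂_z + ∂_w`, and both operations pass through the expansions.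
    let L : (ℤ → ℤ → V → V) →ₗ[ℂ] (ℤ → ℤ → V → V) :=
      { toFun := fun f k l u => T (f k l u) - f k l (T u)
        map_add' := fun f g => by funext k l r; simp only [Pi.add_apply, map_add]; abel
        map_smul' := fun c f => by
          funext k l r; simp only [Pi.smul_apply, map_smul, smul_sub, RingHom.id_apply] }
    have hL1 : ∀ f, BddR f → BddR (L f) := by
      intro f hf u
      obtain ⟨P, hP⟩ := hf u
      obtain ⟨Q, hQ⟩ := hf (T u)
      refine ⟨max P Q, fun l hl k => ?_⟩
      change T (f k l u) - f k l (T u) = 0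
      rw [hP l (le_trans (le_max_left _ _) hl), hQ l (le_trans (le_max_right _ _) hl)]
      simp
    have hL : IsShiftOp L := ⟨hL1, hL1, fun f => by
      funext k l u
      change T (f (k + 1) l u - f k (l + 1) u) - (f (k + 1) l (T u) - f k (l + 1) (T u)) =
        (T (f (k + 1) l u) - f (k + 1) l (T u)) - (T (f k (l + 1) u) - f k (l + 1) (T u))
      rw [map_sub]; abel⟩
    have e : ∀ A B : ℤ → Module.End ℂ V, ∀ a b, Creates T vac (fun n => A n) a →
        Creates T vac (fun n => B n) b →
        L (modeProd (fun n => A n) fun n => B n) =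
          translate (-(modeProd (fun n => A n) fun n => B n)) := by
      intro A B a b cA cB
      funext k l u
      change T (A k (B l u)) - A k (B l (T u)) =
        (k : ℂ) • -(A (k - 1) (B l u)) + (l : ℂ) • -(A k (B (l - 1) u))
      have h1 := cA.cov k (B l u)
      have h2 := congrArg (A k) (cB.cov l u)
      simp only [map_sub, map_neg, map_smul] at h1 h2
      rw [sub_eq_iff_eq_add] at h1 h2
      rw [h1, h2]
      module
    have h1 := hL.residue (F := modeProd (fun n => A n) fun n => B n)
      (G := swapIdx (modeProd (fun n => B n) fun n => A n)) (BddR.modeProd hB)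
      (BddR.modeProd hA) m
    have e2 : L (swapIdx (modeProd (fun n => B n) fun n => A n)) =
        translate (-swapIdx (modeProd (fun n => B n) fun n => A n)) := by
      have := congrArg swapIdx (e B A b a cB cA)
      refine Eq.trans (this) ?_
      funext k l r
      exact add_comm _ _
    rw [e A B a b cA cB, e2, map_neg, map_neg,
      show ∀ F G : ℤ → ℤ → V → V, residue m (-F) (-G) = -residue m F G from ?_,
      isShiftOp_translate.residue (BddR.modeProd hB)
        (G := swapIdx (modeProd (fun n => B n) fun n => A n)) (BddR.modeProd hA)] at h1
    · have h2 := congrFun (congrFun (congrFun h1 0) n) u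
      refine h2.symm.trans ?_
      -- At first index `0` the `∂_z` term carries the factor `0`, leaving only the derivative in
      -- `w`.
      refine (congrArg Neg.neg (?_ : ((0 : ℤ) : ℂ) • FreeBoson.nthProd m (fun n => A n)
        (fun n => B n) (0 - 1) n u + (n : ℂ) • FreeBoson.nthProd m (fun n => A n)
        (fun n => B n) 0 (n - 1) u = _) : _)
      rw [Int.cast_zero, zero_smul, zero_add]
    · intro F G
      funext k l r
      simp only [residue_apply, Pi.neg_apply, smul_neg, finsum_neg_distrib]
      abel
  nonneg n hn := by
    rw [nthProd_apply, finsum_eq_zero_of_forall_eq_zero fun i => ?_,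
      finsum_eq_zero_of_forall_eq_zero fun i => ?_, smul_zero, sub_zero]
    · rw [cA.nonneg _ (by omega), _root_.map_zero, smul_zero]
    · rw [cB.nonneg _ (by omega), _root_.map_zero, smul_zero]
  neg_one := by
    rw [nthProd_apply, finsum_eq_single _ 0 fun i hi => ?_,
      finsum_eq_zero_of_forall_eq_zero fun i => ?_, smul_zero, sub_zero]
    · simp [cB.neg_one]
    · rw [cA.nonneg _ (by omega), _root_.map_zero, smul_zero]
    · rw [cB.nonneg _ (by omega), _root_.map_zero, smul_zero]

end Locality

end FreeBoson
end
noncomputable section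

namespace FreeBoson

/-! ### The Borcherds identity from locality -/

section Reconstruction

variable {V : Type*} [AddCommGroup V] [Module ℂ V]

/-- The left-hand side of the Borcherds identity, for the products `C j = Y(a_(j) b)`. -/
def borcherdsSum (C : ℤ → ℤ → V) (k l m : ℤ) : V :=
  ∑ᶠ i : ℕ, ((Ring.choose k i : ℤ) : ℂ) • C (m + i) (k + l - i)

theorem borcherdsSum_support {C : ℤ → ℤ → V} {N : ℤ} (hC : ∀ j ≥ N, C j = 0) (c : ℕ → ℂ)
    (f : ℕ → ℤ) (m : ℤ) : (Function.support fun i : ℕ => c i • C (m + i) (f i)).Finite := by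
  refine (Set.finite_lt_nat (N - m).toNat).subset fun j hj => ?_
  by_contra hlt
  simp only [Set.mem_ofPred_eq, not_lt] at hlt
  exact hj (by simp only [hC (m + j) (by omega), Pi.zero_apply, smul_zero])

/-- Pascal's rule in `k`. The coefficients of the products of fields satisfy the same recursion,
which there expresses `(z - w)^(m+1) = (z - w)(z - w)^m`. -/
theorem borcherdsSum_succ {C : ℤ → ℤ → V} {N : ℤ} (hC : ∀ j ≥ N, C j = 0) (k l m : ℤ) :
    borcherdsSum C (k + 1) l m = borcherdsSum C k (l + 1) m + borcherdsSum C k l (m + 1) := by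
  simp only [borcherdsSum]
  rw [finsum_nat_eq_add_succ _ (borcherdsSum_support hC _ _ _),
    finsum_nat_eq_add_succ (fun i : ℕ => ((Ring.choose k i : ℤ) : ℂ) •
      C (m + i) (k + (l + 1) - i)) (borcherdsSum_support hC _ _ _),
    add_assoc (_ • _) (finsum _) (finsum _), ← finsum_add_distrib]
  · congr 1
    · simp [show k + 1 + l = k + (l + 1) by ring]
    · refine finsum_congr fun i => ?_
      have e1 : k + 1 + l - ((i + 1 : ℕ) : ℤ) = k + l - i := by push_cast; ring
      have e2 : k + (l + 1) - ((i + 1 : ℕ) : ℤ) = k + l - i := by push_cast; ring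
      have e3 : m + ((i + 1 : ℕ) : ℤ) = m + 1 + i := by push_cast; ring
      rw [e1, e2, e3, ← add_smul, Ring.choose_succ_succ]
      push_cast
      rw [add_comm]
  · have := borcherdsSum_support hC (fun i => ((Ring.choose k (i + 1) : ℤ) : ℂ))
      (fun i => k + (l + 1) - ((i + 1 : ℕ) : ℤ)) (m + 1)
    refine this.subset fun i hi => ?_
    have e3 : m + ((i + 1 : ℕ) : ℤ) = m + 1 + i := by push_cast; ring
    simp only [Function.mem_support, e3] at hi ⊢
    exact hi
  · exact borcherdsSum_support hC _ _ _

/-- The Borcherds identity follows from locality and from its special case `k = 0`. -/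
theorem borcherds_of_local {A B : ℤ → Module.End ℂ V} (hA : Truncated fun n => A n)
    (hB : Truncated fun n => B n) (hAB : IsLocal (fun n => A n) fun n => B n) (c : V)
    {C : ℤ → ℤ → V} {N : ℤ} (hC : ∀ j ≥ N, C j = 0)
    (h0 : ∀ m l, C m l = nthProd m (fun n => A n) (fun n => B n) 0 l c) (k l m : ℤ) :
    borcherdsSum C k l m = nthProd m (fun n => A n) (fun n => B n) k l c := by
  obtain ⟨M, hM⟩ := hAB
  -- For large `m` both sides vanish: the right one by locality, the left one by truncation.
  have hbig : ∀ m : ℤ, (max (M : ℤ) N) ≤ m → ∀ k l,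
      borcherdsSum C k l m = nthProd m (fun n => A n) (fun n => B n) k l c := by
    intro m hm k l
    have h1 : nthProd m (fun n => A n) (fun n => B n) = 0 := by
      obtain ⟨j, rfl⟩ := Int.eq_ofNat_of_zero_le (show 0 ≤ m by omega)
      rw [nthProd, residue_natCast (BddR.modeProd hB)
        (G := swapIdx (modeProd (fun n => B n) fun n => A n)) (BddR.modeProd hA)]
      exact diff_pow_eq_zero_of_le (by omega) hM
    rw [h1, borcherdsSum, finsum_eq_zero_of_forall_eq_zero]
    · rfl
    · intro i
      rw [hC (m + i) (by omega), Pi.zero_apply, smul_zero]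
  -- Descending induction on `m`: once `m + 1` is known, the recursion carries the case `k = 0` to
  -- all `k` in both directions.
  have hstep : ∀ m : ℤ, (∀ k l,
      borcherdsSum C k l (m + 1) = nthProd (m + 1) (fun n => A n) (fun n => B n) k l c) → ∀ k l,
      borcherdsSum C k l m = nthProd m (fun n => A n) (fun n => B n) k l c := by
    intro m hm
    have hrec : ∀ k l, nthProd m (fun n => A n) (fun n => B n) (k + 1) l c =
        nthProd m (fun n => A n) (fun n => B n) k (l + 1) c +
          nthProd (m + 1) (fun n => A n) (fun n => B n) k l c := by
      intro k l
      have := congrFun (congrFun (congrFun (residue_add_nat (BddR.modeProd (A := A) hB)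
        (G := swapIdx (modeProd (fun n => B n) fun n => A n)) (BddR.modeProd hA) m 1) k) l) c
      rw [pow_one, diff_apply, Nat.cast_one, eq_sub_iff_add_eq'] at this
      exact this.symm
    intro k
    induction k using Int.induction_on with
    | zero =>
      intro l
      rw [borcherdsSum, finsum_eq_single _ 0 fun i hi => ?_, ← h0]
      · simp
      · rw [Ring.choose_zero_pos ℤ (Nat.pos_of_ne_zero hi), Int.cast_zero, zero_smul]
    | succ k ih => intro l; rw [borcherdsSum_succ hC, hrec, ih, hm]
    | pred k ih =>
      intro l
      have h1 := borcherdsSum_succ hC (-(k : ℤ) - 1) (l - 1) m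
      have h2 := hrec (-(k : ℤ) - 1) (l - 1)
      rw [sub_add_cancel, sub_add_cancel, ih, hm] at h1
      rw [sub_add_cancel, sub_add_cancel] at h2
      rw [h2] at h1
      exact (add_right_cancel h1).symm
  have hall : ∀ j : ℕ, ∀ m, max (M : ℤ) N ≤ m + j → ∀ k l,
      borcherdsSum C k l m = nthProd m (fun n => A n) (fun n => B n) k l c := by
    intro j
    induction j with
    | zero => intro m hm; exact hbig m (by simpa using hm)
    | succ j ih => intro m hm; exact hstep m (ih (m + 1) (by push_cast at hm; omega))
  exact hall (max (M : ℤ) N - m).toNat m (by omega) k l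

theorem truncated_mode (A : VertexOperator ℂ V) : Truncated fun n => mode A n := mode_trunc A

section

variable {Y : V →ₗ[ℂ] VertexOperator ℂ V} {T : Module.End ℂ V} {vac : V}

/-- The fields of mutually local states multiply as the states do. -/
theorem mode_mode_eq_nthProd (hT : T vac = 0)
    (hcr : ∀ a, Creates T vac (fun n => mode (Y a) n) a)
    (hloc : ∀ a b, IsLocal (fun n => mode (Y a) n) fun n => mode (Y b) n) (a b : V) (m l : ℤ)
    (c : V) : mode (Y (mode (Y a) m b)) l c =
      nthProd m (fun n => mode (Y a) n) (fun n => mode (Y b) n) 0 l c := by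
  -- Both sides are covariant, create `a_(m) b` and, by Dong's lemma, are local with every `Y b'`.
  have := (hcr (mode (Y a) m b)).unique hT
    ((hcr a).nthProd (truncated_mode _) (truncated_mode _) (hcr b) m) fun b' =>
      ⟨mode (Y b'), hcr b', hloc _ _,
        IsLocal.nthProd (truncated_mode _) (truncated_mode _) (hloc a b) (hloc a b') (hloc b b') m⟩
  exact congrFun (congrFun this l) c

/-- The reconstruction theorem. -/
theorem isVertexAlgebra_of_local (hT : T vac = 0)
    (hcr : ∀ a, Creates T vac (fun n => mode (Y a) n) a)
    (hloc : ∀ a b, IsLocal (fun n => mode (Y a) n) fun n => mode (Y b) n) :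
    IsVertexAlgebra Y vac where
  truncation a b := mode_trunc (Y a) b
  borcherds a b c k l m := by
    obtain ⟨N, hN⟩ := mode_trunc (Y a) b
    have h := borcherds_of_local (truncated_mode (Y a)) (truncated_mode (Y b)) (hloc a b) c
      (C := fun j n => mode (Y (mode (Y a) j b)) n c) (N := N)
      (fun j hj => by
        funext n
        change mode (Y (mode (Y a) j b)) n c = 0
        rw [hN j hj, map_zero, mode, map_zero]
        rfl)
      (fun m l => mode_mode_eq_nthProd hT hcr hloc a b m l c) k l m
    refine h.trans ?_
    rw [nthProd_apply, smul_finsum, ← finsum_sub_distrib]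
    · refine finsum_congr fun i => ?_
      rw [smul_sub, smul_comm]
    · exact (BddR.modeProd (A := mode (Y a)) (truncated_mode (Y b))).support _ _ _ _
    · have := (BddR.modeProd (A := mode (Y b)) (truncated_mode (Y a))).support
        (fun i : ℕ => (-1 : ℂ) ^ m * ((-1 : ℂ) ^ i * ((Ring.choose m i : ℤ) : ℂ)))
        (fun i => l + m - i) k c
      refine this.subset fun i hi => ?_
      simpa only [Function.mem_support, mul_smul, modeProd] using hi
  vacuum_nonneg a n hn := (hcr a).nonneg n hn
  vacuum_neg_one a := (hcr a).neg_one

end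

end Reconstruction

end FreeBoson
end
noncomputable section

namespace FreeBoson

/-! ### The fields of the free boson -/

open MvPolynomial

theorem int_cases_pnat (n : ℤ) : n = 0 ∨ (∃ i : ℕ+, n = ((i : ℕ) : ℤ)) ∨
    ∃ i : ℕ+, n = -((i : ℕ) : ℤ) := by
  rcases lt_trichotomy n 0 with h | h | h
  · exact Or.inr (Or.inr ⟨⟨(-n).toNat, by omega⟩, by simp; omega⟩)
  · exact Or.inl h
  · exact Or.inr (Or.inl ⟨⟨n.toNat, by omega⟩, by simp; omega⟩)

theorem alphaMode_zero : alphaMode 0 = 0 := rfl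

theorem alphaMode_pos (i : ℕ+) (u : Fock) :
    alphaMode ((i : ℕ) : ℤ) u = ((i : ℕ) : ℂ) • pderiv i u := by
  obtain ⟨k, rfl⟩ : ∃ k : ℕ, i = k.succPNat := ⟨i.natPred, by simp⟩
  rfl

theorem alphaMode_neg (i : ℕ+) (u : Fock) : alphaMode (-((i : ℕ) : ℤ)) u = X i * u := by
  obtain ⟨k, rfl⟩ : ∃ k : ℕ, i = k.succPNat := ⟨i.natPred, by simp⟩
  rfl

theorem mode_alpha (n : ℤ) : mode alpha n = alphaMode n := mode_ofModes _ _ _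

/-- Multiplications commute and so do partial derivatives. Only opposite signs contribute, through
the Leibniz rule for `∂/∂x_i (x_j u)`. -/
theorem alphaMode_comm (m n : ℤ) (u : Fock) :
    alphaMode m (alphaMode n u) - alphaMode n (alphaMode m u) =
      if m + n = 0 then (m : ℂ) • u else 0 := by
  have key : ∀ i j : ℕ+, ((i : ℕ) : ℂ) • pderiv i (X j * u) - X j * ((i : ℕ) : ℂ) • pderiv i u =
      if ((i : ℕ) : ℤ) - ((j : ℕ) : ℤ) = 0 then ((i : ℕ) : ℂ) • u else 0 := by
    intro i j
    rw [Derivation.leibniz, pderiv_X]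
    by_cases h : i = j
    · subst h
      simp
    · have h' : ¬ ((i : ℕ) : ℤ) - ((j : ℕ) : ℤ) = 0 := fun h' => h (PNat.eq (by omega))
      rw [if_neg h', Pi.single_eq_of_ne (Ne.symm h)]
      simp
  rcases int_cases_pnat m with rfl | ⟨i, rfl⟩ | ⟨i, rfl⟩
  · simp [alphaMode_zero]
  · rcases int_cases_pnat n with rfl | ⟨j, rfl⟩ | ⟨j, rfl⟩
    · simp [alphaMode_zero]
    · have hi := i.pos
      rw [if_neg (by omega)]
      have h : ⁅(pderiv i : Derivation ℂ Fock Fock), (pderiv j : Derivation ℂ Fock Fock)⁆ = 0 := by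
        refine derivation_ext fun s => ?_
        rw [Derivation.commutator_apply, pderiv_X, pderiv_X]
        rcases eq_or_ne s i with rfl | h1 <;> rcases eq_or_ne s j with rfl | h2 <;> simp [*]
      have h' := congrArg (fun D : Derivation ℂ Fock Fock => D u) h
      rw [Derivation.commutator_apply, Derivation.zero_apply, sub_eq_zero] at h'
      simp only [alphaMode_pos, Derivation.map_smul]
      rw [h', smul_comm, sub_self]
    · simp only [alphaMode_pos, alphaMode_neg]
      rw [key, ← sub_eq_add_neg, Int.cast_natCast]
  · rcases int_cases_pnat n with rfl | ⟨j, rfl⟩ | ⟨j, rfl⟩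
    · simp [alphaMode_zero]
    · simp only [alphaMode_pos, alphaMode_neg]
      rw [← neg_sub, key, neg_add_eq_sub]
      split_ifs with h
      · rw [← neg_smul, Int.cast_neg, Int.cast_natCast, sub_eq_zero.1 h |> Int.natCast_inj.1]
      · simp
    · have hi := i.pos
      rw [if_neg (by omega)]
      simp only [alphaMode_neg]
      ring

/-- The infinitesimal translation operator: the derivation with `x_i ↦ i x_{i+1}`. -/
def translation : Derivation ℂ Fock Fock := mkDerivation ℂ fun i : ℕ+ => ((i : ℕ) : ℂ) • X (i + 1)

theorem translation_X (i : ℕ+) : translation (X i) = ((i : ℕ) : ℂ) • X (i + 1) :=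
  mkDerivation_X _ _ _

/-- For positive `n` the commutator of `T` with `∂/∂x_i` is a derivation, so it is enough to compare
values on the variables; the case `i = 1` is separate because it leads to `α_0 = 0`. For negative
`n` it is the Leibniz rule. -/
theorem translation_alphaMode (n : ℤ) (u : Fock) :
    translation (alphaMode n u) - alphaMode n (translation u) =
      -((n : ℂ) • alphaMode (n - 1) u) := by
  rcases int_cases_pnat n with rfl | ⟨i, rfl⟩ | ⟨i, rfl⟩
  · simp [alphaMode_zero]
  · have key : ∀ j : ℕ+, ⁅translation, (pderiv i : Derivation ℂ Fock Fock)⁆ (X j) =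
        if i = j + 1 then -((j : ℕ) : ℂ) • (1 : Fock) else 0 := by
      intro j
      rw [Derivation.commutator_apply, translation_X, Derivation.map_smul, pderiv_X, pderiv_X]
      by_cases h : i = j + 1
      · subst h
        rw [if_pos rfl, Pi.single_eq_same]
        by_cases h2 : j + 1 = j
        · exact absurd (congrArg PNat.val h2) (by simp)
        · rw [Pi.single_eq_of_ne (Ne.symm h2), map_zero, zero_sub, neg_smul]
      · rw [if_neg h, Pi.single_eq_of_ne (Ne.symm h)]
        by_cases h2 : i = j
        · subst h2; simp
        · rw [Pi.single_eq_of_ne (Ne.symm h2)]; simp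
    simp only [alphaMode_pos, Derivation.map_smul, ← smul_sub]
    rw [← Derivation.commutator_apply, Int.cast_natCast, ← smul_neg]
    congr 1
    rcases PNat.exists_eq_succ_of_ne_one (n := i) |> fun h => em (i = 1) |>.imp_right h with
      rfl | ⟨k, rfl⟩
    · have : ⁅translation, (pderiv 1 : Derivation ℂ Fock Fock)⁆ = 0 := by
        refine derivation_ext fun j => ?_
        rw [key, if_neg fun h => ?_]; · rfl
        have := congrArg PNat.val h
        have hj := j.pos
        simp at this
      rw [this]
      simp [alphaMode_zero]
    · have : ⁅translation, (pderiv (k + 1) : Derivation ℂ Fock Fock)⁆ =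
          -((k : ℕ) : ℂ) • pderiv k := by
        refine derivation_ext fun j => ?_
        rw [key, Derivation.smul_apply, pderiv_X]
        by_cases h : k = j
        · subst h; simp
        · rw [if_neg (fun h' => h (add_right_cancel h')), Pi.single_eq_of_ne (Ne.symm h), smul_zero]
      rw [this, show (((k + 1 : ℕ+) : ℕ) : ℤ) - 1 = ((k : ℕ) : ℤ) by simp, alphaMode_pos]
      simp
  · rw [show -((i : ℕ) : ℤ) - 1 = -(((i + 1 : ℕ+) : ℕ) : ℤ) by push_cast; ring]
    simp only [alphaMode_neg]
    rw [Derivation.leibniz, translation_X]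
    simp only [smul_eq_mul, Int.cast_neg, Int.cast_natCast, neg_smul, neg_neg]
    rw [add_sub_cancel_left, mul_smul_comm, mul_comm]

theorem translation_one : translation.toLinearMap (1 : Fock) = 0 := translation.map_one_eq_zero

/-- The commutator is `k δ_{k+l,0}`, linear in `k` along each line `k + l = const`, so its second
difference vanishes. -/
theorem isLocal_alpha : IsLocal (fun n => mode alpha n) fun n => mode alpha n := by
  refine ⟨2, ?_⟩
  funext k l u
  rw [pow_two, Module.End.mul_apply]
  simp only [diff_apply, modeComm, mode_alpha, alphaMode_comm, Pi.zero_apply]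
  have e : (k + 1 + 1 + l = 0 ↔ k + l + 2 = 0) ∧ (k + 1 + (l + 1) = 0 ↔ k + l + 2 = 0) ∧
    (k + (l + 1 + 1) = 0 ↔ k + l + 2 = 0) := by omega
  simp only [e.1, e.2.1, e.2.2]
  split_ifs
  · push_cast; module
  · simp

theorem creates_alpha :
    Creates translation.toLinearMap 1 (fun n => mode alpha n) (X 1) where
  map_zero n := map_zero _
  cov n u := by simp only [mode_alpha]; exact translation_alphaMode n u
  nonneg n hn := by
    rw [mode_alpha]
    rcases int_cases_pnat n with rfl | ⟨i, rfl⟩ | ⟨i, rfl⟩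
    · rfl
    · rw [alphaMode_pos, pderiv_one, smul_zero]
    · have := i.pos
      omega
  neg_one := by
    rw [mode_alpha]
    exact (alphaMode_neg 1 1).trans (mul_one _)

/-! ### Normally ordered products with derivatives as products of negative index -/

section Derivatives

variable {M : Type*} [AddCommGroup M] [Module ℂ M]

theorem choose_mul_eq (r : ℤ) (j : ℕ) :
    r * Ring.choose (r - 1) j = (j + 1) * Ring.choose r (j + 1) := by
  have := Ring.choose_smul_choose r (n := j + 1) (k := 1) (by omega)
  rw [Ring.choose_one_right] at this
  simpa using this.symm

theorem mode_derivField (A : VertexOperator ℂ M) (n : ℤ) :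
    mode (derivField A) n = (-(n : ℂ)) • mode A (n - 1) := mode_ofModes _ _ _

theorem mode_derivField_iterate (j : ℕ) (A : VertexOperator ℂ M) (n : ℤ) :
    mode (derivField^[j] A) n =
      ((-1 : ℂ) ^ j * j.factorial * ((Ring.choose n j : ℤ) : ℂ)) • mode A (n - j) := by
  induction j generalizing n with
  | zero => simp
  | succ j ih =>
    rw [Function.iterate_succ_apply', mode_derivField, ih, smul_smul, sub_sub,
      show (1 : ℤ) + j = ((j + 1 : ℕ) : ℤ) by push_cast; ring]
    congr 1
    have := congrArg (Int.cast : ℤ → ℂ) (choose_mul_eq n j)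
    push_cast at this
    rw [Nat.factorial_succ]
    push_cast
    linear_combination (-(-1) ^ j * (j.factorial : ℂ)) * this

theorem mode_divDeriv (j : ℕ) (A : VertexOperator ℂ M) (n : ℤ) :
    mode (divDeriv j A) n = ((-1 : ℂ) ^ j * ((Ring.choose n j : ℤ) : ℂ)) • mode A (n - j) := by
  have h : mode (divDeriv j A) n = ((j.factorial : ℂ)⁻¹) • mode (derivField^[j] A) n := by
    rw [mode, divDeriv, map_smul]; rfl
  rw [h, mode_derivField_iterate, smul_smul]
  congr 1
  have := Nat.cast_ne_zero (R := ℂ).2 j.factorial_ne_zero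
  field_simp

/-- Upper negation: these are the coefficients in the expansion of `(z - w)^(-j-1)`. -/
theorem neg_one_pow_mul_choose_neg (j i : ℕ) :
    (-1 : ℂ) ^ i * ((Ring.choose (-((j + 1 : ℕ) : ℤ)) i : ℤ) : ℂ) = ((i + j).choose j : ℂ) := by
  rw [Ring.choose_neg, show ((j + 1 : ℕ) : ℤ) + i - 1 = ((i + j : ℕ) : ℤ) by push_cast; ring,
    Ring.choose_natCast, Nat.choose_symm_add]
  simp only [Int.negOnePow_def, Units.smul_def, zpow_natCast, Units.val_pow_eq_pow_val,
    Units.val_neg, Units.val_one, smul_eq_mul]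
  push_cast
  rw [← mul_assoc, ← mul_pow]
  simp

theorem finsum_nat_eq_shift {N : Type*} [AddCommMonoid N] (j : ℕ) (f : ℕ → N)
    (hf : (Function.support f).Finite) (h : ∀ i < j, f i = 0) :
    ∑ᶠ i, f i = ∑ᶠ i, f (i + j) := by
  induction j with
  | zero => simp
  | succ j ih =>
    rw [ih fun i hi => h i (by omega), finsum_nat_eq_add_succ]
    · rw [h (0 + j) (by omega), zero_add]
      refine finsum_congr fun i => ?_
      congr 1; omega
    · exact hf.preimage ((add_left_injective j).injOn)

/-- The normally ordered products with divided derivatives are the products of negative index. -/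
theorem mode_normalProd_divDeriv (j : ℕ) (A B : VertexOperator ℂ M) (n : ℤ) (u : M) :
    mode (normalProd (divDeriv j A) B) n u =
      nthProd (-((j + 1 : ℕ) : ℤ)) (fun n => mode A n) (fun n => mode B n) 0 n u := by
  rw [normalProd, mode_ofModes, nthProd_apply]
  rw [sub_eq_add_neg, show normalMode (divDeriv j A) B n u =
    (∑ᶠ i : ℕ, mode (divDeriv j A) (-(i : ℤ) - 1) (mode B (n + i) u)) +
      ∑ᶠ i : ℕ, mode B (n - 1 - i) (mode (divDeriv j A) i u) from rfl]
  congr 1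
  · refine finsum_congr fun i => ?_
    rw [neg_one_pow_mul_choose_neg, mode_divDeriv, LinearMap.smul_apply,
      show -(i : ℤ) - 1 = -((i + 1 : ℕ) : ℤ) by push_cast; ring, neg_one_pow_mul_choose_neg,
      add_comm j i, ← Nat.choose_symm_add]
    congr 3
    push_cast; ring
  -- The annihilation modes `i < j` of the divided derivative vanish with `choose i j`, so the sum
  -- starts at `j`; the sign `(-1)^j` of the derivative matches `-(-1)^(-(j+1))`.
  · rw [finsum_nat_eq_shift j _ (support_annihilation (divDeriv j A) B n u) fun i hi => ?_,
      ← neg_smul, smul_finsum]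
    · refine finsum_congr fun i => ?_
      have h1 : -(-1 : ℂ) ^ (-((j + 1 : ℕ) : ℤ)) = (-1) ^ j := by
        rw [zpow_neg, zpow_natCast, ← inv_pow, inv_neg_one, pow_succ]; ring
      rw [h1, neg_one_pow_mul_choose_neg, mode_divDeriv, LinearMap.smul_apply, map_smul, smul_smul,
        Ring.choose_natCast, Int.cast_natCast]
      congr 3
      · push_cast; ring_nf
      · push_cast; ring_nf
    · rw [mode_divDeriv, Ring.choose_natCast, Nat.choose_eq_zero_of_lt hi]
      simp

end Derivatives

end FreeBoson
end
noncomputable section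

namespace FreeBoson

open MvPolynomial

/-! ### Creation and locality for the state-field correspondence -/

theorem mode_wickField_cons (i : ℕ+) (is : List ℕ+) (n : ℤ) (u : Fock) :
    mode (wickField (i :: is)) n u =
      nthProd (-((i : ℕ) : ℤ)) (fun n => mode alpha n) (fun n => mode (wickField is) n) 0 n u := by
  rw [wickField, mode_normalProd_divDeriv, Nat.sub_add_cancel i.pos]

theorem mode_idField {M : Type*} [AddCommGroup M] [Module ℂ M] (n : ℤ) (u : M) :
    mode (idField : VertexOperator ℂ M) n u = if n = -1 then u else 0 := by
  rw [idField, mode_ofModes]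
  split_ifs <;> rfl

theorem mode_wickField_cons' (i : ℕ+) (is : List ℕ+) :
    (fun n => ⇑(mode (wickField (i :: is)) n)) =
      nthProd (-((i : ℕ) : ℤ)) (fun n => mode alpha n) (fun n => mode (wickField is) n) 0 :=
  funext fun n => funext fun u => mode_wickField_cons i is n u

/-- Prepending `i` takes the product of index `-i` with `alpha`, which creates `α_{-i} v = x_i v`.
-/
theorem creates_wickField (l : List ℕ+) : Creates translation.toLinearMap 1
    (fun n => mode (wickField l) n) (l.map fun i => (X i : Fock)).prod := by
  induction l with
  | nil =>
    refine ⟨fun n => map_zero _, fun n u => ?_, fun n hn => ?_, ?_⟩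
    · simp only [wickField, mode_idField]
      by_cases h : n - 1 = -1
      · obtain rfl : n = 0 := by omega
        simp
      · rw [if_neg h]
        split_ifs <;> simp
    · simp only [wickField, mode_idField]
      rw [if_neg (by omega)]
    · simp [wickField, mode_idField]
  | cons i is ih =>
    rw [mode_wickField_cons', List.map_cons, List.prod_cons]
    have := creates_alpha.nthProd (truncated_mode alpha) (truncated_mode (wickField is)) ih
      (-((i : ℕ) : ℤ))
    rwa [mode_alpha, alphaMode_neg] at this

theorem isLocal_idField_left {M : Type*} [AddCommGroup M] [Module ℂ M] (B : ℤ → Module.End ℂ M) :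
    IsLocal (fun n => mode (idField : VertexOperator ℂ M) n) fun n => B n := by
  refine ⟨0, ?_⟩
  rw [pow_zero, Module.End.one_apply]
  funext k l u
  simp only [modeComm, mode_idField]
  split_ifs <;> simp

/-- Dong's lemma at each factor. It also needs the locality of `alpha` with the remaining product,
which is supplied as `hl`. -/
theorem isLocal_wickField_left (C : ℤ → Module.End ℂ Fock)
    (hC : IsLocal (fun n => mode alpha n) fun n => C n) (l : List ℕ+)
    (hl : ∀ l : List ℕ+, IsLocal (fun n => mode alpha n) fun n => mode (wickField l) n) :
    IsLocal (fun n => mode (wickField l) n) fun n => C n := by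
  induction l with
  | nil => exact isLocal_idField_left C
  | cons i is ih =>
    rw [mode_wickField_cons']
    exact IsLocal.nthProd (truncated_mode alpha) (truncated_mode _) (hl is) hC ih _

theorem isLocal_alpha_wickField (l : List ℕ+) :
    IsLocal (fun n => mode alpha n) fun n => mode (wickField l) n := by
  induction l with
  | nil => exact (isLocal_idField_left (mode alpha)).symm
  | cons i is ih =>
    rw [mode_wickField_cons']
    exact (IsLocal.nthProd (truncated_mode alpha) (truncated_mode _) ih isLocal_alpha ih.symm
      _).symm

theorem isLocal_wickField (l l' : List ℕ+) :
    IsLocal (fun n => mode (wickField l) n) fun n => mode (wickField l') n :=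
  isLocal_wickField_left _ (isLocal_alpha_wickField l') l isLocal_alpha_wickField

theorem Y_monomial (d : ℕ+ →₀ ℕ) (c : ℂ) :
    Y (monomial d c) = c • wickField (d.toMultiset.sort (· ≤ ·)) := by
  have h : (monomial d c : Fock) = c • basisMonomials ℕ+ ℂ d := by
    rw [coe_basisMonomials, smul_monomial, smul_eq_mul, mul_one]
  rw [h, map_smul, Y, Module.Basis.constr_basis]

theorem prod_sort_toMultiset (d : ℕ+ →₀ ℕ) :
    ((d.toMultiset.sort (· ≤ ·)).map fun i => (X i : Fock)).prod = monomial d 1 := by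
  rw [← Multiset.prod_coe, ← Multiset.map_coe, Multiset.sort_eq, Finsupp.toMultiset_map,
    Finsupp.prod_toMultiset, Finsupp.prod_mapDomain_index (by simp) (by simp [pow_add]),
    monomial_eq, C_1, one_mul]

theorem mode_add {M : Type*} [AddCommGroup M] [Module ℂ M] (A B : VertexOperator ℂ M) (n : ℤ) :
    mode (A + B) n = mode A n + mode B n := by
  rw [mode, map_add]; rfl

theorem mode_smul {M : Type*} [AddCommGroup M] [Module ℂ M] (c : ℂ) (A : VertexOperator ℂ M)
    (n : ℤ) : mode (c • A) n = c • mode A n := by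
  rw [mode, map_smul]; rfl

theorem creates_Y (a : Fock) : Creates translation.toLinearMap 1 (fun n => mode (Y a) n) a := by
  induction a using MvPolynomial.induction_on' with
  | monomial d c =>
    have h := creates_wickField (d.toMultiset.sort (· ≤ ·))
    rw [prod_sort_toMultiset] at h
    rw [Y_monomial]
    refine ⟨fun n => map_zero _, fun n u => ?_, fun n hn => ?_, ?_⟩
    · simp only [mode_smul, LinearMap.smul_apply, map_smul, ← smul_sub, h.cov]
      rw [smul_neg, smul_comm]
    · simp only [mode_smul, LinearMap.smul_apply, h.nonneg n hn, smul_zero]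
    · simp only [mode_smul, LinearMap.smul_apply, h.neg_one]
      rw [smul_monomial, smul_eq_mul, mul_one]
  | add p q hp hq =>
    rw [map_add]
    refine ⟨fun n => map_zero _, fun n u => ?_, fun n hn => ?_, ?_⟩
    · have h1 := hp.cov n u
      have h2 := hq.cov n u
      simp only [mode_add, LinearMap.add_apply, map_add, add_sub_add_comm, h1, h2]
      rw [smul_add, neg_add]
    · simp only [mode_add, LinearMap.add_apply, hp.nonneg n hn, hq.nonneg n hn, add_zero]
    · simp only [mode_add, LinearMap.add_apply, hp.neg_one, hq.neg_one]

theorem isLocal_Y_left (C : ℤ → Module.End ℂ Fock)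
    (hC : ∀ l : List ℕ+, IsLocal (fun n => mode (wickField l) n) fun n => C n) (a : Fock) :
    IsLocal (fun n => mode (Y a) n) fun n => C n := by
  induction a using MvPolynomial.induction_on' with
  | monomial d c =>
    rw [Y_monomial]
    simp only [mode_smul]
    exact (hC _).smul_left c
  | add p q hp hq =>
    rw [map_add]
    simp only [mode_add]
    exact hp.add_left hq

theorem isLocal_Y_wickField (a : Fock) (l : List ℕ+) :
    IsLocal (fun n => mode (Y a) n) fun n => mode (wickField l) n :=
  isLocal_Y_left _ (fun l' => isLocal_wickField l' l) a

theorem isLocal_Y (a b : Fock) : IsLocal (fun n => mode (Y a) n) fun n => mode (Y b) n :=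
  isLocal_Y_left _ (fun l => (isLocal_Y_wickField b l).symm) a

theorem isVertexAlgebra_Y : IsVertexAlgebra Y 1 :=
  isVertexAlgebra_of_local translation_one creates_Y isLocal_Y

theorem ext_mode {M : Type*} [AddCommGroup M] [Module ℂ M] {A B : VertexOperator ℂ M}
    (h : ∀ n, mode A n = mode B n) : A = B := by
  refine HVertexOperator.coeff_inj (funext fun n => ?_)
  rw [VertexOperator.coeff_eq_ncoeff, VertexOperator.coeff_eq_ncoeff]
  exact h _

/-- The nested normally ordered products do not depend on the order of the factors. -/
theorem wickField_eq_Y (l : List ℕ+) : wickField l = Y (l.map fun i => (X i : Fock)).prod := by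
  refine ext_mode fun n => LinearMap.ext fun u => ?_
  exact congrFun (congrFun ((creates_wickField l).unique translation_one (creates_Y _) fun b =>
    ⟨mode (Y b), creates_Y b, (isLocal_Y_wickField b l).symm, isLocal_Y _ b⟩) n) u

/-- Both fields create `x₁` and are local with all `Y b`, so uniqueness avoids computing the
normally ordered product with the identity field. -/
theorem Y_x_one : Y (x 1) = alpha := by
  refine ext_mode fun n => LinearMap.ext fun u => ?_
  refine congrFun (congrFun ((creates_Y (x 1)).unique translation_one creates_alpha fun b =>
    ⟨mode (Y b), creates_Y b, isLocal_Y _ b, ?_⟩) n) u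
  exact (isLocal_Y_left (mode alpha) (fun l => (isLocal_alpha_wickField l).symm) b).symm

theorem mode_Y_one (n : ℤ) (u : Fock) : mode (Y 1) n u = if n = -1 then u else 0 := by
  have := wickField_eq_Y []
  rw [List.map_nil, List.prod_nil] at this
  rw [← this]
  exact mode_idField n u

end FreeBoson
end
noncomputable section

namespace FreeBoson

open MvPolynomial

/-! ### Consequences of the Borcherds identity -/

section General

variable {V : Type*} [AddCommGroup V] [Module ℂ V]

theorem mode_normalProd_idField (A : VertexOperator ℂ V) (n : ℤ) (u : V) :
    mode (normalProd A idField) n u = mode A n u := by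
  rw [normalProd, mode_ofModes, show normalMode A idField n u =
    (∑ᶠ i : ℕ, mode A (-(i : ℤ) - 1) (mode idField (n + i) u)) +
      ∑ᶠ i : ℕ, mode idField (n - 1 - i) (mode A i u) from rfl]
  simp only [mode_idField]
  by_cases hn : 0 ≤ n
  · rw [finsum_eq_zero_of_forall_eq_zero fun i => by rw [if_neg (by omega), map_zero],
      finsum_eq_single _ n.toNat fun i hi => by rw [if_neg (by omega)],
      if_pos (by omega), zero_add, Int.toNat_of_nonneg hn]
  · rw [finsum_eq_single _ (-n - 1).toNat fun i hi => by rw [if_neg (by omega), map_zero],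
      finsum_eq_zero_of_forall_eq_zero fun i => by rw [if_neg (by omega)],
      if_pos (by omega), add_zero]
    congr 2
    omega

theorem map_nthProd (σ : V ≃ₗ[ℂ] V) {A B A' B' : ℤ → V → V} (hA : ∀ n u, σ (A n u) = A' n (σ u))
    (hB : ∀ n u, σ (B n u) = B' n (σ u)) (m k l : ℤ) (u : V) :
    σ (nthProd m A B k l u) = nthProd m A' B' k l (σ u) := by
  have h : ∀ f : ℕ → V, σ (∑ᶠ i, f i) = ∑ᶠ i, σ (f i) :=
    fun f => σ.toAddEquiv.map_finsum f
  simp only [nthProd_apply, map_sub, map_smul, h, hA, hB]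

variable {Y : V →ₗ[ℂ] VertexOperator ℂ V} {vac : V}

/-- The commutator formula. -/
theorem IsVertexAlgebra.commutator (h : IsVertexAlgebra Y vac) (a b c : V) (k l : ℤ) :
    mode (Y a) k (mode (Y b) l c) - mode (Y b) l (mode (Y a) k c) =
      ∑ᶠ i : ℕ, ((Ring.choose k i : ℤ) : ℂ) • mode (Y (mode (Y a) i b)) (k + l - i) c := by
  have := h.borcherds a b c k l 0
  simp only [zero_add] at this
  rw [this, finsum_eq_single _ 0 fun i hi => ?_]
  · simp
  · rw [Ring.choose_zero_pos ℤ (Nat.pos_of_ne_zero hi)]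
    simp

/-- If the lower modes of `a` vanish, then `a_(m)` is a derivation of all products. -/
theorem IsVertexAlgebra.derivation (h : IsVertexAlgebra Y vac) {a : V} {m : ℕ}
    (ha : ∀ j : ℕ, j < m → mode (Y a) j = 0) (b c : V) (l : ℤ) :
    mode (Y a) m (mode (Y b) l c) =
      mode (Y (mode (Y a) m b)) l c + mode (Y b) l (mode (Y a) m c) := by
  -- In the commutator formula the terms `i < m` vanish by hypothesis and the terms `i > m` because
  -- `choose m i = 0`.
  rw [← sub_eq_iff_eq_add, h.commutator, finsum_eq_single _ m fun i hi => ?_]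
  · rw [Ring.choose_natCast, Nat.choose_self, add_sub_cancel_left]
    simp
  · rcases lt_or_gt_of_ne hi with h1 | h1
    · rw [ha i h1, LinearMap.zero_apply, map_zero, mode, map_zero]
      simp
    · rw [Ring.choose_natCast, Nat.choose_eq_zero_of_lt h1]
      simp

end General

theorem mode_Y_mode_Y (a b : Fock) (m l : ℤ) (c : Fock) : mode (Y (mode (Y a) m b)) l c =
    nthProd m (fun n => mode (Y a) n) (fun n => mode (Y b) n) 0 l c :=
  mode_mode_eq_nthProd translation_one creates_Y isLocal_Y a b m l c

/-- Since `x_i b = (x₁)_(-i) b`, this recursion permits induction on polynomials without ordering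
the factors of a monomial. -/
theorem mode_Y_X_mul (i : ℕ+) (b : Fock) (n : ℤ) (u : Fock) : mode (Y (X i * b)) n u =
    nthProd (-((i : ℕ) : ℤ)) (fun n => alphaMode n) (fun n => mode (Y b) n) 0 n u := by
  rw [← alphaMode_neg, ← mode_alpha, ← Y_x_one, mode_Y_mode_Y, Y_x_one]
  simp only [mode_alpha]

theorem mode_Y_C (c : ℂ) (n : ℤ) (u : Fock) :
    mode (Y (C c)) n u = if n = -1 then c • u else 0 := by
  rw [show (C c : Fock) = c • 1 by rw [smul_eq_C_mul, mul_one], map_smul, mode_smul,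
    LinearMap.smul_apply, mode_Y_one]
  split_ifs <;> simp

/-- Covariance at index `-1` on the vacuum. It expresses `T` through the products and the vacuum, so
automorphisms commute with it. -/
theorem translation_eq (a : Fock) : translation a = mode (Y a) (-2) 1 := by
  have := (creates_Y a).cov (-1) 1
  rw [translation_one, map_zero, sub_zero, (creates_Y a).neg_one] at this
  refine this.trans ?_
  norm_num

/-- `T a` is `a_(-2) 1`, and the product of index `-2` with the identity field is differentiation.
-/
theorem mode_Y_translation (a : Fock) (n : ℤ) (u : Fock) :
    mode (Y (translation a)) n u = -((n : ℂ) • mode (Y a) (n - 1) u) := by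
  have h := mode_normalProd_divDeriv 1 (Y a) idField n u
  rw [mode_normalProd_idField, mode_divDeriv] at h
  rw [translation_eq, mode_Y_mode_Y, show (-2 : ℤ) = -((1 + 1 : ℕ) : ℤ) by norm_num]
  have e : (fun n => ⇑(mode (Y 1) n)) = fun n => ⇑(mode (idField : VertexOperator ℂ Fock) n) := by
    funext n u
    rw [mode_Y_one, mode_idField]
  rw [e, ← h, Ring.choose_one_right]
  simp

/-! ### Automorphisms -/

theorem Aut_apply_mode (σ : Aut Y) (a b : Fock) (n : ℤ) :
    (σ : Fock ≃ₗ[ℂ] Fock) (mode (Y a) n b) =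
      mode (Y ((σ : Fock ≃ₗ[ℂ] Fock) a)) n ((σ : Fock ≃ₗ[ℂ] Fock) b) := σ.2 a b n

/-- With `σ v = 1`, applying `σ` to `1_(-1) v = v` gives `1 = (σ 1)_(-1) 1 = σ 1`. -/
theorem Aut_apply_one (σ : Aut Y) : (σ : Fock ≃ₗ[ℂ] Fock) 1 = 1 := by
  obtain ⟨v, hv⟩ := (σ : Fock ≃ₗ[ℂ] Fock).surjective 1
  have h1 := Aut_apply_mode σ 1 v (-1)
  rw [mode_Y_one, if_pos rfl, hv, isVertexAlgebra_Y.vacuum_neg_one] at h1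
  exact h1.symm

theorem Aut_apply_C (σ : Aut Y) (c : ℂ) : (σ : Fock ≃ₗ[ℂ] Fock) (C c) = C c := by
  rw [show (C c : Fock) = c • 1 by rw [smul_eq_C_mul, mul_one], map_smul, Aut_apply_one]

theorem Aut_apply_translation (σ : Aut Y) (a : Fock) :
    (σ : Fock ≃ₗ[ℂ] Fock) (translation a) = translation ((σ : Fock ≃ₗ[ℂ] Fock) a) := by
  rw [translation_eq, Aut_apply_mode, Aut_apply_one, translation_eq]

theorem Aut_apply_X_mul (σ : Aut Y) (i : ℕ+) (a : Fock) :
    (σ : Fock ≃ₗ[ℂ] Fock) (X i * a) = mode (Y ((σ : Fock ≃ₗ[ℂ] Fock) (x 1))) (-((i : ℕ) : ℤ))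
      ((σ : Fock ≃ₗ[ℂ] Fock) a) := by
  rw [← Aut_apply_mode, Y_x_one, mode_alpha, alphaMode_neg]

/-- All monomials arise from `1` by the modes `(x₁)_(-i)`. -/
theorem Aut_ext {σ ρ : Aut Y} (h : (σ : Fock ≃ₗ[ℂ] Fock) (x 1) = (ρ : Fock ≃ₗ[ℂ] Fock) (x 1)) :
    σ = ρ := by
  refine Subtype.ext (LinearEquiv.ext fun v => ?_)
  induction v using MvPolynomial.induction_on with
  | C c => rw [Aut_apply_C, Aut_apply_C]
  | add p q hp hq => rw [map_add, map_add, hp, hq]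
  | mul_X p i hp => rw [mul_comm, Aut_apply_X_mul, Aut_apply_X_mul, h, hp]

/-- A linear bijection that fixes the vacuum is an automorphism if it preserves the products with
the generator `x₁`. -/
theorem mem_Aut_of_alphaMode (σ : Fock ≃ₗ[ℂ] Fock) (h : Fock) (h1 : σ 1 = 1)
    (hσ : ∀ n v, σ (alphaMode n v) = mode (Y h) n (σ v)) : σ ∈ Aut Y := by
  intro a b n
  induction a using MvPolynomial.induction_on generalizing b n with
  | C c =>
    rw [show σ (C c) = C c by
      rw [show (C c : Fock) = c • 1 by rw [smul_eq_C_mul, mul_one], map_smul, h1],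
      mode_Y_C, mode_Y_C]
    split_ifs <;> simp
  | add p q hp hq =>
    rw [map_add, map_add, map_add, mode_add, mode_add, LinearMap.add_apply, LinearMap.add_apply,
      map_add, hp, hq]
  | mul_X p i hp =>
    rw [mul_comm p, mode_Y_X_mul, ← alphaMode_neg, hσ, mode_Y_mode_Y]
    exact map_nthProd σ hσ (fun n u => hp u n) _ _ _ _

/-! ### The affine automorphisms -/

section Affine

/-- The algebra endomorphism with `x_i ↦ ε x_i` for `i > 1` and `x₁ ↦ ε x₁ + a`. -/
def affineHom (ε a : ℂ) : Fock →ₐ[ℂ] Fock :=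
  aeval fun i : ℕ+ => C ε * X i + if i = 1 then C a else 0

theorem affineHom_X (ε a : ℂ) (i : ℕ+) :
    affineHom ε a (X i) = C ε * X i + if i = 1 then C a else 0 := aeval_X _ _

theorem affineHom_affineHom (ε a ε' a' : ℂ) (v : Fock) :
    affineHom ε a (affineHom ε' a' v) = affineHom (ε' * ε) (ε' * a + a') v := by
  suffices h : (affineHom ε a).comp (affineHom ε' a') = affineHom (ε' * ε) (ε' * a + a') from
    DFunLike.congr_fun h v
  refine algHom_ext fun i => ?_
  rw [AlgHom.comp_apply, affineHom_X, affineHom_X, map_add, map_mul, affineHom_X]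
  have hC : ∀ c : ℂ, affineHom ε a (C c) = C c := fun c => (affineHom ε a).commutes c
  rw [hC]
  split_ifs
  · rw [hC]; simp only [C_mul, C_add]; ring
  · simp only [C_mul, map_zero]; ring

theorem affineHom_one_zero (v : Fock) : affineHom 1 0 v = v := by
  have : affineHom 1 0 = AlgHom.id ℂ Fock := by
    refine algHom_ext fun i => ?_
    rw [affineHom_X]; simp
  rw [this]; rfl

/-- The chain rule: the image of `x_j` has derivative `ε` with respect to `x_j` and `0` with respect
to the other variables. -/
theorem pderiv_affineHom (ε a : ℂ) (i : ℕ+) (v : Fock) :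
    affineHom ε a (C ε * pderiv i v) = pderiv i (affineHom ε a v) := by
  have hC : ∀ c : ℂ, affineHom ε a (C c) = C c := fun c => (affineHom ε a).commutes c
  induction v using MvPolynomial.induction_on with
  | C c => rw [pderiv_C, mul_zero, map_zero, hC, pderiv_C]
  | add p q hp hq => rw [map_add, mul_add, map_add, hp, hq, map_add, map_add]
  | mul_X p j hp =>
    have e : affineHom ε a (p * X j) = affineHom ε a p * (C ε * X j + if j = 1 then C a else 0) := by
      rw [map_mul, affineHom_X]
    rw [e, Derivation.leibniz, Derivation.leibniz, ← hp, pderiv_X]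
    have h0 : pderiv i (if j = 1 then (C a : Fock) else 0) = 0 := by
      split_ifs <;> simp
    simp only [smul_eq_mul, mul_add, map_mul, map_add, h0, affineHom_X, pderiv_C_mul, pderiv_X, hC,
      add_zero]
    rcases eq_or_ne j i with rfl | hji
    · rw [Pi.single_eq_same, map_one]; ring
    · rw [Pi.single_eq_of_ne hji, map_zero]; ring

/-- The affine automorphisms, as linear bijections. -/
def affineEquiv (ε a : ℂ) (h : ε * ε = 1) : Fock ≃ₗ[ℂ] Fock :=
  LinearEquiv.ofLinearMap (affineHom ε a).toLinearMap
    (affineHom ε (-(ε * a))).toLinearMap (LinearMap.ext fun v => by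
      change affineHom _ _ (affineHom _ _ v) = v
      rw [affineHom_affineHom, h, show ε * a + -(ε * a) = 0 by ring, affineHom_one_zero]) (LinearMap.ext fun v => by
      change affineHom _ _ (affineHom _ _ v) = v
      rw [affineHom_affineHom, h, show ε * -(ε * a) + a = 0 by linear_combination (-a) * h,
        affineHom_one_zero])

theorem affineEquiv_apply (ε a : ℂ) (h : ε * ε = 1) (v : Fock) :
    affineEquiv ε a h v = affineHom ε a v := rfl

/-- Conjugation has to carry `α_n` to the modes `ε α_n + a δ_{n,-1}` of the field of `εx₁ + a`. For
`n < 0` this is the substitution itself. For `n > 0` the chain rule gives `ε⁻¹ ∂/∂x_n`, which is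
where `ε² = 1` enters. -/
theorem affineEquiv_mem_Aut (ε a : ℂ) (h : ε * ε = 1) : affineEquiv ε a h ∈ Aut Y := by
  refine mem_Aut_of_alphaMode _ (ε • x 1 + C a) (map_one (affineHom ε a)) fun n v => ?_
  rw [map_add, map_smul, Y_x_one, mode_add, mode_smul, LinearMap.add_apply, LinearMap.smul_apply,
    mode_alpha, mode_Y_C]
  simp only [affineEquiv_apply]
  rcases int_cases_pnat n with rfl | ⟨i, rfl⟩ | ⟨i, rfl⟩
  · simp [alphaMode_zero]
  · have := i.pos
    rw [if_neg (by omega), add_zero, alphaMode_pos, alphaMode_pos, ← pderiv_affineHom, map_smul,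
      map_mul, show affineHom ε a (C ε) = C ε from (affineHom ε a).commutes ε, ← smul_eq_C_mul,
      smul_comm ε, smul_smul ε, h, one_smul]
  · rw [alphaMode_neg, alphaMode_neg, map_mul, affineHom_X, add_mul, mul_assoc, ← smul_eq_C_mul]
    congr 1
    by_cases hi : i = 1
    · subst hi; simp [smul_eq_C_mul]
    · have : ¬ -((i : ℕ) : ℤ) = -1 := fun h => hi (PNat.eq (by rw [PNat.one_coe]; omega))
      rw [if_neg hi, if_neg this, zero_mul]

/-- The affine automorphisms of the free bosonic vertex algebra. -/
def affineAut (ε a : ℂ) (h : ε * ε = 1) : Aut Y := ⟨affineEquiv ε a h, affineEquiv_mem_Aut ε a h⟩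

theorem affineAut_apply (ε a : ℂ) (h : ε * ε = 1) (v : Fock) :
    (affineAut ε a h : Fock ≃ₗ[ℂ] Fock) v = affineHom ε a v := rfl

theorem affineAut_x_one (ε a : ℂ) (h : ε * ε = 1) :
    (affineAut ε a h : Fock ≃ₗ[ℂ] Fock) (x 1) = ε • x 1 + C a := by
  rw [affineAut_apply, affineHom_X, if_pos rfl, smul_eq_C_mul]

end Affine

end FreeBoson
end
noncomputable section

namespace FreeBoson

open MvPolynomial

/-! ### The filtration by the degree -/

/-- The polynomials of degree less than `k`. -/
def low (k : ℕ) : Submodule ℂ Fock where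
  carrier := {p | ∀ d : ℕ+ →₀ ℕ, k ≤ d.degree → coeff d p = 0}
  zero_mem' _ _ := coeff_zero _
  add_mem' hp hq d hd := by rw [coeff_add, hp d hd, hq d hd, add_zero]
  smul_mem' c p hp d hd := by rw [coeff_smul, hp d hd, smul_zero]

theorem low_mono {k l : ℕ} (h : k ≤ l) : low k ≤ low l := fun _ hp d hd => hp d (h.trans hd)

theorem eq_zero_of_mem_low_zero {p : Fock} (h : p ∈ low 0) : p = 0 :=
  MvPolynomial.ext _ _ fun d => by rw [h d (Nat.zero_le _), coeff_zero]

theorem monomial_mem_low {k : ℕ} {d : ℕ+ →₀ ℕ} (h : d.degree < k) (c : ℂ) :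
    monomial d c ∈ low k := by
  intro e he
  rw [coeff_monomial, if_neg]
  rintro rfl
  omega

/-- The bounds are strict: degree at most `k` times degree less than `l` has degree less than `k +
l`. -/
theorem mul_mem_low {k l : ℕ} {p q : Fock} (hp : p ∈ low (k + 1)) (hq : q ∈ low l) :
    p * q ∈ low (k + l) := by
  intro d hd
  rw [coeff_mul]
  refine Finset.sum_eq_zero fun e he => ?_
  have h : e.1 + e.2 = d := Finset.HasAntidiagonal.mem_antidiagonal.1 he
  have h' : e.1.degree + e.2.degree = d.degree := by rw [← h, map_add]
  by_cases h1 : k + 1 ≤ e.1.degree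
  · rw [hp _ h1, zero_mul]
  · rw [hq _ (by omega), mul_zero]

theorem X_mem_low (i : ℕ+) : (X i : Fock) ∈ low 2 :=
  monomial_mem_low (by rw [Finsupp.degree_single]; norm_num) _

theorem C_mem_low (c : ℂ) : (C c : Fock) ∈ low 1 :=
  monomial_mem_low (by rw [map_zero]; norm_num) _

theorem totalDegree_mem_low (p : Fock) : p ∈ low (p.totalDegree + 1) := by
  intro d hd
  by_contra h
  have := le_totalDegree (mem_support_iff.2 h)
  rw [Finsupp.degree_apply] at hd
  rw [Finsupp.sum] at this
  omega

theorem eq_C_of_mem_low_one {p : Fock} (h : p ∈ low 1) : p = C (coeff 0 p) := by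
  refine MvPolynomial.ext _ _ fun d => ?_
  rw [coeff_C]
  split_ifs with hd
  · rw [hd]
  · refine h d (Nat.one_le_iff_ne_zero.2 fun h0 => hd ?_)
    exact ((Finsupp.degree_eq_zero_iff d).1 h0).symm

/-- The monomial with the given list of indices. -/
abbrev listMonomial (l : List ℕ+) : Fock := (l.map fun i => (X i : Fock)).prod

theorem exists_listMonomial (d : ℕ+ →₀ ℕ) :
    ∃ l : List ℕ+, l.length = d.degree ∧ listMonomial l = monomial d 1 := by
  refine ⟨_, ?_, prod_sort_toMultiset d⟩
  rw [Multiset.length_sort, Finsupp.card_toMultiset]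
  rfl

theorem listMonomial_mem_low (l : List ℕ+) : listMonomial l ∈ low (l.length + 1) := by
  induction l with
  | nil => exact C_mem_low 1
  | cons i l ih =>
    have := mul_mem_low (X_mem_low i) ih
    rw [List.length_cons, add_comm l.length 1]
    simpa [listMonomial, add_comm, add_left_comm, add_assoc] using this

theorem mem_of_forall_support {S : Submodule ℂ Fock} {p : Fock}
    (h : ∀ l : List ℕ+, (∃ d, coeff d p ≠ 0 ∧ d.degree = l.length) → listMonomial l ∈ S) :
    p ∈ S := by
  rw [← support_sum_monomial_coeff p]
  refine S.sum_mem fun d hd => ?_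
  obtain ⟨l, hl, hl'⟩ := exists_listMonomial d
  have := S.smul_mem (coeff d p) (h l ⟨d, mem_support_iff.1 hd, hl.symm⟩)
  rwa [hl', smul_monomial, smul_eq_mul, mul_one] at this

theorem low_le {S : Submodule ℂ Fock} {k : ℕ}
    (h : ∀ l : List ℕ+, l.length < k → listMonomial l ∈ S) : low k ≤ S := fun p hp =>
  mem_of_forall_support fun l ⟨d, hd, hl⟩ => h l (by
    rw [← hl]
    by_contra h'
    exact hd (hp d (by omega)))

theorem homogeneous_mem {S : Submodule ℂ Fock} {k : ℕ}
    (h : ∀ l : List ℕ+, l.length = k → listMonomial l ∈ S) {p : Fock} (hp : p.IsHomogeneous k) :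
    p ∈ S :=
  mem_of_forall_support fun l ⟨d, hd, hl⟩ => h l (by
    rw [← hl]
    by_contra h'
    exact hd (hp.coeff_eq_zero h'))

theorem isHomogeneous_listMonomial (l : List ℕ+) : (listMonomial l).IsHomogeneous l.length := by
  induction l with
  | nil => exact isHomogeneous_one _ _
  | cons i l ih =>
    have := (isHomogeneous_X ℂ i).mul ih
    rw [List.length_cons, add_comm]
    simpa [listMonomial] using this

theorem translation_listMonomial_cons (i : ℕ+) (l : List ℕ+) :
    translation (listMonomial (i :: l)) = ((i : ℕ) : ℂ) • (X (i + 1) * listMonomial l) +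
      X i * translation (listMonomial l) := by
  rw [listMonomial, List.map_cons, List.prod_cons, Derivation.leibniz, translation_X]
  simp only [smul_eq_mul]
  rw [add_comm, mul_smul_comm, mul_comm (X (i + 1))]

theorem isHomogeneous_translation {k : ℕ} {p : Fock} (hp : p.IsHomogeneous k) :
    (translation p).IsHomogeneous k := by
  have key : ∀ l : List ℕ+, (translation (listMonomial l)).IsHomogeneous l.length := by
    intro l
    induction l with
    | nil =>
      rw [show translation (listMonomial []) = 0 from translation.map_one_eq_zero]
      exact isHomogeneous_zero _ _ _
    | cons i l ih =>
      rw [translation_listMonomial_cons, List.length_cons, add_comm l.length]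
      exact ((homogeneousSubmodule ℕ+ ℂ _).smul_mem _
        ((isHomogeneous_X ℂ (i + 1)).mul (isHomogeneous_listMonomial l))).add
        ((isHomogeneous_X ℂ i).mul ih)
  exact homogeneous_mem (S := (homogeneousSubmodule ℕ+ ℂ k).comap translation.toLinearMap)
    (fun l hl => by subst hl; exact key l) hp

theorem mem_low_of_isHomogeneous {k : ℕ} {p : Fock} (hp : p.IsHomogeneous k) :
    p ∈ low (k + 1) := fun _ hd => hp.coeff_eq_zero (by omega)

theorem translation_mem_low {k : ℕ} {p : Fock} (hp : p ∈ low k) : translation p ∈ low k :=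
  low_le (S := (low k).comap translation.toLinearMap) (fun l hl => low_mono (by omega)
    (mem_low_of_isHomogeneous (isHomogeneous_translation (isHomogeneous_listMonomial l)))) hp

theorem coeff_pderiv (i : ℕ+) (p : Fock) (e : ℕ+ →₀ ℕ) :
    coeff e (pderiv i p) = ((e i + 1 : ℕ) : ℂ) * coeff (e + Finsupp.single i 1) p := by
  induction p using MvPolynomial.induction_on' with
  | monomial d c =>
    rw [pderiv_monomial, coeff_monomial, coeff_monomial]
    by_cases h : d = e + Finsupp.single i 1
    · subst h
      simp [mul_comm]
    · rw [if_neg h]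
      by_cases h0 : d i = 0
      · simp [h0]
      · rw [if_neg, mul_zero]
        intro h'
        refine h (h' ▸ ?_)
        refine (tsub_add_cancel_of_le ?_).symm
        rw [Finsupp.single_le_iff]
        omega
  | add p q hp hq => rw [map_add, coeff_add, coeff_add, hp, hq, mul_add]

theorem pderiv_mem_low {k : ℕ} {p : Fock} (hp : p ∈ low (k + 1)) (i : ℕ+) :
    pderiv i p ∈ low k := by
  intro d hd
  rw [coeff_pderiv, hp, mul_zero]
  rw [map_add, Finsupp.degree_single]
  omega

/-- Characteristic zero: a monomial containing `x_i` keeps a nonzero coefficient. -/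
theorem pderiv_ne_zero {p : Fock} {i : ℕ+} (hi : i ∈ p.vars) : pderiv i p ≠ 0 := by
  obtain ⟨d, hd, hid⟩ := (mem_vars_iff_mem_support i).1 hi
  intro h
  have := coeff_pderiv i p (d - Finsupp.single i 1)
  rw [h, coeff_zero, tsub_add_cancel_of_le (by
    rw [Finsupp.single_le_iff]; have := Finsupp.mem_support_iff.1 hid; omega)] at this
  exact (mul_ne_zero (Nat.cast_ne_zero.2 (Nat.succ_ne_zero _)) (mem_support_iff.1 hd)) this.symm

theorem alphaMode_mem_low {k : ℕ} {p : Fock} (hp : p ∈ low (k + 1)) (j : ℕ) :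
    alphaMode j p ∈ low k := by
  rcases int_cases_pnat (j : ℤ) with h | ⟨i, h⟩ | ⟨i, h⟩
  · rw [h, alphaMode_zero]; exact Submodule.zero_mem _
  · rw [h, alphaMode_pos]; exact Submodule.smul_mem _ _ (pderiv_mem_low hp i)
  · have := i.pos
    omega

theorem alphaMode_neg_mem_low {k : ℕ} {p : Fock} (hp : p ∈ low k) {n : ℤ} (hn : n < 0) :
    alphaMode n p ∈ low (k + 1) := by
  rcases int_cases_pnat n with h | ⟨i, h⟩ | ⟨i, rfl⟩
  · omega
  · have := i.pos
    omega
  · rw [alphaMode_neg, add_comm]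
    exact mul_mem_low (X_mem_low i) hp

theorem finsum_mem_submodule {S : Submodule ℂ Fock} {f : ℕ → Fock} (h : ∀ i, f i ∈ S) :
    ∑ᶠ i, f i ∈ S :=
  finsum_induction (· ∈ S) S.zero_mem (fun _ _ => S.add_mem) h

/-! ### The leading terms of the products -/

/-- The divided power `T^s / s!` of the translation operator. -/
def divTranslation (s : ℕ) (a : Fock) : Fock := ((s.factorial : ℂ)⁻¹) • translation^[s] a

theorem divTranslation_succ (s : ℕ) (a : Fock) :
    divTranslation (s + 1) a = ((s + 1 : ℂ)⁻¹) • divTranslation s (translation a) := by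
  rw [divTranslation, divTranslation, Function.iterate_succ_apply, smul_smul, Nat.factorial_succ,
    Nat.cast_mul, mul_inv]
  push_cast
  rfl

theorem divTranslation_mem {S : Submodule ℂ Fock} (hS : ∀ a ∈ S, translation a ∈ S) (s : ℕ)
    {a : Fock} (ha : a ∈ S) : divTranslation s a ∈ S := by
  induction s generalizing a with
  | zero => simpa [divTranslation] using ha
  | succ s ih => rw [divTranslation_succ]; exact S.smul_mem _ (ih (hS a ha))

/-- Iterating `(T a)_(n) = -n a_(n-1)` reduces all negative modes to the mode `-1`. -/
theorem mode_Y_neg (s : ℕ) (a b : Fock) :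
    mode (Y a) (-((s + 1 : ℕ) : ℤ)) b = mode (Y (divTranslation s a)) (-1) b := by
  induction s generalizing a with
  | zero => simp [divTranslation]
  | succ s ih =>
    have h := mode_Y_translation a (-((s + 1 : ℕ) : ℤ)) b
    rw [divTranslation_succ, map_smul, mode_smul, LinearMap.smul_apply, ← ih, h,
      show -((s + 1 : ℕ) : ℤ) - 1 = -((s + 1 + 1 : ℕ) : ℤ) by push_cast; ring, ← neg_smul,
      smul_smul]
    have : ((s : ℂ) + 1) ≠ 0 := Nat.cast_add_one_ne_zero s
    have h2 : ((s : ℂ) + 1)⁻¹ * -((-((s + 1 : ℕ) : ℤ) : ℤ) : ℂ) = 1 := by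
      push_cast
      rw [neg_neg, inv_mul_cancel₀ this]
    rw [h2, one_smul]

/-- `a_(-1) b` is `a b` up to terms of lower degree, and the other `a_(n) b` are of lower degree
for `n ≥ 0`. -/
theorem mode_Y_leading (k : ℕ) : ∀ a ∈ low (k + 1), ∀ (m : ℕ), ∀ b ∈ low (m + 1),
    mode (Y a) (-1) b - a * b ∈ low (k + m) ∧ ∀ n : ℕ, mode (Y a) n b ∈ low (k + m) := by
  induction k with
  | zero =>
    intro a ha m b hb
    rw [eq_C_of_mem_low_one ha]
    constructor
    · rw [mode_Y_C, if_pos rfl, smul_eq_C_mul, sub_self]; exact Submodule.zero_mem _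
    · intro n
      rw [mode_Y_C, if_neg (by omega)]; exact Submodule.zero_mem _
  | succ k ih =>
    intro a ha m b hb
    -- A crude bound for all modes: no product raises the degree beyond the sum of the degrees.
    -- Negative modes reduce to `-1`, because `T` preserves the filtration.
    have hbd : ∀ a' ∈ low (k + 1), ∀ m, ∀ b ∈ low m, ∀ n : ℤ, mode (Y a') n b ∈ low (k + m) := by
      intro a' ha' m b hb n
      obtain _ | m := m
      · rw [eq_zero_of_mem_low_zero hb, map_zero]; exact Submodule.zero_mem _
      by_cases hn : 0 ≤ n
      · obtain ⟨j, rfl⟩ := Int.eq_ofNat_of_zero_le hn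
        exact low_mono (by omega) ((ih a' ha' m b hb).2 j)
      · obtain ⟨s, rfl⟩ : ∃ s : ℕ, n = -((s + 1 : ℕ) : ℤ) := ⟨(-n - 1).toNat, by omega⟩
        rw [mode_Y_neg]
        have h1 := divTranslation_mem (S := low (k + 1)) (fun _ => translation_mem_low) s ha'
        have h2 := (ih _ h1 m b hb).1
        rw [← sub_add_cancel (mode (Y (divTranslation s a')) (-1) b) (divTranslation s a' * b)]
        exact Submodule.add_mem _ (low_mono (by omega) h2) (mul_mem_low h1 hb)
    let S : Submodule ℂ Fock :=
      { carrier := {a | mode (Y a) (-1) b - a * b ∈ low (k + 1 + m) ∧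
          ∀ n : ℕ, mode (Y a) n b ∈ low (k + 1 + m)}
        zero_mem' := by
          rw [Set.mem_ofPred_eq]
          have h : ∀ n, mode (Y 0) n b = 0 := fun n => by
            rw [map_zero, mode, map_zero]; rfl
          simp only [h, zero_mul, sub_zero]
          exact ⟨Submodule.zero_mem _, fun _ => Submodule.zero_mem _⟩
        add_mem' := by
          rintro p q ⟨h1, h2⟩ ⟨h3, h4⟩
          simp only [Set.mem_ofPred_eq, map_add, mode_add, LinearMap.add_apply, add_mul,
            add_sub_add_comm]
          exact ⟨Submodule.add_mem _ h1 h3, fun n => Submodule.add_mem _ (h2 n) (h4 n)⟩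
        smul_mem' := by
          rintro c p ⟨h1, h2⟩
          simp only [Set.mem_ofPred_eq, map_smul, mode_smul, LinearMap.smul_apply, smul_mul_assoc,
            ← smul_sub]
          exact ⟨Submodule.smul_mem _ _ h1, fun n => Submodule.smul_mem _ _ (h2 n)⟩ }
    refine low_le (S := S) (fun l hl => ?_) ha
    obtain _ | ⟨i, l⟩ := l
    · obtain ⟨h1, h2⟩ := ih 1 (low_mono (by omega) (C_mem_low 1)) m b hb
      exact ⟨low_mono (by omega) h1, fun n => low_mono (by omega) (h2 n)⟩
    · have hl' : listMonomial l ∈ low (k + 1) :=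
        low_mono (by rw [List.length_cons] at hl; omega) (listMonomial_mem_low l)
      have e : listMonomial (i :: l) = X i * listMonomial l := by
        rw [listMonomial, List.map_cons, List.prod_cons]
      -- The annihilation terms first apply some `α_j` with `j ≥ 0` to `b`, which costs a degree.
      have hsec : ∀ n : ℤ, (-1 : ℂ) ^ (-((i : ℕ) : ℤ)) • ∑ᶠ j : ℕ,
          ((-1 : ℂ) ^ j * ((Ring.choose (-((i : ℕ) : ℤ)) j : ℤ) : ℂ)) •
            mode (Y (listMonomial l)) (n + -((i : ℕ) : ℤ) - j) (alphaMode (0 + j) b) ∈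
              low (k + 1 + m) := fun n =>
        Submodule.smul_mem _ _ (finsum_mem_submodule fun j => Submodule.smul_mem _ _ (by
          rw [zero_add]
          exact low_mono (by omega) (hbd _ hl' m _ (alphaMode_mem_low hb j) _)))
      -- A nonnegative mode of the remaining factor loses a degree by induction, and `α` of negative
      -- index adds only one.
      have hfst : ∀ (n : ℤ) (c : ℂ), 0 ≤ n → ∀ j : ℕ, c • alphaMode (0 + -((i : ℕ) : ℤ) - j)
          (mode (Y (listMonomial l)) n b) ∈ low (k + 1 + m) := by
        intro n c hn j
        obtain ⟨s, rfl⟩ := Int.eq_ofNat_of_zero_le hn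
        have hi := i.pos
        exact Submodule.smul_mem _ _ (low_mono (by omega)
          (alphaMode_neg_mem_low ((ih _ hl' m b hb).2 s) (by omega)))
      constructor
      · rw [e, mode_Y_X_mul, nthProd_apply, sub_right_comm]
        refine Submodule.sub_mem _ ?_ (hsec _)
        -- Only the first creation term, `x_i` times the `(-1)`-product of the remaining factor with
        -- `b`, can reach the top degree.
        rw [finsum_nat_eq_add_succ, add_sub_right_comm]
        · refine Submodule.add_mem _ ?_ (finsum_mem_submodule fun j => hfst _ _ (by omega) _)
          have h1 := mul_mem_low (X_mem_low i) (ih _ hl' m b hb).1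
          rw [mul_sub, ← mul_assoc] at h1
          simp only [pow_zero, Ring.choose_zero_right, Int.cast_one, mul_one, one_smul,
            Nat.cast_zero, sub_zero, add_zero, zero_add, alphaMode_neg]
          exact low_mono (by omega) h1
        · exact (BddR.modeProd (A := alphaMode) (truncated_mode (Y (listMonomial l)))).support _ _ _ _
      · intro n
        rw [e, mode_Y_X_mul, nthProd_apply]
        exact Submodule.sub_mem _ (finsum_mem_submodule fun j => hfst _ _ (by omega) _) (hsec _)

end FreeBoson
end
noncomputable section

namespace FreeBoson

open MvPolynomial

/-! ### The image of the generator under an automorphism -/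

/-- The algebra endomorphism that commutes with the translation operator and maps `x₁` to `h`. -/
def substHom (h : Fock) : Fock →ₐ[ℂ] Fock := aeval fun i : ℕ+ => divTranslation ((i : ℕ) - 1) h

theorem substHom_X (h : Fock) (i : ℕ+) : substHom h (X i) = divTranslation ((i : ℕ) - 1) h :=
  aeval_X _ _

theorem iterate_translation (s : ℕ) (a : Fock) :
    translation^[s] a = (translation.toLinearMap ^ s) a := by
  rw [Module.End.pow_apply]; rfl

theorem divTranslation_sub (s : ℕ) (a b : Fock) :
    divTranslation s (a - b) = divTranslation s a - divTranslation s b := by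
  simp only [divTranslation, iterate_translation, map_sub, smul_sub]

/-- The leading terms of the images under an automorphism. -/
theorem Aut_leading (σ : Aut Y) {k : ℕ} {H : Fock} (hH : H ∈ low (k + 1))
    (h : (σ : Fock ≃ₗ[ℂ] Fock) (x 1) - H ∈ low k) (l : List ℕ+) :
    (σ : Fock ≃ₗ[ℂ] Fock) (listMonomial l) - substHom H (listMonomial l) ∈ low (k * l.length) ∧
      substHom H (listMonomial l) ∈ low (k * l.length + 1) := by
  induction l with
  | nil =>
    simp only [listMonomial, List.map_nil, List.prod_nil, map_one, Aut_apply_one, sub_self]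
    exact ⟨Submodule.zero_mem _, low_mono (by omega) (C_mem_low 1)⟩
  | cons i l ih =>
    obtain ⟨s, hs⟩ : ∃ s : ℕ, (i : ℕ) = s + 1 := ⟨(i : ℕ) - 1, by have := i.pos; omega⟩
    have e : listMonomial (i :: l) = X i * listMonomial l := by
      rw [listMonomial, List.map_cons, List.prod_cons]
    rw [e, Aut_apply_X_mul, map_mul, substHom_X, hs, Nat.add_sub_cancel, mode_Y_neg,
      List.length_cons, mul_add, mul_one]
    set v := (σ : Fock ≃ₗ[ℂ] Fock) (listMonomial l)
    set g := (σ : Fock ≃ₗ[ℂ] Fock) (x 1)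
    set w := substHom H (listMonomial l)
    have hg : g ∈ low (k + 1) := by
      rw [← sub_add_cancel g H]; exact Submodule.add_mem _ (low_mono (by omega) h) hH
    have hv : v ∈ low (k * l.length + 1) := by
      rw [← sub_add_cancel v w]; exact Submodule.add_mem _ (low_mono (by omega) ih.1) ih.2
    have hd : ∀ j, ∀ a ∈ low j, divTranslation s a ∈ low j := fun j _ ha =>
      divTranslation_mem (S := low j) (fun _ => translation_mem_low) s ha
    have hu := hd _ _ hg
    have hU := hd _ _ hH
    have hsub := hd _ _ h
    rw [divTranslation_sub] at hsub
    constructor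
    -- With `u` and `U` the divided translations of `g` and `H`, the difference is `(u_(-1) v - uv)
    -- + u(v - w) + w(u - U)`.
    · have h1 := (mode_Y_leading k _ hu _ v hv).1
      have h2 := mul_mem_low hu ih.1
      have h3 := mul_mem_low ih.2 hsub
      have := Submodule.add_mem _ (low_mono (le_of_eq (add_comm _ _)) h1) (Submodule.add_mem _
        (low_mono (le_of_eq (add_comm _ _)) h2) h3)
      convert this using 1
      ring
    · exact low_mono (by omega) (mul_mem_low hU ih.2)

/-- By `[T, α_{j+1}] = -(j+1) α_j`, each application of `T` raises the largest variable index by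
one, and the derivative in the top variable changes only by a nonzero scalar. -/
theorem alphaMode_translation_iterate {H : Fock} {m : ℕ}
    (hm : ∀ j : ℕ, m < j → alphaMode j H = 0) (s : ℕ) :
    (∀ j : ℕ, m + s < j → alphaMode j (translation^[s] H) = 0) ∧
      ∃ c : ℂ, c ≠ 0 ∧ alphaMode (m + s : ℕ) (translation^[s] H) = c • alphaMode m H := by
  have hcomm : ∀ (j : ℕ) (u : Fock), alphaMode (j + 1 : ℕ) (translation u) =
      translation (alphaMode (j + 1 : ℕ) u) + ((j + 1 : ℕ) : ℂ) • alphaMode j u := by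
    intro j u
    have := translation_alphaMode (j + 1 : ℕ) u
    rw [Int.cast_natCast, Nat.cast_succ, add_sub_cancel_right, sub_eq_iff_eq_add] at this
    rw [Nat.cast_succ, this]
    push_cast
    abel
  induction s with
  | zero => exact ⟨hm, 1, one_ne_zero, by simp⟩
  | succ s ih =>
    obtain ⟨ih1, c, hc, ih2⟩ := ih
    simp only [Function.iterate_succ_apply']
    constructor
    · intro j hj
      obtain ⟨j, rfl⟩ := Nat.exists_eq_succ_of_ne_zero (show j ≠ 0 by omega)
      rw [hcomm, ih1 _ (by omega), ih1 _ (by omega)]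
      simp
    · refine ⟨((m + s + 1 : ℕ) : ℂ) * c, mul_ne_zero (Nat.cast_ne_zero.2 (by omega)) hc, ?_⟩
      rw [← add_assoc, hcomm, ih1 _ (by omega), ih2, map_zero, zero_add, smul_smul]

/-- A nonconstant polynomial is differentially transcendental. -/
theorem substHom_injective {H : Fock} (hH : H.vars.Nonempty) (e : ℕ) :
    ∀ p ∈ low e, substHom H p = 0 → p = 0 := by
  set m := H.vars.max' hH with hm
  have hmax : ∀ j : ℕ, (m : ℕ) < j → alphaMode j H = 0 := by
    intro j hj
    obtain ⟨j, rfl⟩ : ∃ i : ℕ+, (i : ℕ) = j := ⟨⟨j, by omega⟩, rfl⟩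
    rw [alphaMode_pos, pderiv_eq_zero_of_notMem_vars, smul_zero]
    intro h
    have := PNat.coe_le_coe _ _ |>.2 (H.vars.le_max' _ h)
    rw [← hm] at this
    omega
  have hne : alphaMode (m : ℕ) H ≠ 0 := by
    rw [alphaMode_pos]
    exact smul_ne_zero (Nat.cast_ne_zero.2 m.ne_zero) (pderiv_ne_zero (H.vars.max'_mem hH))
  induction e with
  | zero => intro p hp _; exact eq_zero_of_mem_low_zero hp
  | succ e ih =>
    intro p hp h0
    by_cases hv : p.vars.Nonempty
    · set i := p.vars.max' hv with hi
      -- With `m` and `i` the largest variable indices of `H` and `p`, `x_n` for `n = m + i - 1` is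
      -- the top variable of `T^(i-1) H`; it does not occur in `T^(j-1) H` for `j < i`.
      obtain ⟨n, hn⟩ : ∃ n : ℕ+, (n : ℕ) + 1 = m + i := ⟨⟨m + i - 1, by
        have := m.pos
        have := i.pos
        omega⟩, by rw [PNat.mk_coe]; have := m.pos; omega⟩
      have hlow : ∀ j : ℕ+, j < i → pderiv n (divTranslation ((j : ℕ) - 1) H) = 0 := by
        intro j hj
        have h1 := (alphaMode_translation_iterate hmax ((j : ℕ) - 1)).1 n (by
          have := PNat.coe_lt_coe _ _ |>.2 hj
          have := j.pos
          omega)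
        rw [alphaMode_pos] at h1
        rw [divTranslation, Derivation.map_smul,
          (smul_eq_zero.1 h1).resolve_left (Nat.cast_ne_zero.2 n.ne_zero), smul_zero]
      have htop : pderiv n (divTranslation ((i : ℕ) - 1) H) ≠ 0 := by
        obtain ⟨c, hc, h1⟩ := (alphaMode_translation_iterate hmax ((i : ℕ) - 1)).2
        rw [show (m : ℕ) + ((i : ℕ) - 1) = n by have := i.pos; omega, alphaMode_pos] at h1
        rw [divTranslation, Derivation.map_smul]
        refine smul_ne_zero (inv_ne_zero (Nat.cast_ne_zero.2 (Nat.factorial_ne_zero _))) ?_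
        intro h2
        rw [h2, smul_zero] at h1
        exact smul_ne_zero hc hne h1.symm
      -- Among the substituted variables of `p` only the image of `x_i` involves `x_n`, so the chain
      -- rule has a single term.
      have hchain : ∀ q ∈ supported ℂ (p.vars : Set ℕ+), pderiv n (substHom H q) =
          substHom H (pderiv i q) * pderiv n (divTranslation ((i : ℕ) - 1) H) := by
        intro q hq
        induction hq using Algebra.adjoin_induction with
        | mem q hq =>
          obtain ⟨j, hj, rfl⟩ := hq
          rw [substHom_X]
          rcases (p.vars.le_max' j hj).lt_or_eq with h | h
          · rw [hlow j h, pderiv_X_of_ne h.ne, map_zero, zero_mul]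
          · rw [← hi] at h
            rw [h, pderiv_X_self, map_one, one_mul]
        | algebraMap c =>
          rw [AlgHom.commutes, algebraMap_eq, pderiv_C, pderiv_C, map_zero, zero_mul]
        | add q r _ _ h1 h2 => rw [map_add, map_add, map_add, h1, h2, map_add, add_mul]
        | mul q r _ _ h1 h2 =>
          rw [map_mul, Derivation.leibniz, h1, h2, Derivation.leibniz]
          simp only [smul_eq_mul, map_add, map_mul]
          ring
      have h1 := hchain p (mem_supported_vars p)
      rw [h0, map_zero, eq_comm, mul_eq_zero] at h1
      -- The factor `∂/∂x_n` of the image of `x_i` is nonzero, so the substitution kills `∂p/∂x_i`.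
      -- That has lower degree, hence is zero, although `x_i` occurs in `p`.
      have h2 := ih _ (pderiv_mem_low hp i) (h1.resolve_right htop)
      exact absurd h2 (pderiv_ne_zero (p.vars.max'_mem hv))
    · rw [Finset.not_nonempty_iff_eq_empty, vars_eq_empty_iff_eq_C] at hv
      rw [hv] at h0 ⊢
      rwa [show substHom H (C (coeff 0 p)) = C (coeff 0 p) from (substHom H).commutes _] at h0

theorem isHomogeneous_divTranslation (s : ℕ) {k : ℕ} {a : Fock} (ha : a.IsHomogeneous k) :
    (divTranslation s a).IsHomogeneous k :=
  divTranslation_mem (S := homogeneousSubmodule ℕ+ ℂ k) (fun _ => isHomogeneous_translation) s ha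

theorem sub_homogeneousComponent_mem_low {k : ℕ} {p : Fock} (hp : p ∈ low (k + 1)) :
    p - homogeneousComponent k p ∈ low k := by
  intro d hd
  rw [coeff_sub, coeff_homogeneousComponent]
  split_ifs with h
  · rw [sub_self]
  · rw [hp d (by omega), sub_zero]

theorem homogeneousComponent_totalDegree_ne_zero {p : Fock} (hp : p ≠ 0) :
    homogeneousComponent p.totalDegree p ≠ 0 := by
  intro h
  have h1 := sub_homogeneousComponent_mem_low (totalDegree_mem_low p)
  rw [h, sub_zero] at h1
  obtain ⟨d, hd, hd'⟩ := Finset.exists_mem_eq_sup p.support (support_nonempty.2 hp)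
    fun s => s.sum fun _ e => e
  refine mem_support_iff.1 hd (h1 d ?_)
  rw [totalDegree, hd', Finsupp.degree_apply]
  rfl

theorem eq_zero_of_isHomogeneous_of_mem_low {k : ℕ} {p : Fock} (hp : p.IsHomogeneous k)
    (h : p ∈ low k) : p = 0 := by
  refine MvPolynomial.ext _ _ fun d => ?_
  rw [coeff_zero]
  by_cases hd : d.degree = k
  · exact h d hd.ge
  · exact hp.coeff_eq_zero hd

/-- An automorphism maps `x₁` to a polynomial of degree at most one. -/
theorem Aut_apply_x_one_mem_low (σ : Aut Y) : (σ : Fock ≃ₗ[ℂ] Fock) (x 1) ∈ low 2 := by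
  set h := (σ : Fock ≃ₗ[ℂ] Fock) (x 1) with hh
  obtain ⟨p, hp⟩ := (σ : Fock ≃ₗ[ℂ] Fock).surjective (x 1)
  have hconst : ∀ (v : Fock) (c : ℂ), (σ : Fock ≃ₗ[ℂ] Fock) v = C c → v = C c := fun v c hv =>
    (σ : Fock ≃ₗ[ℂ] Fock).injective (by rw [hv, Aut_apply_C])
  have hx : ∀ c : ℂ, (x 1 : Fock) ≠ C c := fun c hc => by
    have := congrArg (pderiv (1 : ℕ+)) hc
    rw [pderiv_X_self, pderiv_C] at this
    exact one_ne_zero this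
  have hp0 : ∀ c, p ≠ C c := fun c hc => hx c (by rw [← hp, hc, Aut_apply_C])
  set k := h.totalDegree with hk
  set e := p.totalDegree with he
  by_contra hlow
  have hk2 : 2 ≤ k := by
    by_contra hk2
    exact hlow (low_mono (by omega) (totalDegree_mem_low h))
  have he1 : 1 ≤ e := by
    by_contra he1
    refine hp0 _ (eq_C_of_mem_low_one (low_mono ?_ (totalDegree_mem_low p)))
    omega
  set H := homogeneousComponent k h with hH
  have hHhom : H.IsHomogeneous k := homogeneousComponent_isHomogeneous _ _
  have hHne : H ≠ 0 := homogeneousComponent_totalDegree_ne_zero fun h0 => by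
    rw [h0] at hk
    simp at hk
    omega
  have hHvars : H.vars.Nonempty := by
    rw [Finset.nonempty_iff_ne_empty]
    intro h0
    rw [vars_eq_empty_iff_eq_C] at h0
    rw [hHhom.coeff_eq_zero (by rw [map_zero]; omega), C_0] at h0
    exact hHne h0
  have hlead := Aut_leading σ (mem_low_of_isHomogeneous hHhom)
    (sub_homogeneousComponent_mem_low (totalDegree_mem_low h))
  set P := homogeneousComponent e p with hP
  -- Up to degree less than `ke`, `x₁ = σ(p)` is the substitution of `H` into `p`, and then into its
  -- top component `P`.
  have h1 : (σ : Fock ≃ₗ[ℂ] Fock) p - substHom H p ∈ low (k * e) :=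
    low_le (S := (low (k * e)).comap (((σ : Fock ≃ₗ[ℂ] Fock) : Fock →ₗ[ℂ] Fock) -
      (substHom H).toLinearMap)) (fun l hl => low_mono (Nat.mul_le_mul_left k (by omega))
        (hlead l).1) (totalDegree_mem_low p)
  have h2 : substHom H (p - P) ∈ low (k * e) :=
    low_le (S := (low (k * e)).comap (substHom H).toLinearMap) (fun l hl => low_mono (by
      calc k * l.length + 1 ≤ k * l.length + k := by omega
        _ = k * (l.length + 1) := by ring
        _ ≤ k * e := Nat.mul_le_mul_left k hl) (hlead l).2)
      (sub_homogeneousComponent_mem_low (totalDegree_mem_low p))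
  -- Here `k ≥ 2` and `e ≥ 1` are used: `x₁` has degree `1 < ke`.
  have h3 : (x 1 : Fock) ∈ low (k * e) := low_mono (by nlinarith) (X_mem_low 1)
  have h4 : substHom H P ∈ low (k * e) := by
    rw [hp] at h1
    have := Submodule.sub_mem _ (Submodule.sub_mem _ h3 h1) h2
    rwa [sub_sub_cancel, map_sub, sub_sub_cancel] at this
  -- Being homogeneous of degree `ke` and of degree less than `ke`, the leading term vanishes,
  -- contradicting the differential transcendence of `H`.
  have h5 : (substHom H P).IsHomogeneous (k * e) :=
    (homogeneousComponent_isHomogeneous e p).aeval _ fun i => isHomogeneous_divTranslation _ hHhom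
  have h6 := substHom_injective hHvars (P.totalDegree + 1) P (totalDegree_mem_low P)
    (eq_zero_of_isHomogeneous_of_mem_low h5 h4)
  exact homogeneousComponent_totalDegree_ne_zero (fun h0 => hp0 0 (by rw [h0, C_0])) h6

/-! ### Images of degree at most one, as polynomials in the translation operator -/

theorem translation_pow_x_one (n : ℕ) :
    (translation.toLinearMap ^ n) (x 1) = (n.factorial : ℂ) • X n.succPNat := by
  induction n with
  | zero => simp; rfl
  | succ n ih =>
    rw [pow_succ', Module.End.mul_apply, ih, map_smul]
    change _ • translation (X _) = _
    rw [translation_X, smul_smul, Nat.factorial_succ, mul_comm]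
    simp only [Nat.succPNat_coe, Nat.cast_mul]
    rfl

open Polynomial in
theorem aeval_translation_x_one (R : ℂ[X]) :
    aeval translation.toLinearMap R (x 1) =
      ∑ n ∈ R.support, (R.coeff n * (n.factorial : ℂ)) • (MvPolynomial.X n.succPNat : Fock) := by
  rw [Polynomial.aeval_eq_sum_range, LinearMap.sum_apply]
  rw [← Finset.sum_subset (s₁ := R.support)]
  · refine Finset.sum_congr rfl fun n _ => ?_
    rw [LinearMap.smul_apply, translation_pow_x_one, smul_smul]
  · exact Polynomial.supp_subset_range_natDegree_succ
  · intro n _ hn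
    rw [Polynomial.notMem_support_iff.1 hn, zero_smul, LinearMap.zero_apply]

/-- The vectors `T^n x₁ = n! x_{n+1}` together with `1` are linearly independent; `∂/∂x_{n+1}`
isolates the `n`-th coefficient. -/
theorem eq_zero_of_aeval_translation_x_one {R : Polynomial ℂ} {c : ℂ}
    (h : Polynomial.aeval translation.toLinearMap R (x 1) = C c) : R = 0 := by
  ext n
  have h1 := congrArg (pderiv n.succPNat) h
  rw [aeval_translation_x_one, pderiv_C, map_sum, Finset.sum_eq_single n] at h1
  · rw [Derivation.map_smul, pderiv_X_self, smul_eq_zero] at h1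
    rw [Polynomial.coeff_zero]
    exact (mul_eq_zero.1 (h1.resolve_right one_ne_zero)).resolve_right
      (Nat.cast_ne_zero.2 n.factorial_ne_zero)
  · intro m _ hm
    rw [Derivation.map_smul, pderiv_X_of_ne (fun h => hm (Nat.succPNat_injective h)), smul_zero]
  · intro hn
    rw [Polynomial.notMem_support_iff.1 hn, zero_mul, zero_smul, map_zero]

/-- Each variable is `x_i = T^(i-1) x₁ / (i-1)!`, so degree at most one means `ℂ[T] x₁ + ℂ`. -/
theorem exists_aeval_translation {h : Fock} (hh : h ∈ low 2) :
    ∃ (P : Polynomial ℂ) (c : ℂ), h = Polynomial.aeval translation.toLinearMap P (x 1) + C c := by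
  let S : Submodule ℂ Fock :=
    { carrier := {h | ∃ (P : Polynomial ℂ) (c : ℂ),
        h = Polynomial.aeval translation.toLinearMap P (x 1) + C c}
      zero_mem' := ⟨0, 0, by simp⟩
      add_mem' := by
        rintro _ _ ⟨P, c, rfl⟩ ⟨Q, d, rfl⟩
        exact ⟨P + Q, c + d, by rw [map_add, C_add, LinearMap.add_apply]; abel⟩
      smul_mem' := by
        rintro r _ ⟨P, c, rfl⟩
        exact ⟨r • P, r * c, by
          rw [map_smul, LinearMap.smul_apply, smul_add, C_mul, smul_eq_C_mul (C c)]⟩ }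
  refine low_le (S := S) (fun l hl => ?_) hh
  match l, hl with
  | [], _ => exact ⟨0, 1, by simp [listMonomial]⟩
  | [i], _ =>
    refine ⟨((i.natPred.factorial : ℂ)⁻¹) • Polynomial.X ^ i.natPred, 0, ?_⟩
    rw [map_smul, map_pow, Polynomial.aeval_X, LinearMap.smul_apply, translation_pow_x_one,
      smul_smul, inv_mul_cancel₀ (Nat.cast_ne_zero.2 (Nat.factorial_ne_zero _)), one_smul,
      PNat.succPNat_natPred, C_0, add_zero, listMonomial, List.map_cons, List.map_nil,
      List.prod_singleton]
  | _ :: _ :: _, hl => simp at hl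

theorem Aut_apply_aeval_translation (σ : Aut Y) (P : Polynomial ℂ) (a : Fock) :
    (σ : Fock ≃ₗ[ℂ] Fock) (Polynomial.aeval translation.toLinearMap P a) =
      Polynomial.aeval translation.toLinearMap P ((σ : Fock ≃ₗ[ℂ] Fock) a) := by
  have hpow : ∀ n : ℕ, (σ : Fock ≃ₗ[ℂ] Fock) ((translation.toLinearMap ^ n) a) =
      (translation.toLinearMap ^ n) ((σ : Fock ≃ₗ[ℂ] Fock) a) := fun n =>
    pow_intertwine (fun u => Aut_apply_translation σ u) n a
  simp only [Polynomial.aeval_eq_sum_range, LinearMap.sum_apply, LinearMap.smul_apply, map_sum,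
    map_smul, hpow]

theorem aeval_translation_C (P : Polynomial ℂ) (c : ℂ) :
    Polynomial.aeval translation.toLinearMap P (C c : Fock) = C (P.coeff 0 * c) := by
  rw [Polynomial.aeval_eq_sum_range, LinearMap.sum_apply, Finset.sum_eq_single 0]
  · rw [pow_zero, LinearMap.smul_apply, Module.End.one_apply, smul_eq_C_mul, C_mul]
  · intro n _ hn
    obtain ⟨n, rfl⟩ := Nat.exists_eq_succ_of_ne_zero hn
    rw [LinearMap.smul_apply, pow_succ, Module.End.mul_apply,
      show translation.toLinearMap (C c : Fock) = 0 from derivation_C _ _, map_zero, smul_zero]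
  · intro h
    simp at h

/-- The image of `x₁` under an automorphism is `± x₁ + a`. -/
theorem Aut_apply_x_one (σ : Aut Y) :
    ∃ ε a : ℂ, ε * ε = 1 ∧ (σ : Fock ≃ₗ[ℂ] Fock) (x 1) = ε • x 1 + C a := by
  obtain ⟨P, c, hP⟩ := exists_aeval_translation (Aut_apply_x_one_mem_low σ)
  obtain ⟨Q, d, hQ⟩ := exists_aeval_translation (Aut_apply_x_one_mem_low σ⁻¹)
  have h1 : (σ : Fock ≃ₗ[ℂ] Fock) (((σ⁻¹ : Aut Y) : Fock ≃ₗ[ℂ] Fock) (x 1)) = x 1 :=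
    (σ : Fock ≃ₗ[ℂ] Fock).apply_symm_apply _
  rw [hQ, map_add, Aut_apply_C, Aut_apply_aeval_translation, hP, map_add, aeval_translation_C,
    ← Module.End.mul_apply, ← map_mul] at h1
  -- Composing `σ` with its inverse gives `QP(T) x₁ = x₁ + const`.
  have h2 : Q * P - 1 = 0 := by
    refine eq_zero_of_aeval_translation_x_one (c := -(Q.coeff 0 * c) - d) ?_
    rw [map_sub, map_one, LinearMap.sub_apply, Module.End.one_apply, C_sub, C_neg]
    rw [← eq_sub_iff_add_eq, ← eq_sub_iff_add_eq] at h1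
    rw [h1]
    ring
  -- The units of `ℂ[T]` are the nonzero constants.
  obtain ⟨ε, -, rfl⟩ := Polynomial.isUnit_iff.1
    (IsUnit.of_mul_eq_one_right Q (sub_eq_zero.1 h2))
  have hσ : (σ : Fock ≃ₗ[ℂ] Fock) (x 1) = ε • x 1 + C c := by
    rw [hP, Polynomial.aeval_C]
    rfl
  refine ⟨ε, c, ?_, hσ⟩
  -- Applying `σ` to `(x₁)_(1) x₁ = 1` gives `1 = ε²`.
  have h3 := Aut_apply_mode σ (x 1) (x 1) 1
  have h4 : ∀ v : Fock, alphaMode 1 v = pderiv 1 v := fun v => by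
    have := alphaMode_pos 1 v
    simpa using this
  have h5 : ∀ v : Fock, mode (Y (ε • x 1 + C c)) 1 v = ε • pderiv 1 v := fun v => by
    rw [map_add, map_smul, Y_x_one, mode_add, mode_smul, LinearMap.add_apply, LinearMap.smul_apply,
      mode_alpha, mode_Y_C, if_neg (by norm_num), h4, add_zero]
  rw [Y_x_one, mode_alpha, h4, pderiv_X_self, Aut_apply_one, hσ, h5, map_add, pderiv_C,
    Derivation.map_smul, pderiv_X_self, add_zero, smul_smul] at h3
  have h6 := congrArg (coeff 0) h3
  simpa using h6.symm

end FreeBoson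
end
noncomputable section

namespace FreeBoson

open MvPolynomial

/-! ### Square roots of exponentials -/

theorem hasSum_antidiagonal {f g : ℕ → ℂ} {F G : ℂ} (hf : HasSum f F) (hg : HasSum g G) :
    HasSum (fun N => ∑ ij ∈ Finset.HasAntidiagonal.antidiagonal N, f ij.1 * g ij.2) (F * G) := by
  have h1 := hf.summable.norm
  have h2 := hg.summable.norm
  rw [← hf.tsum_eq, ← hg.tsum_eq, tsum_mul_tsum_eq_tsum_sum_antidiagonal_of_summable_norm h1 h2]
  exact (summable_norm_sum_mul_antidiagonal_of_summable_norm h1 h2).of_norm.hasSum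

theorem hasSum_of_eq {f g : ℕ → ℂ} {a b : ℂ} (h : HasSum f a) (hf : ∀ n, g n = f n) (hb : b = a) :
    HasSum g b := by
  rw [hb, funext hf]
  exact h

/-- A finite-dimensional space of polynomials involves finitely many monomials. -/
theorem exists_finset_support (W : Submodule ℂ Fock) [FiniteDimensional ℂ W] :
    ∃ S : Finset (ℕ+ →₀ ℕ), ∀ p ∈ W, p.support ⊆ S := by
  classical
  obtain ⟨B, hB⟩ := (Submodule.fg_iff_finiteDimensional W).2 inferInstance
  refine ⟨B.biUnion fun p => p.support, fun p hp => ?_⟩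
  rw [← hB] at hp
  induction hp using Submodule.span_induction with
  | mem p hp => exact Finset.subset_biUnion_of_mem (fun p : Fock => p.support) hp
  | zero => simp
  | add p q _ _ h1 h2 => exact (support_add).trans (Finset.union_subset h1 h2)
  | smul c p _ h => exact support_smul.trans h

theorem sum_monomial_of_support_subset {S : Finset (ℕ+ →₀ ℕ)} {p : Fock} (h : p.support ⊆ S) :
    ∑ d ∈ S, coeff d p • (monomial d 1 : Fock) = p := by
  conv_rhs => rw [← support_sum_monomial_coeff p]
  rw [← Finset.sum_subset h]
  · refine Finset.sum_congr rfl fun d _ => ?_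
    rw [smul_monomial, smul_eq_mul, mul_one]
  · intro d _ hd
    rw [notMem_support_iff.1 hd, zero_smul]

theorem IsExp.hasSum_coeff {D σ : Module.End ℂ Fock} (h : IsExp D σ) (v : Fock)
    (d : ℕ+ →₀ ℕ) :
    HasSum (fun n : ℕ => ((n.factorial : ℂ)⁻¹) * coeff d ((D ^ n) v)) (coeff d (σ v)) :=
  (h v).2 (lcoeff ℂ d)

/-- A finite set of monomials carries the whole series and its sum, so identities between
exponentials reduce to scalar series for each coefficient, with finite sums over monomials. -/
theorem IsExp.exists_support {D σ : Module.End ℂ Fock} (h : IsExp D σ) (v : Fock) :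
    ∃ S : Finset (ℕ+ →₀ ℕ), (∀ n : ℕ, ((D ^ n) v).support ⊆ S) ∧ (σ v).support ⊆ S := by
  obtain ⟨W, hW, hD⟩ := (h v).1
  obtain ⟨S, hS⟩ := exists_finset_support W
  refine ⟨S, fun n => hS _ (hD n), fun d hd => ?_⟩
  by_contra hdS
  have h1 := h.hasSum_coeff v d
  have h2 : (fun n : ℕ => ((n.factorial : ℂ)⁻¹) * coeff d ((D ^ n) v)) = fun _ => 0 := by
    funext n
    rw [notMem_support_iff.1 fun h' => hdS (hS _ (hD n) h'), mul_zero]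
  rw [h2] at h1
  exact mem_support_iff.1 hd (h1.unique hasSum_zero)

/-- If `exp D` exists then so does `exp (D / 2)`. -/
theorem IsExp.exists_half {D σ : Module.End ℂ Fock} (h : IsExp D σ) :
    ∃ ρ : Module.End ℂ Fock, IsExp ((2 : ℂ)⁻¹ • D) ρ := by
  have hpow : ∀ (n : ℕ) v, (((2 : ℂ)⁻¹ • D) ^ n) v = ((2 : ℂ)⁻¹) ^ n • (D ^ n) v := fun n v => by
    rw [smul_pow, LinearMap.smul_apply]
  have hsum : ∀ v d, Summable fun n : ℕ =>
      ((n.factorial : ℂ)⁻¹) * coeff d ((((2 : ℂ)⁻¹ • D) ^ n) v) := by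
    intro v d
    -- The factor `2^(-n)` has norm at most `1`, and complex series that are summable are absolutely
    -- so.
    refine Summable.of_norm_bounded (h.hasSum_coeff v d).summable.norm fun n => ?_
    rw [hpow, coeff_smul, smul_eq_mul, norm_mul, norm_mul, norm_mul]
    refine mul_le_mul_of_nonneg_left (mul_le_of_le_one_left (norm_nonneg _) ?_) (norm_nonneg _)
    rw [norm_pow]
    refine pow_le_one₀ (norm_nonneg _) ?_
    norm_num
  have hex : ∀ v, ∃ w : Fock, ∀ d, HasSum (fun n : ℕ =>
      ((n.factorial : ℂ)⁻¹) * coeff d ((((2 : ℂ)⁻¹ • D) ^ n) v)) (coeff d w) := by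
    intro v
    obtain ⟨S, hS, -⟩ := h.exists_support v
    refine ⟨∑ d ∈ S, monomial d (∑' n : ℕ,
      ((n.factorial : ℂ)⁻¹) * coeff d ((((2 : ℂ)⁻¹ • D) ^ n) v)), fun d => ?_⟩
    refine hasSum_of_eq (hsum v d).hasSum (fun _ => rfl) ?_
    rw [coeff_sum]
    simp only [coeff_monomial]
    rw [Finset.sum_ite_eq' S d]
    split_ifs with hd
    · rfl
    · refine (Eq.trans (tsum_congr fun n => ?_) tsum_zero).symm
      rw [hpow, coeff_smul, notMem_support_iff.1 fun h' => hd (hS n h'), smul_zero, mul_zero]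
  choose w hw using hex
  refine ⟨{ toFun := w, map_add' := fun u v => ?_, map_smul' := fun c v => ?_ }, fun v => ?_⟩
  · refine MvPolynomial.ext _ _ fun d => (hw (u + v) d).unique ?_
    rw [coeff_add]
    refine hasSum_of_eq ((hw u d).add (hw v d)) (fun n => ?_) rfl
    rw [map_add, coeff_add, mul_add]
  · refine MvPolynomial.ext _ _ fun d => (hw (c • v) d).unique ?_
    rw [coeff_smul]
    refine hasSum_of_eq ((hw v d).mul_left c) (fun n => ?_) rfl
    rw [map_smul, coeff_smul, smul_eq_mul]
    ring
  · obtain ⟨W, hW, hD⟩ := (h v).1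
    refine ⟨⟨W, hW, fun n => by rw [hpow]; exact W.smul_mem _ (hD n)⟩, fun φ => ?_⟩
    obtain ⟨S, hS⟩ := exists_finset_support W
    have h1 : ∀ n, ((((2 : ℂ)⁻¹ • D) ^ n) v).support ⊆ S := fun n => hS _ (by
      rw [hpow]; exact W.smul_mem _ (hD n))
    have h2 : (w v).support ⊆ S := by
      intro d hd
      by_contra hdS
      refine mem_support_iff.1 hd ((hw v d).unique (hasSum_of_eq hasSum_zero (fun n => ?_) rfl))
      rw [notMem_support_iff.1 fun h' => hdS (h1 n h'), mul_zero]
    -- On polynomials supported in `S` a functional is a finite combination of coefficients, so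
    -- convergence of coefficients suffices.
    have h3 := hasSum_sum (s := S) fun d _ => (hw v d).mul_right (φ (monomial d 1))
    refine hasSum_of_eq h3 (fun n => ?_) ?_
    · conv_lhs => rw [← sum_monomial_of_support_subset (h1 n)]
      rw [map_sum, Finset.mul_sum]
      refine Finset.sum_congr rfl fun d _ => ?_
      rw [map_smul, smul_eq_mul, mul_assoc]
    · change φ (w v) = _
      conv_lhs => rw [← sum_monomial_of_support_subset h2]
      rw [map_sum]
      refine Finset.sum_congr rfl fun d _ => ?_
      rw [map_smul, smul_eq_mul]

theorem inv_factorial_mul_inv_factorial {N : ℕ} {ij : ℕ × ℕ}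
    (h : ij ∈ Finset.HasAntidiagonal.antidiagonal N) :
    (ij.1.factorial : ℂ)⁻¹ * (ij.2.factorial : ℂ)⁻¹ = (N.factorial : ℂ)⁻¹ * (N.choose ij.1 : ℂ) := by
  have h' : ij.1 + ij.2 = N := Finset.HasAntidiagonal.mem_antidiagonal.1 h
  subst h'
  have := Nat.add_choose_mul_factorial_mul_factorial ij.1 ij.2
  rw [← Nat.choose_symm_add] at this
  have h2 : ((ij.1 + ij.2).choose ij.1 : ℂ) * ij.1.factorial * ij.2.factorial =
    (ij.1 + ij.2).factorial := by exact_mod_cast this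
  have h3 := Nat.cast_ne_zero (R := ℂ).2 ij.1.factorial_ne_zero
  have h4 := Nat.cast_ne_zero (R := ℂ).2 ij.2.factorial_ne_zero
  have h5 := Nat.cast_ne_zero (R := ℂ).2 (ij.1 + ij.2).factorial_ne_zero
  rw [← mul_inv, eq_comm, inv_mul_eq_iff_eq_mul₀ h5, eq_mul_inv_iff_mul_eq₀ (mul_ne_zero h3 h4),
    ← mul_assoc, h2]

/-- Cauchy product of the coefficient series: the binomial coefficients sum to `2^N` and cancel the
factor `2^(-N)` of `(D/2)^N`. -/
theorem IsExp.comp_self {D ρ σ : Module.End ℂ Fock} (hρ : IsExp ((2 : ℂ)⁻¹ • D) ρ)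
    (hσ : IsExp D σ) (v : Fock) : ρ (ρ v) = σ v := by
  set E := (2 : ℂ)⁻¹ • D with hE
  refine MvPolynomial.ext _ _ fun c => ?_
  obtain ⟨S, hS, hS'⟩ := hρ.exists_support v
  have h1 := hasSum_sum (s := S) fun d _ =>
    hasSum_antidiagonal (hρ.hasSum_coeff v d) (hρ.hasSum_coeff (monomial d 1) c)
  refine Eq.trans ?_ (h1.unique ?_)
  · conv_lhs => rw [← sum_monomial_of_support_subset hS']
    rw [map_sum, coeff_sum]
    refine Finset.sum_congr rfl fun d _ => ?_
    rw [map_smul, coeff_smul, smul_eq_mul]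
  · refine hasSum_of_eq (hσ.hasSum_coeff v c) (fun N => ?_) rfl
    rw [Finset.sum_comm]
    have hterm : ∀ ij ∈ Finset.HasAntidiagonal.antidiagonal N,
        ∑ d ∈ S, (ij.1.factorial : ℂ)⁻¹ * coeff d ((E ^ ij.1) v) *
          ((ij.2.factorial : ℂ)⁻¹ * coeff c ((E ^ ij.2) (monomial d 1))) =
        (N.choose ij.1 : ℂ) * ((N.factorial : ℂ)⁻¹ * coeff c ((E ^ N) v)) := by
      intro ij hij
      have h' : ij.1 + ij.2 = N := Finset.HasAntidiagonal.mem_antidiagonal.1 hij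
      have h2 : coeff c ((E ^ N) v) =
          ∑ d ∈ S, coeff d ((E ^ ij.1) v) * coeff c ((E ^ ij.2) (monomial d 1)) := by
        rw [← h', add_comm, pow_add, Module.End.mul_apply]
        conv_lhs => rw [← sum_monomial_of_support_subset (hS ij.1)]
        rw [map_sum, coeff_sum]
        refine Finset.sum_congr rfl fun d _ => ?_
        rw [map_smul, coeff_smul, smul_eq_mul]
      rw [h2, ← mul_assoc, mul_comm (N.choose ij.1 : ℂ), ← inv_factorial_mul_inv_factorial hij,
        Finset.mul_sum]
      refine Finset.sum_congr rfl fun d _ => ?_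
      ring
    rw [Finset.sum_congr rfl hterm, ← Finset.sum_mul, ← Nat.cast_sum,
      Finset.Nat.sum_antidiagonal_eq_sum_range_succ_mk, Nat.sum_range_choose, hE, smul_pow,
      LinearMap.smul_apply, coeff_smul, smul_eq_mul]
    push_cast
    rw [inv_pow]
    field_simp

theorem leibniz_pow {B : Fock →ₗ[ℂ] Fock →ₗ[ℂ] Fock} {D : Module.End ℂ Fock}
    (hD : ∀ a b, D (B a b) = B (D a) b + B a (D b)) (N : ℕ) (a b : Fock) :
    (D ^ N) (B a b) = ∑ ij ∈ Finset.HasAntidiagonal.antidiagonal N,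
      N.choose ij.1 • B ((D ^ ij.1) a) ((D ^ ij.2) b) := by
  induction N with
  | zero => simp
  | succ N ih =>
    rw [pow_succ', Module.End.mul_apply, ih,
      Finset.sum_antidiagonal_choose_succ_nsmul (fun i j => B ((D ^ i) a) ((D ^ j) b)), map_sum,
      ← Finset.sum_add_distrib]
    refine Finset.sum_congr rfl fun ij hij => ?_
    have h' : ij.1 + ij.2 = N := Finset.HasAntidiagonal.mem_antidiagonal.1 hij
    rw [← Nat.choose_symm_of_eq_add h'.symm, map_nsmul, hD, ← smul_add, pow_succ' D ij.1,
      pow_succ' D ij.2, Module.End.mul_apply, Module.End.mul_apply, add_comm]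

/-- The exponential of a derivation of a product preserves the product. -/
theorem IsExp.map_bilin {B : Fock →ₗ[ℂ] Fock →ₗ[ℂ] Fock} {D ρ : Module.End ℂ Fock}
    (hD : ∀ a b, D (B a b) = B (D a) b + B a (D b)) (hρ : IsExp D ρ) (a b : Fock) :
    ρ (B a b) = B (ρ a) (ρ b) := by
  refine MvPolynomial.ext _ _ fun c => ?_
  obtain ⟨S, hS, hS'⟩ := hρ.exists_support a
  obtain ⟨R, hR, hR'⟩ := hρ.exists_support b
  have hexp : ∀ p q : Fock, p.support ⊆ S → q.support ⊆ R → coeff c (B p q) =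
      ∑ de ∈ S ×ˢ R, coeff de.1 p * coeff de.2 q * coeff c (B (monomial de.1 1) (monomial de.2 1)) := by
    intro p q hp hq
    conv_lhs => rw [← sum_monomial_of_support_subset hp, ← sum_monomial_of_support_subset hq]
    rw [Finset.sum_product, map_sum B, LinearMap.sum_apply, coeff_sum]
    refine Finset.sum_congr rfl fun d _ => ?_
    rw [map_sum, coeff_sum]
    refine Finset.sum_congr rfl fun e _ => ?_
    rw [map_smul, map_smul, LinearMap.smul_apply, coeff_smul, coeff_smul, smul_eq_mul, smul_eq_mul]
    ring
  have h1 := hasSum_sum (s := S ×ˢ R) fun de _ =>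
    (hasSum_antidiagonal (hρ.hasSum_coeff a de.1) (hρ.hasSum_coeff b de.2)).mul_right
      (coeff c (B (monomial de.1 1) (monomial de.2 1)))
  rw [hexp _ _ hS' hR']
  refine (hρ.hasSum_coeff (B a b) c).unique ?_
  refine hasSum_of_eq h1 (fun N => ?_) rfl
  simp only [Finset.sum_mul]
  rw [Finset.sum_comm, leibniz_pow hD, coeff_sum, Finset.mul_sum]
  refine Finset.sum_congr rfl fun ij hij => ?_
  rw [← Nat.cast_smul_eq_nsmul ℂ, coeff_smul, smul_eq_mul, ← mul_assoc,
    ← inv_factorial_mul_inv_factorial hij, hexp _ _ (hS _) (hR _), Finset.mul_sum]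
  refine Finset.sum_congr rfl fun de _ => ?_
  ring

/-- An automorphism which is the exponential of a mode that acts as a derivation is a square. -/
theorem exists_mul_self_eq (σ : Aut Y) {a : Fock} {m : ℕ}
    (ha : ∀ j : ℕ, j < m → mode (Y a) j = 0)
    (h : IsExp (mode (Y a) m) ((σ : Fock ≃ₗ[ℂ] Fock) : Fock →ₗ[ℂ] Fock)) :
    ∃ ρ : Aut Y, ρ * ρ = σ := by
  obtain ⟨ρ, hρ⟩ := h.exists_half
  have hsq : ∀ v, ρ (ρ v) = (σ : Fock ≃ₗ[ℂ] Fock) v := fun v => hρ.comp_self h v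
  have hbij : Function.Bijective ρ := by
    constructor
    · intro u v huv
      refine (σ : Fock ≃ₗ[ℂ] Fock).injective ?_
      rw [← hsq, ← hsq, huv]
    · intro v
      obtain ⟨u, hu⟩ := (σ : Fock ≃ₗ[ℂ] Fock).surjective v
      exact ⟨ρ u, (hsq u).trans hu⟩
  refine ⟨⟨LinearEquiv.ofBijective ρ hbij, fun b c n => ?_⟩,
    Subtype.ext (LinearEquiv.ext hsq)⟩
  -- Each `n`-th product is a bilinear map of which `a_(m)`, hence also `a_(m)/2`, is a derivation.
  let B : Fock →ₗ[ℂ] Fock →ₗ[ℂ] Fock := LinearMap.mk₂ ℂ (fun b c => mode (Y b) n c)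
    (fun b b' c => by rw [map_add, mode_add, LinearMap.add_apply])
    (fun r b c => by rw [map_smul, mode_smul, LinearMap.smul_apply])
    (fun b c c' => map_add _ _ _) (fun r b c => map_smul _ _ _)
  refine IsExp.map_bilin (B := B) (fun b c => ?_) hρ b c
  have := isVertexAlgebra_Y.derivation ha b c n
  rw [LinearMap.smul_apply, LinearMap.smul_apply, LinearMap.smul_apply, map_smul, map_smul,
    LinearMap.smul_apply, ← smul_add]
  exact congrArg _ this

end FreeBoson
end
noncomputable section

namespace FreeBoson

open MvPolynomial

/-! ### The exponential of a multiple of `∂/∂x₁` -/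

section Exponential

variable (a : ℂ)

/-- The derivation `a ∂/∂x₁`. -/
abbrev shiftDerivation : Module.End ℂ Fock := a • (pderiv (R := ℂ) (1 : ℕ+)).toLinearMap

theorem shiftDerivation_apply (v : Fock) : shiftDerivation a v = a • pderiv 1 v := rfl

theorem shiftDerivation_pow_eq_zero {N : ℕ} {v : Fock} (hv : v ∈ low N) {n : ℕ} (hn : N ≤ n) :
    (shiftDerivation a ^ n) v = 0 := by
  induction N generalizing v n with
  | zero => rw [eq_zero_of_mem_low_zero hv, map_zero]
  | succ N ih =>
    obtain ⟨n, rfl⟩ := Nat.exists_eq_succ_of_ne_zero (show n ≠ 0 by omega)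
    rw [pow_succ, Module.End.mul_apply]
    exact ih (Submodule.smul_mem _ a (pderiv_mem_low hv 1)) (by omega)

theorem shiftDerivation_support (v : Fock) : (Function.support fun n : ℕ =>
    ((n.factorial : ℂ)⁻¹) • (shiftDerivation a ^ n) v).Finite := by
  refine (Set.finite_lt_nat (v.totalDegree + 1)).subset fun n hn => ?_
  by_contra h
  simp only [Set.mem_ofPred_eq, not_lt] at h
  refine hn ?_
  simp only [shiftDerivation_pow_eq_zero a (totalDegree_mem_low v) h, smul_zero]

/-- The exponential of `a ∂/∂x₁`. -/
def shiftExp : Module.End ℂ Fock where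
  toFun v := ∑ᶠ n : ℕ, ((n.factorial : ℂ)⁻¹) • (shiftDerivation a ^ n) v
  map_add' u v := by
    rw [← finsum_add_distrib (shiftDerivation_support a u) (shiftDerivation_support a v)]
    exact finsum_congr fun n => by rw [map_add, smul_add]
  map_smul' c v := by
    rw [RingHom.id_apply, smul_finsum]
    exact finsum_congr fun n => by rw [map_smul, smul_comm]

theorem shiftExp_eq_sum {N : ℕ} {v : Fock} (hv : v ∈ low N) : shiftExp a v =
    ∑ n ∈ Finset.range N, ((n.factorial : ℂ)⁻¹) • (shiftDerivation a ^ n) v := by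
  refine finsum_eq_sum_of_support_subset _ fun n hn => ?_
  rw [Finset.coe_range, Set.mem_Iio]
  by_contra h
  refine hn ?_
  simp only [shiftDerivation_pow_eq_zero a hv (not_lt.1 h), smul_zero]

theorem isExp_shiftExp : IsExp (shiftDerivation a) (shiftExp a) := by
  intro v
  have hv := totalDegree_mem_low v
  set N := v.totalDegree + 1
  refine ⟨⟨Submodule.span ℂ ((Finset.range N).image fun n => (shiftDerivation a ^ n) v : Finset Fock),
    FiniteDimensional.span_finset ℂ _, fun n => ?_⟩, fun φ => ?_⟩
  · by_cases hn : n < N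
    · refine Submodule.subset_span ?_
      rw [Finset.coe_image]
      exact ⟨n, by simpa using hn, rfl⟩
    · rw [shiftDerivation_pow_eq_zero a hv (not_lt.1 hn)]
      exact Submodule.zero_mem _
  · rw [shiftExp_eq_sum a hv, map_sum]
    simp only [map_smul, smul_eq_mul]
    refine hasSum_sum_of_ne_finset_zero fun n hn => ?_
    rw [shiftDerivation_pow_eq_zero a hv (by simpa using hn), map_zero, mul_zero]

/-- The exponential of a derivation is multiplicative, so it is enough to compare on constants and
variables. -/
theorem shiftExp_eq_affineHom (v : Fock) : shiftExp a v = affineHom 1 a v := by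
  have hmul : ∀ p q, shiftExp a (p * q) = shiftExp a p * shiftExp a q := fun p q =>
    IsExp.map_bilin (B := LinearMap.mul ℂ Fock) (fun p q => by
      simp only [LinearMap.mul_apply_apply, shiftDerivation_apply, Derivation.leibniz, smul_eq_mul]
      rw [smul_add, mul_smul_comm, smul_mul_assoc, add_comm, mul_comm q])
      (isExp_shiftExp a) p q
  induction v using MvPolynomial.induction_on with
  | C c =>
    rw [shiftExp_eq_sum a (C_mem_low c), Finset.sum_range_one,
      show affineHom 1 a (C c) = C c from (affineHom 1 a).commutes c]
    simp
  | add p q hp hq => rw [map_add, map_add, hp, hq]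
  | mul_X p i hp =>
    rw [hmul, hp, map_mul, affineHom_X, shiftExp_eq_sum a (X_mem_low i), Finset.sum_range_succ,
      Finset.sum_range_one, pow_one, shiftDerivation_apply, pderiv_X]
    congr 1
    rcases eq_or_ne i 1 with rfl | h
    · simp [smul_eq_C_mul]
    · rw [Pi.single_eq_of_ne h, if_neg h]
      simp

theorem isExp_affineHom : IsExp (shiftDerivation a) (affineHom 1 a).toLinearMap := by
  have : (affineHom 1 a).toLinearMap = shiftExp a :=
    LinearMap.ext fun v => (shiftExp_eq_affineHom a v).symm
  rw [this]
  exact isExp_shiftExp a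

end Exponential

/-! ### The automorphism group -/

theorem exists_eq_affineAut (σ : Aut Y) : ∃ (ε a : ℂ) (h : ε * ε = 1), σ = affineAut ε a h := by
  obtain ⟨ε, a, h, hσ⟩ := Aut_apply_x_one σ
  exact ⟨ε, a, h, Aut_ext (hσ.trans (affineAut_x_one ε a h).symm)⟩

theorem affineAut_mul (ε a ε' a' : ℂ) (h : ε * ε = 1) (h' : ε' * ε' = 1) :
    affineAut ε a h * affineAut ε' a' h' =
      affineAut (ε' * ε) (ε' * a + a') (by rw [mul_mul_mul_comm, h, h', one_mul]) :=
  Subtype.ext (LinearEquiv.ext fun v => affineHom_affineHom ε a ε' a' v)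

theorem affineAut_congr {ε a ε' a' : ℂ} {h : ε * ε = 1} {h' : ε' * ε' = 1} (hε : ε = ε')
    (ha : a = a') : affineAut ε a h = affineAut ε' a' h' := by
  subst hε ha; rfl

theorem affineAut_injective {ε a ε' a' : ℂ} {h : ε * ε = 1} {h' : ε' * ε' = 1}
    (he : affineAut ε a h = affineAut ε' a' h') : ε = ε' ∧ a = a' := by
  have h1 : ε • x 1 + C a = ε' • x 1 + C a' := by
    rw [← affineAut_x_one ε a h, ← affineAut_x_one ε' a' h', he]
  have h2 := congrArg (fun p => coeff 0 (pderiv 1 p)) h1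
  have h3 := congrArg (coeff 0) h1
  simp only [map_add, Derivation.map_smul, pderiv_X_self, pderiv_C, add_zero, coeff_smul,
    coeff_zero_one, smul_eq_mul, mul_one] at h2
  simp only [coeff_add, coeff_smul, coeff_zero_X, coeff_zero_C, smul_zero, zero_add] at h3
  exact ⟨h2, h3⟩

/-- The homomorphism `a ↦ τ_a`. -/
def tau : Multiplicative ℂ →* Aut Y where
  toFun a := affineAut 1 a.toAdd (one_mul 1)
  map_one' := Subtype.ext (LinearEquiv.ext fun v => affineHom_one_zero v)
  map_mul' a b := by
    rw [affineAut_mul]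
    exact affineAut_congr (one_mul 1).symm (by rw [one_mul, toAdd_mul])

theorem tau_apply (a : Multiplicative ℂ) : tau a = affineAut 1 a.toAdd (one_mul 1) := rfl

theorem tau_injective : Function.Injective tau := fun a b h => by
  rw [tau_apply, tau_apply] at h
  exact Multiplicative.toAdd.injective (affineAut_injective h).2

/-- A generator of the inner group is a square, and the square of the pair `(ε, b)` has sign `ε² =
1`. Conversely `τ_a` has level `1`, coming from `a x₁`, whose mode `0` vanishes. -/
theorem Inn_eq_range_tau : Inn Y = tau.range := by
  refine le_antisymm (iSup_le fun m => (Subgroup.closure_le _).2 ?_) ?_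
  · rintro σ ⟨a, ha, hσ⟩
    obtain ⟨ρ, rfl⟩ := exists_mul_self_eq σ ha hσ
    obtain ⟨ε, b, h, rfl⟩ := exists_eq_affineAut ρ
    rw [affineAut_mul]
    exact ⟨Multiplicative.ofAdd (ε * b + b), affineAut_congr h.symm rfl⟩
  · rintro _ ⟨a, rfl⟩
    have hmode : ∀ n : ℤ, n ≠ -1 → mode (Y (a.toAdd • x 1)) n = a.toAdd • alphaMode n := by
      intro n _
      rw [map_smul, mode_smul, Y_x_one, mode_alpha]
    refine Subgroup.mem_iSup_of_mem 1 (Subgroup.subset_closure ⟨a.toAdd • x 1, ?_, ?_⟩)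
    · intro j hj
      obtain rfl : j = 0 := by omega
      rw [hmode _ (by norm_num), Nat.cast_zero, alphaMode_zero, smul_zero]
    · have : mode (Y (a.toAdd • x 1)) (1 : ℕ) = shiftDerivation a.toAdd := by
        rw [hmode _ (by norm_num)]
        congr 1
        refine LinearMap.ext fun v => ?_
        have h1 := alphaMode_pos 1 v
        simpa using h1
      rw [this]
      exact isExp_affineHom a.toAdd

theorem mem_Inn {ε a : ℂ} {h : ε * ε = 1} : affineAut ε a h ∈ Inn Y ↔ ε = 1 := by
  rw [Inn_eq_range_tau]
  constructor
  · rintro ⟨b, hb⟩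
    exact (affineAut_injective hb).1.symm
  · rintro rfl
    exact ⟨Multiplicative.ofAdd a, rfl⟩

theorem coeff_affineHom_zero (ε : ℂ) (p : Fock) (d : ℕ+ →₀ ℕ) :
    coeff d (affineHom ε 0 p) = ε ^ d.degree * coeff d p := by
  induction p using MvPolynomial.induction_on generalizing d with
  | C c =>
    rw [show affineHom ε 0 (C c) = C c from (affineHom ε 0).commutes c, coeff_C]
    split_ifs with h
    · rw [← h, map_zero, pow_zero, one_mul]
    · rw [mul_zero]
  | add p q hp hq => rw [map_add, coeff_add, coeff_add, hp, hq, mul_add]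
  | mul_X p i hp =>
    rw [map_mul, affineHom_X, C_0, ite_self, add_zero, mul_left_comm, coeff_C_mul, coeff_mul_X',
      coeff_mul_X']
    split_ifs with h
    · rw [hp, ← mul_assoc, ← pow_succ']
      congr 2
      have h1 : d - Finsupp.single i 1 + Finsupp.single i 1 = d := tsub_add_cancel_of_le (by
        rw [Finsupp.single_le_iff]
        have := Finsupp.mem_support_iff.1 h
        omega)
      conv_rhs => rw [← h1, map_add, Finsupp.degree_single]
    · rw [mul_zero, mul_zero]

/-- A constant has weight `0` while `x₁` has weight `1`. Conversely, for `a = 0` each monomial is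
only multiplied by a power of `ε`. -/
theorem mem_AutZero {ε a : ℂ} {h : ε * ε = 1} : affineAut ε a h ∈ AutZero Y stdGrading ↔ a = 0 := by
  constructor
  · intro hσ
    have h1 : (x 1 : Fock) ∈ stdGrading 1 := by
      have := isWeightedHomogeneous_X ℂ (fun n : ℕ+ => ((n : ℕ) : ℂ)) 1
      rw [PNat.one_coe, Nat.cast_one] at this
      exact this
    have h2 : ε • x 1 + C a ∈ stdGrading 1 := by
      rw [← affineAut_x_one ε a h]
      have h3 := Submodule.mem_map_of_mem
        (f := ((affineAut ε a h : Fock ≃ₗ[ℂ] Fock) : Fock →ₗ[ℂ] Fock)) h1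
      rw [hσ 1] at h3
      exact h3
    by_contra ha
    have h3 := @h2 0 (by simpa using ha)
    rw [map_zero] at h3
    exact zero_ne_one h3
  · rintro rfl Δ
    have hle : (stdGrading Δ).map (((affineAut ε 0 h : Aut Y) : Fock ≃ₗ[ℂ] Fock) : Fock →ₗ[ℂ] Fock) ≤
        stdGrading Δ := by
      rintro _ ⟨p, hp, rfl⟩ d hd
      refine @hp d fun h0 => hd ?_
      change coeff d (affineHom ε 0 p) = 0
      rw [coeff_affineHom_zero, h0, mul_zero]
    refine le_antisymm hle fun p hp => ⟨affineHom ε 0 p, hle ⟨p, hp, rfl⟩, ?_⟩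
    change affineHom ε 0 (affineHom ε 0 p) = p
    rw [affineHom_affineHom, h, mul_zero, zero_add, affineHom_one_zero]

/-- The automorphism `ι` with `ι x₁ = -x₁`. -/
def iota : Aut Y := affineAut (-1) 0 (by norm_num)

theorem AutZero_eq : (AutZero Y stdGrading : Set (Aut Y)) = {1, iota} := by
  have h1 : (1 : Aut Y) = affineAut 1 0 (one_mul 1) := tau.map_one.symm
  rw [h1]
  ext σ
  obtain ⟨ε, a, h, rfl⟩ := exists_eq_affineAut σ
  rw [SetLike.mem_coe, mem_AutZero]
  constructor
  · rintro rfl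
    rcases mul_self_eq_one_iff.1 h with rfl | rfl
    · exact Or.inl rfl
    · exact Or.inr rfl
  · rintro (h2 | h2)
    · exact (affineAut_injective h2).2
    · exact (affineAut_injective h2).2

theorem card_AutZero : Nat.card (AutZero Y stdGrading) = 2 := by
  have : Nat.card (AutZero Y stdGrading) = (AutZero Y stdGrading : Set (Aut Y)).ncard := rfl
  rw [this, AutZero_eq, Set.ncard_pair]
  intro h
  have h1 : (1 : Aut Y) = affineAut 1 0 (one_mul 1) := tau.map_one.symm
  rw [h1] at h
  have := (affineAut_injective h).1
  norm_num at this

/-- Conjugation by the pair `(ε, b)` sends `τ_a` to `τ_{εa}`. -/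
theorem normal_Inn : (Inn Y).Normal := by
  refine ⟨fun σ hσ ρ => ?_⟩
  obtain ⟨ε, a, h, rfl⟩ := exists_eq_affineAut σ
  obtain rfl := mem_Inn.1 hσ
  obtain ⟨ε, b, h', rfl⟩ := exists_eq_affineAut ρ
  have : affineAut ε b h' * affineAut 1 a h = affineAut 1 (ε * a) h * affineAut ε b h' := by
    rw [affineAut_mul, affineAut_mul]
    refine affineAut_congr (by ring) ?_
    linear_combination (-a) * h'
  rw [this, mul_inv_cancel_right]
  exact mem_Inn.2 rfl

theorem isComplement'_Inn_AutZero :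
    Subgroup.IsComplement' (Inn Y) (AutZero Y stdGrading) := by
  refine Subgroup.isComplement'_of_disjoint_and_mul_eq_univ ?_ ?_
  · rw [Subgroup.disjoint_def]
    intro σ h1 h2
    obtain ⟨ε, a, h, rfl⟩ := exists_eq_affineAut σ
    obtain rfl := mem_Inn.1 h1
    obtain rfl := mem_AutZero.1 h2
    exact tau.map_one
  · rw [Set.eq_univ_iff_forall]
    intro σ
    obtain ⟨ε, a, h, rfl⟩ := exists_eq_affineAut σ
    -- Composition multiplies the translation part by the sign of the second factor, so `εa` is
    -- needed in order that `ε · εa = a`.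
    refine ⟨affineAut 1 (ε * a) (one_mul 1), mem_Inn.2 rfl, affineAut ε 0 h, mem_AutZero.2 rfl, ?_⟩
    refine (affineAut_mul _ _ _ _ _ _).trans (affineAut_congr (mul_one ε) ?_)
    linear_combination a * h

end FreeBoson
end

theorem mainTheorem4 :
    -- the operations form a vertex algebra on `ℂ[x₁, x₂, …]` with vacuum `1` and `Y(x₁,z) = α(z)`
    FreeBoson.IsVertexAlgebra FreeBoson.Y 1 ∧
    FreeBoson.Y (FreeBoson.x 1) = FreeBoson.alpha ∧
    -- `Aut V = Inn V ⋊ Aut⁰ V`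
    (FreeBoson.Inn FreeBoson.Y).Normal ∧
    Subgroup.IsComplement' (FreeBoson.Inn FreeBoson.Y)
      (FreeBoson.AutZero FreeBoson.Y FreeBoson.stdGrading) ∧
    -- `Inn V = {τ_a | a ∈ ℂ} ≅ ℂ`, where `τ_a = exp (a ∂/∂x₁)`
    (∃ τ : Multiplicative ℂ ≃* FreeBoson.Inn FreeBoson.Y, ∀ a : ℂ,
      FreeBoson.IsExp (a • (MvPolynomial.pderiv (R := ℂ) (1 : ℕ+)).toLinearMap)
        ((τ (Multiplicative.ofAdd a) : FreeBoson.Aut FreeBoson.Y) :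
          FreeBoson.Fock ≃ₗ[ℂ] FreeBoson.Fock).toLinearMap) ∧
    -- `Aut⁰ V = {id, ι} ≅ ℤ/2ℤ`, where `ι x₁ = -x₁`
    (∃ ι : FreeBoson.Aut FreeBoson.Y,
      (ι : FreeBoson.Fock ≃ₗ[ℂ] FreeBoson.Fock) (FreeBoson.x 1) = -FreeBoson.x 1 ∧
      (FreeBoson.AutZero FreeBoson.Y FreeBoson.stdGrading : Set (FreeBoson.Aut FreeBoson.Y)) =
        {1, ι}) ∧
    Nonempty (FreeBoson.AutZero FreeBoson.Y FreeBoson.stdGrading ≃* Multiplicative (ZMod 2)) ∧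
    -- an automorphism is determined by the image of `x₁`
    (∀ σ ρ : FreeBoson.Aut FreeBoson.Y,
      (σ : FreeBoson.Fock ≃ₗ[ℂ] FreeBoson.Fock) (FreeBoson.x 1) =
        (ρ : FreeBoson.Fock ≃ₗ[ℂ] FreeBoson.Fock) (FreeBoson.x 1) → σ = ρ) ∧
    -- and the possible images of `x₁` are exactly the vectors `a + x₁` and `a - x₁`
    (∀ h : FreeBoson.Fock,
      (∃ σ : FreeBoson.Aut FreeBoson.Y,
        (σ : FreeBoson.Fock ≃ₗ[ℂ] FreeBoson.Fock) (FreeBoson.x 1) = h) ↔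
      ∃ a : ℂ, h = MvPolynomial.C a + FreeBoson.x 1 ∨ h = MvPolynomial.C a - FreeBoson.x 1) := by
  refine ⟨FreeBoson.isVertexAlgebra_Y, FreeBoson.Y_x_one, FreeBoson.normal_Inn,
    FreeBoson.isComplement'_Inn_AutZero,
    ⟨(MonoidHom.ofInjective FreeBoson.tau_injective).trans
      (MulEquiv.subgroupCongr FreeBoson.Inn_eq_range_tau.symm),
      fun a => FreeBoson.isExp_affineHom a⟩,
    ⟨FreeBoson.iota, ?_, FreeBoson.AutZero_eq⟩,
    ⟨mulEquivOfPrimeCardEq (p := 2) FreeBoson.card_AutZero (by simp)⟩,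
    fun σ ρ => FreeBoson.Aut_ext, fun h => ⟨?_, ?_⟩⟩
  · rw [FreeBoson.iota, FreeBoson.affineAut_x_one, map_zero, add_zero, neg_smul, one_smul]
  · rintro ⟨σ, rfl⟩
    obtain ⟨ε, a, hε, rfl⟩ := FreeBoson.exists_eq_affineAut σ
    refine ⟨a, ?_⟩
    rw [FreeBoson.affineAut_x_one]
    rcases mul_self_eq_one_iff.1 hε with rfl | rfl
    · left
      rw [one_smul, add_comm]
    · right
      rw [neg_smul, one_smul, neg_add_eq_sub]
  · rintro ⟨a, rfl | rfl⟩
    · refine ⟨FreeBoson.affineAut 1 a (one_mul 1), ?_⟩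
      rw [FreeBoson.affineAut_x_one, one_smul, add_comm]
    · refine ⟨FreeBoson.affineAut (-1) a (by norm_num), ?_⟩
      rw [FreeBoson.affineAut_x_one, neg_smul, one_smul, neg_add_eq_sub]
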